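/- **Notation.** For $t\in\mathbb R$ let $u_t=(\cos t,\sin t)$ and $v_t=(-\sin t,\cos t)$. For a nonempty compact convex $K\subset\mathbb R^2$ let $h_K(t)=\max_{p\in K}p\cdot u_t$, let $e_K(t)=\{p\in K: p\cdot u_t=h_K(t)\}$, and let $\sigma_K$ be the surface area measure of $K$, so that $\sigma_K(X)=\mathcal H^1\big(\bigcup_{t\in X}e_K(t)\big)$ for Borel sets $X$ of angles. Put $\mathbf x_K(t)=(h_K(t)-1)u_t+(h_K(t+\pi/2)-1)v_t$ (the *inner corner*, or *rotation path*), $Q_K^+(t)=\{p: p\cdot u_t\le h_K(t),\ p\cdot v_t\le h_K(t+\pi/2)\}$ and $Q_K^-(t)=\{p: p\cdot u_t< h_K(t)-1,\ p\cdot v_t< h_K(t+\pi/2)-1\}$. A *cap* (with rotation angle $\pi/2$) is a nonempty compact convex set $K\subset\mathbb R^2$ with $h_K(\pi/2)=1$ and $h_K(3\pi/2)=0$ that is an intersection of closed half-planes $\{p:p\cdot u_t\le c\}$ with normal angles $t\in[0,\pi]\cup\{3\pi/2\}$. Let $\Theta\subset(0,\pi/2)$ be finite and nonempty. A *polygon cap*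 with angle set $\Theta$ is a cap that is an intersection of closed half-planes with normal angles in $\Theta\cup(\Theta+\pi/2)\cup\{\pi/2,3\pi/2\}$. With $|\cdot|$ denoting area, put $$\mathcal A_\Theta(K)=\Big|\{0\le y\le 1\}\cap\bigcap_{t\in\Theta}Q_K^+(t)\Big|-\Big|\{y\ge 0\}\cap\bigcup_{t\in\Theta}Q_K^-(t)\Big| .$$ A *maximum polygon cap* with angle set $\Theta$ is a polygon cap $K$ with angle set $\Theta$ that contains $(0,1)$ and maximizes $\mathcal A_\Theta$ among all polygon caps with angle set $\Theta$. A *balanced maximum cap* is a cap $K$ for which there are powers of two $1<n_1<n_2<\cdots$ and, for each $i$, a maximum polygon cap $K_i$ with angle set $\{\tfrac{j}{n_i}\cdot\tfrac{\pi}{2}:1\le j<n_i\}$, such that $K_i\to K$ in the Hausdorff distance. **Theorem.** Every balanced maximum cap $K$ (with rotation angle $\pi/2$) satisfies the *injectivity condition*: 1. There are measurable functions $r_K,s_K:[0,\pi/2]\to\mathbb R_{\ge0}$, unique up to null sets, such that $\sigma_K=r_K(t)\,dt$ on $[0,\pi/2)$ and $\sigma_K=s_K(t-\pi/2)\,dt$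 on $(\pi/2,\pi]$. 2. The map $\mathbf x_K:[0,\pi/2]\to\mathbb R^2$ is continuously differentiable. 3. For all $t\in(0,\pi/2)$, $\mathbf x_K'(t)\cdot u_t<0$ and $\mathbf x_K'(t)\cdot v_t>0$. Consequently the rotation path does not intersect itself: $\mathbf x_K$ is injective on $[0,\pi/2]$. -/

import Mathlib

open Real Set Filter Topology MeasureTheory
open scoped NNReal ENNReal

noncomputable section

namespace Sofa

/-- The Euclidean plane. -/
abbrev Plane : Type := EuclideanSpace ℝ (Fin 2)

/-- `u_t = (cos t, sin t)`. -/
def u (t : ℝ) : Plane := !₂[cos t, sin t]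

/-- `v_t = (-sin t, cos t)`. -/
def v (t : ℝ) : Plane := !₂[-sin t, cos t]

/-- The closed half-plane `H_-(t, h)` with normal angle `t`. -/
def closedLower (t h : ℝ) : Set Plane := {p | inner ℝ p (u t) ≤ h}

/-- The open half-plane `H_-^∘(t, h)`. -/
def openLower (t h : ℝ) : Set Plane := {p | inner ℝ p (u t) < h}

/-- The closed half-plane `H_+(t, h)`. -/
def closedUpper (t h : ℝ) : Set Plane := {p | h ≤ inner ℝ p (u t)}

/-- `K` is an intersection of closed half-planes whose normal angles all lie in `A`. -/
def IsInterOfHalfPlanes (A : Set ℝ) (K : Set Plane) : Prop :=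
  ∃ F : Set (ℝ × ℝ), (∀ q ∈ F, q.1 ∈ A) ∧ K = ⋂ q ∈ F, closedLower q.1 q.2

/-- The support function `h_K(t) = sup {p · u_t : p ∈ K}` of a convex body
(angles are real numbers, and `h_K` is `2π`-periodic). -/
def supp (K : ConvexBody Plane) (t : ℝ) : ℝ :=
  sSup ((fun p : Plane => inner ℝ p (u t)) '' (K : Set Plane))

/-- The edge `e_K(t)`: the intersection of `K` with its supporting line of normal angle `t`. -/
def edge (K : ConvexBody Plane) (t : ℝ) : Set Plane :=
  {p | p ∈ (K : Set Plane) ∧ inner ℝ p (u t) = supp K t}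

/-- The surface area measure `σ_K`: a set `X` of angles is sent to the one-dimensional Hausdorff
measure of the union of the edges of `K` with normal angle in `X`. Being defined through the
Hausdorff outer measure, it is an outer measure on angles. If `K` has nonempty interior, its values
on the Borel subsets of `[0, 2π)` are those of the surface area measure of `K`. -/
def surfaceArea (K : ConvexBody Plane) : OuterMeasure ℝ where
  measureOf X := Measure.hausdorffMeasure 1 (⋃ t ∈ X, edge K t)
  empty := by simp
  mono h := measure_mono (biUnion_mono h fun _ _ => Subset.rfl)
  iUnion_nat s _ := by
    rw [biUnion_iUnion]
    exact measure_iUnion_le _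

/-- The inner corner `x_K(t)` of the supporting hallway of `K` with angle `t`. -/
def innerCorner (K : ConvexBody Plane) (t : ℝ) : Plane :=
  (supp K t - 1) • u t + (supp K (t + π / 2) - 1) • v t

/-- The closed quarter-plane `Q_K^+(t)` bounded by the outer walls of the supporting hallway. -/
def outerQuadrant (K : ConvexBody Plane) (t : ℝ) : Set Plane :=
  closedLower t (supp K t) ∩ closedLower (t + π / 2) (supp K (t + π / 2))

/-- The open quarter-plane `Q_K^-(t)` bounded by the inner walls of the supporting hallway. -/
def innerQuadrant (K : ConvexBody Plane) (t : ℝ) : Set Plane :=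
  openLower t (supp K t - 1) ∩ openLower (t + π / 2) (supp K (t + π / 2) - 1)

/-- The fan `F_ω`. -/
def fan (ω : ℝ) : Set Plane := closedUpper ω 0 ∩ closedUpper (π / 2) 0

/-- The parallelogram `P_ω`: the intersection of the strip `0 ≤ y ≤ 1` and of the strip
`0 ≤ x ≤ 1` rotated by `ω`. -/
def parallelogram (ω : ℝ) : Set Plane :=
  (closedUpper (π / 2) 0 ∩ closedLower (π / 2) 1) ∩ (closedUpper ω 0 ∩ closedLower ω 1)

/-- The upper right vertex `o_ω` of `P_ω`. -/
def topCorner (ω : ℝ) : Plane := !₂[tan (π / 4 - ω / 2), 1]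

/-- `K` is a cap with rotation angle `ω ∈ (0, π/2]`. -/
structure IsCap (ω : ℝ) (K : ConvexBody Plane) : Prop where
  angle_mem : ω ∈ Ioc 0 (π / 2)
  supp_angle : supp K ω = 1
  supp_top : supp K (π / 2) = 1
  supp_angle_add_pi : supp K (ω + π) = 0
  supp_bottom : supp K (3 * π / 2) = 0
  isInter : IsInterOfHalfPlanes
    ((Icc 0 ω ∪ Icc (π / 2) (ω + π / 2)) ∪ {ω + π, 3 * π / 2}) (K : Set Plane)

/-- `Θ^◇ = Θ ∪ (Θ + π/2) ∪ {ω, π/2}`. -/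
def angleDomain (ω : ℝ) (Θ : Set ℝ) : Set ℝ :=
  Θ ∪ (fun t => t + π / 2) '' Θ ∪ {ω, π / 2}

/-- `K` is a polygon cap with angle set `Θ` and rotation angle `ω`. -/
structure IsPolygonCap (ω : ℝ) (Θ : Set ℝ) (K : ConvexBody Plane) : Prop where
  isCap : IsCap ω K
  isInter : IsInterOfHalfPlanes (angleDomain ω Θ ∪ {ω + π, 3 * π / 2}) (K : Set Plane)

/-- The polygon cap `C_Θ(K)` approximating `K` from outside. -/
def polygonCap (ω : ℝ) (Θ : Set ℝ) (K : ConvexBody Plane) : Set Plane :=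
  parallelogram ω ∩ ⋂ t ∈ Θ, outerQuadrant K t

/-- The polygon niche `N_Θ(K) = F_ω ∩ ⋃_{t ∈ Θ} Q_K^-(t)`. -/
def polygonNiche (ω : ℝ) (Θ : Set ℝ) (K : ConvexBody Plane) : Set Plane :=
  fan ω ∩ ⋃ t ∈ Θ, innerQuadrant K t

/-- The polygon sofa area functional `A_Θ(K) = |C_Θ(K)| - |N_Θ(K)|`. -/
def polygonArea (ω : ℝ) (Θ : Set ℝ) (K : ConvexBody Plane) : ℝ :=
  volume.real (polygonCap ω Θ K) - volume.real (polygonNiche ω Θ K)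

/-- `K` is a maximum polygon cap with angle set `Θ` and rotation angle `ω`. -/
structure IsMaximumPolygonCap (ω : ℝ) (Θ : Set ℝ) (K : ConvexBody Plane) : Prop where
  isPolygonCap : IsPolygonCap ω Θ K
  topCorner_mem : topCorner ω ∈ (K : Set Plane)
  maximal : ∀ K' : ConvexBody Plane, IsPolygonCap ω Θ K' →
    polygonArea ω Θ K' ≤ polygonArea ω Θ K

/-- The uniform angle set `Θ_{ω,n} = {(i/n) ω : 1 ≤ i < n}`. -/
def uniformAngleSet (ω : ℝ) (n : ℕ) : Set ℝ :=
  {t | ∃ i : ℕ, 1 ≤ i ∧ i < n ∧ t = (i : ℝ) / (n : ℝ) * ω}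

/-- `K` is a balanced maximum cap with rotation angle `ω`. The topology on convex bodies is that
of the Hausdorff distance. -/
structure IsBalancedMaximumCap (ω : ℝ) (K : ConvexBody Plane) : Prop where
  isCap : IsCap ω K
  exists_seq : ∃ (n : ℕ → ℕ) (L : ℕ → ConvexBody Plane),
    StrictMono n ∧ (∀ i, 1 < n i ∧ ∃ k : ℕ, n i = 2 ^ k) ∧
    (∀ i, IsMaximumPolygonCap ω (uniformAngleSet ω (n i)) (L i)) ∧
    Tendsto L atTop (𝓝 K)

/-- On the angles in `I` (a subset of `[0, 2π)`), the surface area measure of `K` is `ρ(t) dt`. -/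
def HasSurfaceDensityOn (K : ConvexBody Plane) (I : Set ℝ) (ρ : ℝ → ℝ≥0) : Prop :=
  ∀ X : Set ℝ, MeasurableSet X → X ⊆ I → surfaceArea K X = ∫⁻ t in X, (ρ t : ℝ≥0∞)

/-- The pair `(r_K, s_K)` of densities: `σ_K = r(t) dt` on `[0, π/2)` and
`σ_K = s(t - π/2) dt` on `(π/2, π]`. -/
def IsDensityPair (K : ConvexBody Plane) (r s : ℝ → ℝ≥0) : Prop :=
  Measurable r ∧ Measurable s ∧
    HasSurfaceDensityOn K (Ico 0 (π / 2)) r ∧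
    HasSurfaceDensityOn K (Ioc (π / 2) π) (fun t => s (t - π / 2))

/-- The injectivity condition on a cap `K` with rotation angle `π/2`. -/
structure InjectivityCondition (K : ConvexBody Plane) : Prop where
  exists_density : ∃ r s : ℝ → ℝ≥0, IsDensityPair K r s ∧
    ∀ r' s' : ℝ → ℝ≥0, IsDensityPair K r' s' →
      r' =ᵐ[volume.restrict (Icc 0 (π / 2))] r ∧ s' =ᵐ[volume.restrict (Icc 0 (π / 2))] s
  contDiffOn_innerCorner : ContDiffOn ℝ 1 (innerCorner K) (Icc 0 (π / 2))
  deriv_inner_u_neg : ∀ t ∈ Ioo 0 (π / 2), inner ℝ (deriv (innerCorner K) t) (u t) < 0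
  deriv_inner_v_pos : ∀ t ∈ Ioo 0 (π / 2), 0 < inner ℝ (deriv (innerCorner K) t) (v t)

end Sofa

end

noncomputable section

namespace Sofa

/-! Take a maximum polygon cap with step δ = π/(2n). At each angle t = jδ, measure from the outer
corner of the hallway the distances `fp ≤ fm` to the two ends of the edge of normal angle t, and `gm
≤ gp` to those of the edge of normal angle t + π/2. If f and g are the limits of these arm lengths,
the inner corner of the limit cap moves with velocity (1 - f) u_t + (g - 1) v_t. So condition 3 says
that f > 1 and g > 1, while regularity amounts to edges of length O(δ). Both come from maximality.

First variation (`IsMaximumPolygonCap.edge_le`): pushing the wall of angle t outwards by ε enlarges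
the cap by about ε times the length of its edge, and the niche by at most about ε times the part of
the inner wall that the two neighbouring quadrants leave visible. So an edge is no longer than the
visible wall, and the visible wall is controlled by the arm lengths. `IsChain` records the resulting
discrete dynamics: from one angle to the next the pair of arms is rotated by δ, after which each arm
is corrected by the length of its edge.

While g stays above 1, f grows by about δ/2 or more per step (`step_ge`). If g fell below 1 after f
had passed 1, the edge of angle t + π/2 would vanish and the other would have length at most about
δ/2. Then f² + g² - g would almost not decrease, f would remain above 1 and g would keep decreasing,
whereas g = 1 at the last angle (`trap_step`, `ge_of_initial`). For the start of this argument,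
comparison with a stadium gives width at least (1 + π)/2 > 2 (`le_width`), so one of the two extreme
arms exceeds 1 by a fixed amount; a reflection makes it the initial one. The outcome is
`HasArmBounds`, with a constant independent of n.

Edges of length at most Cδ bound the second differences of the support function by those of a disc
of radius 3C. A discrete Sturm comparison then puts the support function below that of such a disc
touching the cap at a given edge, and this survives in the limit (`IsRound`). Hence edges are points
depending on the angle in a Lipschitz way, which yields the densities and the C¹ regularity. The
limits of the arm bounds are f ≥ 1 + t/2 and g ≥ 1 + (π/2 - t)/2, and these signs make the abscissa
of the inner corner strictly decreasing. -/

theorem inner_u (p : Plane) (t : ℝ) : inner ℝ p (u t) = p 0 * cos t + p 1 * sin t := by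
  simp [u, PiLp.inner_apply, Fin.sum_univ_two, mul_comm]

theorem inner_v (p : Plane) (t : ℝ) : inner ℝ p (v t) = -(p 0 * sin t) + p 1 * cos t := by
  simp [v, PiLp.inner_apply, Fin.sum_univ_two, mul_comm]

@[simp] theorem u_apply_zero (t : ℝ) : u t 0 = cos t := rfl

@[simp] theorem u_apply_one (t : ℝ) : u t 1 = sin t := rfl

@[simp] theorem v_apply_zero (t : ℝ) : v t 0 = -sin t := rfl

@[simp] theorem v_apply_one (t : ℝ) : v t 1 = cos t := rfl

theorem u_add_pi_div_two (t : ℝ) : u (t + π / 2) = v t := by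
  simp [u, v, cos_add_pi_div_two, sin_add_pi_div_two]

theorem u_add_two_pi (t : ℝ) : u (t + 2 * π) = u t := by
  simp [u]

@[simp] theorem norm_u (t : ℝ) : ‖u t‖ = 1 := by
  simp [u, EuclideanSpace.norm_eq, Fin.sum_univ_two]

@[simp] theorem norm_v (t : ℝ) : ‖v t‖ = 1 := by
  rw [← u_add_pi_div_two, norm_u]

/-- The inner product with `u b` as a combination of those with `u a` and `u c`. -/
theorem sin_mul_inner_u (p : Plane) (a b c : ℝ) :
    sin (c - a) * inner ℝ p (u b) =
      sin (c - b) * inner ℝ p (u a) + sin (b - a) * inner ℝ p (u c) := by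
  simp only [inner_u, sin_sub]
  ring

theorem inner_u_eq_frame (p : Plane) (t s : ℝ) :
    inner ℝ p (u s) = inner ℝ p (u t) * cos (s - t) + inner ℝ p (v t) * sin (s - t) := by
  simp only [inner_u, inner_v, sin_sub, cos_sub]
  linear_combination (-(p 0 * cos s) - p 1 * sin s) * sin_sq_add_cos_sq t

theorem inner_v_eq_frame (p : Plane) (t s : ℝ) :
    inner ℝ p (v s) = -(inner ℝ p (u t) * sin (s - t)) + inner ℝ p (v t) * cos (s - t) := by
  simp only [inner_u, inner_v, sin_sub, cos_sub]
  linear_combination (p 0 * sin s - p 1 * cos s) * sin_sq_add_cos_sq t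

theorem eq_frame (p : Plane) (t : ℝ) : p = inner ℝ p (u t) • u t + inner ℝ p (v t) • v t := by
  ext i
  fin_cases i
  · simp [inner_u, inner_v]
    linear_combination -(p 0) * sin_sq_add_cos_sq t
  · simp [inner_u, inner_v]
    linear_combination -(p 1) * sin_sq_add_cos_sq t

theorem norm_le_abs_add_abs (p : Plane) (t : ℝ) :
    ‖p‖ ≤ |inner ℝ p (u t)| + |inner ℝ p (v t)| := by
  conv_lhs => rw [eq_frame p t]
  refine (norm_add_le _ _).trans ?_
  simp [norm_smul]

theorem inner_frame_u (a b t : ℝ) : inner ℝ (a • u t + b • v t) (u t) = a := by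
  simp [inner_u]
  linear_combination a * sin_sq_add_cos_sq t

theorem inner_frame_v (a b t : ℝ) : inner ℝ (a • u t + b • v t) (v t) = b := by
  simp [inner_v]
  linear_combination b * sin_sq_add_cos_sq t

theorem continuous_inner_u (t : ℝ) : Continuous fun p : Plane => (inner ℝ p (u t) : ℝ) := by
  fun_prop

theorem abs_inner_u_le (p : Plane) (t : ℝ) : |inner ℝ p (u t)| ≤ ‖p‖ := by
  simpa using abs_real_inner_le_norm p (u t)

/-! ### Support functions of convex bodies -/

section Support

variable (K : ConvexBody Plane)

theorem bddAbove_inner (t : ℝ) :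
    BddAbove ((fun p : Plane => inner ℝ p (u t)) '' (K : Set Plane)) :=
  (K.isCompact.image (continuous_inner_u t)).bddAbove

variable {K}

theorem inner_le_supp {p : Plane} (hp : p ∈ (K : Set Plane)) (t : ℝ) :
    inner ℝ p (u t) ≤ supp K t :=
  le_csSup (bddAbove_inner K t) (mem_image_of_mem _ hp)

variable (K) in
theorem exists_mem_edge (t : ℝ) : ∃ p, p ∈ edge K t := by
  obtain ⟨p, hp, h⟩ := K.isCompact.exists_sSup_image_eq K.nonempty
    (continuous_inner_u t).continuousOn
  exact ⟨p, hp, h.symm⟩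

theorem supp_le {t c : ℝ} (h : ∀ p ∈ (K : Set Plane), inner ℝ p (u t) ≤ c) : supp K t ≤ c := by
  obtain ⟨p, hp, h'⟩ := exists_mem_edge K t
  exact h' ▸ h p hp

theorem supp_mono {L : ConvexBody Plane} (h : (K : Set Plane) ⊆ L) (t : ℝ) :
    supp K t ≤ supp L t :=
  supp_le fun _ hp => inner_le_supp (h hp) t

variable (K) in
theorem supp_add_two_pi (t : ℝ) : supp K (t + 2 * π) = supp K t := by
  simp [supp, u_add_two_pi]

variable (K) in
-- Trigonometric convexity of the support function: at a point of the edge of angle b,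
-- `sin_mul_inner_u` has nonnegative coefficients on the right.
theorem sin_mul_supp_le {a b c : ℝ} (hab : a ≤ b) (hbc : b ≤ c) (hac : c - a ≤ π) :
    sin (c - a) * supp K b ≤ sin (c - b) * supp K a + sin (b - a) * supp K c := by
  obtain ⟨p, hp, h⟩ := exists_mem_edge K b
  rw [← h, sin_mul_inner_u]
  have h1 : 0 ≤ sin (c - b) := sin_nonneg_of_nonneg_of_le_pi (by linarith) (by linarith)
  have h2 : 0 ≤ sin (b - a) := sin_nonneg_of_nonneg_of_le_pi (by linarith) (by linarith)
  gcongr <;> exact inner_le_supp hp _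

variable (K) in
theorem exists_abs_supp_le : ∃ M, ∀ t, |supp K t| ≤ M := by
  obtain ⟨M, hM⟩ := K.isBounded.exists_norm_le
  refine ⟨M, fun t => ?_⟩
  obtain ⟨p, hp, h⟩ := exists_mem_edge K t
  rw [← h]
  exact (abs_inner_u_le p t).trans (hM p hp)

theorem supp_le_supp_add_dist (K L : ConvexBody Plane) (t : ℝ) :
    supp K t ≤ supp L t + dist K L := by
  refine supp_le fun p hp => le_of_forall_pos_le_add fun ε hε => ?_
  obtain ⟨q, hq, hpq⟩ := Metric.exists_dist_lt_of_hausdorffDist_lt hp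
    (lt_add_of_pos_right (Metric.hausdorffDist (K : Set Plane) L) hε)
    ConvexBody.hausdorffEDist_ne_top
  rw [ConvexBody.hausdorffDist_coe, dist_eq_norm] at hpq
  have h1 := inner_le_supp hq t
  have h2 := (abs_le.1 (abs_inner_u_le (p - q) t)).2
  rw [inner_sub_left] at h2
  linarith

theorem abs_supp_sub_le (K L : ConvexBody Plane) (t : ℝ) :
    |supp K t - supp L t| ≤ dist K L := by
  have h1 := supp_le_supp_add_dist K L t
  have h2 := supp_le_supp_add_dist L K t
  rw [dist_comm] at h2
  rw [abs_le]
  constructor <;> linarith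

/-- A half-plane of the family contains K, so its offset is at least the support number and can be
lowered to it. -/
theorem mem_iff_of_isInterOfHalfPlanes {A : Set ℝ} (h : IsInterOfHalfPlanes A (K : Set Plane))
    (p : Plane) : p ∈ (K : Set Plane) ↔ ∀ t ∈ A, inner ℝ p (u t) ≤ supp K t := by
  refine ⟨fun hp t _ => inner_le_supp hp t, fun hp => ?_⟩
  obtain ⟨F, hF, hK⟩ := h
  rw [hK]
  refine mem_iInter₂.2 fun q hq => (hp q.1 (hF q hq)).trans (supp_le fun p' hp' => ?_)
  rw [hK] at hp'
  exact mem_iInter₂.1 hp' q hq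

end Support

/-! ### Areas in rotated frames -/

section FrameMeasure

/-- Coordinates in the frame `(u t, v t)`. -/
def frame (t : ℝ) (p : Plane) : ℝ × ℝ := (inner ℝ p (u t), inner ℝ p (v t))

/-- The rotation by the angle `-t`. -/
def rotation (t : ℝ) : Plane ≃ₗᵢ[ℝ] Plane where
  toFun p := !₂[inner ℝ p (u t), inner ℝ p (v t)]
  invFun q := q 0 • u t + q 1 • v t
  map_add' p q := by
    ext i
    fin_cases i <;> simp [inner_add_left]
  map_smul' c p := by
    ext i
    fin_cases i <;> simp [inner_smul_left]
  left_inv p := by simpa using (eq_frame p t).symm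
  right_inv q := by
    ext i
    fin_cases i
    · simpa using inner_frame_u (q 0) (q 1) t
    · simpa using inner_frame_v (q 0) (q 1) t
  norm_map' p := by
    simp only [LinearEquiv.coe_mk, LinearMap.coe_mk, AddHom.coe_mk, EuclideanSpace.norm_eq,
      Fin.sum_univ_two, norm_eq_abs, sq_abs]
    congr 1
    simp only [Matrix.cons_val_zero, Matrix.cons_val_one, inner_u, inner_v]
    linear_combination (p 0 ^ 2 + p 1 ^ 2) * sin_sq_add_cos_sq t

theorem measurePreserving_frame (t : ℝ) :
    MeasurePreserving (frame t) (volume : Measure Plane) (volume : Measure (ℝ × ℝ)) := by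
  have h1 := (rotation t).measurePreserving
  have h2 := PiLp.volume_preserving_ofLp (Fin 2)
  have h3 := MeasureTheory.volume_preserving_finTwoArrow ℝ
  exact h3.comp (h2.comp h1)

/-- The set of the points whose coordinates in the frame `(u t, v t)` lie in `I` and `J`. -/
def box (t : ℝ) (I J : Set ℝ) : Set Plane := {p | inner ℝ p (u t) ∈ I ∧ inner ℝ p (v t) ∈ J}

theorem volume_box (t : ℝ) {I J : Set ℝ} (hI : MeasurableSet I) (hJ : MeasurableSet J) :
    volume (box t I J) = volume I * volume J := by
  have h := (measurePreserving_frame t).measure_preimage (hI.prod hJ).nullMeasurableSet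
  rw [Measure.volume_eq_prod, Measure.prod_prod] at h
  exact h

theorem measurableSet_box (t : ℝ) {I J : Set ℝ} (hI : MeasurableSet I) (hJ : MeasurableSet J) :
    MeasurableSet (box t I J) :=
  (measurePreserving_frame t).measurable (hI.prod hJ)

end FrameMeasure

/-! ### The discrete dynamics of the arm lengths -/

/-- Estimates for a step of length `δ`: they hold for `c = cos δ`, `s = sin δ`, `τ = tan (δ / 2)`,
`T = tan δ` and `σ = (cos δ)⁻¹ - 1`. -/
structure IsStep (δ c s τ T σ : ℝ) : Prop where
  pos : 0 < δ
  le : δ ≤ 1 / 4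
  c_le : c ≤ 1
  le_c : 1 - δ ^ 2 ≤ c
  s_le : s ≤ δ
  le_s : δ - δ ^ 2 ≤ s
  sq_add_sq : c ^ 2 + s ^ 2 = 1
  τ_nonneg : 0 ≤ τ
  τ_le : τ ≤ δ / 2 + δ ^ 2
  T_le : T ≤ δ + δ ^ 2
  le_T : δ - δ ^ 2 ≤ T
  σ_nonneg : 0 ≤ σ
  σ_le : σ ≤ δ ^ 2

theorem isStep {δ : ℝ} (h0 : 0 < δ) (h1 : δ ≤ 1 / 4) :
    IsStep δ (cos δ) (sin δ) ((1 - cos δ) / sin δ) (sin δ / cos δ) (1 / cos δ - 1) := by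
  have hc := one_sub_sq_div_two_le_cos (x := δ)
  have hs := sin_gt_sub_cube h0
  have hc1 := cos_le_one δ
  have hs1 := sin_le h0.le
  have hδ2 : δ ^ 2 ≤ 1 / 16 := by nlinarith
  have hδ3 : δ ^ 3 ≤ δ ^ 2 / 4 := by nlinarith
  have hs0 : 0 < sin δ := by nlinarith
  have hc0 : 0 < cos δ := by linarith
  have hs2 : δ * (1 - δ / 8) ≤ sin δ := by nlinarith
  refine ⟨h0, h1, hc1, by nlinarith, hs1, by nlinarith, cos_sq_add_sin_sq δ, ?_, ?_, ?_, ?_, ?_, ?_⟩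
  · exact div_nonneg (by linarith) hs0.le
  · rw [div_le_iff₀ hs0]
    nlinarith [mul_le_mul_of_nonneg_left hs2 (by positivity : 0 ≤ δ / 2 + δ ^ 2)]
  · rw [div_le_iff₀ hc0]
    nlinarith [mul_le_mul_of_nonneg_left hc (by positivity : 0 ≤ δ + δ ^ 2)]
  · rw [le_div_iff₀ hc0]
    have : 0 ≤ δ - δ ^ 2 := by nlinarith
    nlinarith [mul_le_mul_of_nonneg_left hc1 this]
  · rw [sub_nonneg, le_div_iff₀ hc0]
    linarith
  · rw [sub_le_iff_le_add, div_le_iff₀ hc0]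
    nlinarith [mul_le_mul_of_nonneg_left hc (by positivity : 0 ≤ δ ^ 2 + 1)]

/-- The arm lengths of the hallways of a polygon cap with balanced edges: `fm j` and `fp j` are the
distances from the outer corner to the two ends of the edge of angle `j δ`, and `gm j` and `gp j`
the distances to the two ends of the edge of angle `j δ + π / 2`. -/
structure IsChain (n : ℕ) (δ c s τ T σ M : ℝ) (fm fp gm gp : ℕ → ℝ) : Prop where
  fm_succ : ∀ j < n, fm (j + 1) = c * fp j + s * gp j
  gm_succ : ∀ j < n, gm (j + 1) = c * gp j - s * fp j
  fp_zero : fp 0 = 1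
  gm_last : gm n = 1
  fp_mem : ∀ j < n, fp j ∈ Icc 0 M
  gp_mem : ∀ j < n, gp j ∈ Icc 0 M
  fm_mem : ∀ j, 1 ≤ j → j ≤ n → fm j ∈ Icc 0 M
  gm_mem : ∀ j, 1 ≤ j → j ≤ n → gm j ∈ Icc 0 M
  fp_le : ∀ j, 1 ≤ j → j < n → fp j ≤ fm j
  gm_le : ∀ j, 1 ≤ j → j < n → gm j ≤ gp j
  bal_f : ∀ j, 1 ≤ j → j < n → fm j - fp j ≤
    max (max (fp j - 1 + τ) (T * (1 - gp j) + σ)) 0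
  bal_f' : ∀ j, 1 ≤ j → j < n → fm j - fp j ≤ max (T * (gm j - 1) + σ) 0 +
    max (max (fp j - 1 + τ) (T * (1 - gp j) + σ) - (fm j - 1 - τ)) 0
  bal_g : ∀ j, 1 ≤ j → j < n → gp j - gm j ≤
    max (max (gm j - 1 + τ) (T * (1 - fm j) + σ)) 0
  bal_g' : ∀ j, 1 ≤ j → j < n → gp j - gm j ≤ max (T * (fp j - 1) + σ) 0 +
    max (max (gm j - 1 + τ) (T * (1 - fm j) + σ) - (gp j - 1 - τ)) 0

namespace IsChain

variable {n : ℕ} {δ c s τ T σ M : ℝ} {fm fp gm gp : ℕ → ℝ}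

theorem mirror (H : IsChain n δ c s τ T σ M fm fp gm gp) (hst : IsStep δ c s τ T σ) :
    IsChain n δ c s τ T σ M (fun j => gp (n - j)) (fun j => gm (n - j))
      (fun j => fp (n - j)) (fun j => fm (n - j)) where
  fm_succ j hj := by
    obtain ⟨i, rfl⟩ := Nat.exists_eq_add_of_lt hj
    have h1 := H.fm_succ i (by omega)
    have h2 := H.gm_succ i (by omega)
    rw [show j + i + 1 - (j + 1) = i by omega, show j + i + 1 - j = i + 1 by omega, h1, h2]
    linear_combination -gp i * hst.sq_add_sq
  gm_succ j hj := by
    obtain ⟨i, rfl⟩ := Nat.exists_eq_add_of_lt hj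
    have h1 := H.fm_succ i (by omega)
    have h2 := H.gm_succ i (by omega)
    rw [show j + i + 1 - (j + 1) = i by omega, show j + i + 1 - j = i + 1 by omega, h1, h2]
    linear_combination -fp i * hst.sq_add_sq
  fp_zero := by simpa using H.gm_last
  gm_last := by simpa using H.fp_zero
  fp_mem j hj := H.gm_mem _ (by omega) (by omega)
  gp_mem j hj := H.fm_mem _ (by omega) (by omega)
  fm_mem j h1 hj := H.gp_mem _ (by omega)
  gm_mem j h1 hj := H.fp_mem _ (by omega)
  fp_le j h1 hj := H.gm_le _ (by omega) (by omega)
  gm_le j h1 hj := H.fp_le _ (by omega) (by omega)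
  bal_f j h1 hj := H.bal_g _ (by omega) (by omega)
  bal_f' j h1 hj := H.bal_g' _ (by omega) (by omega)
  bal_g j h1 hj := H.bal_f _ (by omega) (by omega)
  bal_g' j h1 hj := H.bal_f' _ (by omega) (by omega)

/-- When `fp j - 1 + τ` is the larger bound, it exceeds `fm j - 1 - τ` by exactly 2τ minus the edge
length. The edge length thus reappears on the right with the opposite sign, which is what later
produces the factor 1/2. -/
theorem edge_le (H : IsChain n δ c s τ T σ M fm fp gm gp) {j : ℕ} (h1 : 1 ≤ j) (hj : j < n) :
    fm j - fp j ≤ max (max (T * (1 - gp j) + σ) 0)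
      (max (T * (gm j - 1) + σ) 0 + max (2 * τ - (fm j - fp j)) 0) := by
  rcases le_total (fp j - 1 + τ) (T * (1 - gp j) + σ) with h | h
  · have := H.bal_f j h1 hj
    rw [max_eq_right h] at this
    exact this.trans (le_max_left _ _)
  · have := H.bal_f' j h1 hj
    rw [max_eq_left h] at this
    refine le_max_of_le_right (this.trans_eq ?_)
    ring_nf

theorem edge_le_const (H : IsChain n δ c s τ T σ M fm fp gm gp) (hst : IsStep δ c s τ T σ)
    {j : ℕ} (h1 : 1 ≤ j) (hj : j < n) : fm j - fp j ≤ (2 * M + 4) * δ := by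
  have h := H.edge_le h1 hj
  obtain ⟨p1, p2, p3, p4, p5, p6, p7, p8, p9, p10, p11, p12, p13⟩ := hst
  obtain ⟨a1, a2⟩ := H.gp_mem j hj
  obtain ⟨b1, b2⟩ := H.gm_mem j h1 hj.le
  have hT0 : 0 ≤ T := by nlinarith
  have hT2 : T ≤ 2 * δ := by nlinarith
  have hσ : σ ≤ δ := by nlinarith
  have hM : 0 ≤ M := a1.trans a2
  have e1 : max (T * (1 - gp j) + σ) 0 ≤ 3 * δ :=
    max_le (by nlinarith [mul_nonneg hT0 a1]) (by linarith)
  have e2 : max (T * (gm j - 1) + σ) 0 ≤ 2 * δ * M + δ :=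
    max_le (by nlinarith [mul_le_mul hT2 b2 b1 (by linarith : (0:ℝ) ≤ 2 * δ)]) (by positivity)
  have hl : 0 ≤ fm j - fp j := sub_nonneg.2 (H.fp_le j h1 hj)
  have e3 : max (2 * τ - (fm j - fp j)) 0 ≤ 2 * δ := max_le (by nlinarith) (by linarith)
  refine h.trans (max_le (by nlinarith) (by nlinarith))

/-- As long as the arm length `gm` stays above `1`, the arm length `fm` grows. -/
theorem step_ge (H : IsChain n δ c s τ T σ M fm fp gm gp) (hst : IsStep δ c s τ T σ)
    {B : ℝ} (hB : 0 ≤ B) {j : ℕ} (h1 : 1 ≤ j) (hj : j < n) (hg : 1 - B * δ ≤ gm j) :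
    fm j + δ / 2 - (4 * M + 3 * B + 6) * δ ^ 2 ≤ fm (j + 1) := by
  have h := H.edge_le h1 hj
  rw [H.fm_succ j hj]
  obtain ⟨p1, p2, p3, p4, p5, p6, p7, p8, p9, p10, p11, p12, p13⟩ := hst
  obtain ⟨a1, a2⟩ := H.gp_mem j hj
  obtain ⟨b1, b2⟩ := H.gm_mem j h1 hj.le
  obtain ⟨c1, c2⟩ := H.fm_mem j h1 hj.le
  obtain ⟨d1, d2⟩ := H.fp_mem j hj
  have hgg := H.gm_le j h1 hj
  have hT0 : 0 ≤ T := by nlinarith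
  have hT2 : T ≤ 2 * δ := by nlinarith
  have hM : 0 ≤ M := a1.trans a2
  have hδ2 : 0 ≤ δ ^ 2 := sq_nonneg _
  have k1 : fp j - δ ^ 2 * M ≤ c * fp j := by nlinarith [mul_nonneg hδ2 d1]
  have k2 : δ * gm j - δ ^ 2 * M ≤ s * gp j := by nlinarith [mul_nonneg p1.le b1]
  set l := fm j - fp j with hl
  have e1 : max (T * (1 - gp j) + σ) 0 ≤ (2 * B + 1) * δ ^ 2 := by
    refine max_le ?_ (by positivity)
    have : T * (1 - gp j) ≤ T * (B * δ) := by gcongr; linarith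
    nlinarith [mul_le_mul_of_nonneg_right hT2 (mul_nonneg hB p1.le)]
  have hlow : δ - B * δ ^ 2 ≤ δ * gm j := by nlinarith
  have m1 : 0 ≤ M * δ ^ 2 := mul_nonneg hM hδ2
  have m2 : 0 ≤ B * δ ^ 2 := mul_nonneg hB hδ2
  have m3 : δ ^ 2 * gm j ≤ δ ^ 2 * M := mul_le_mul_of_nonneg_left b2 hδ2
  -- Up to O(δ²), either l is zero, or the term 2τ - l is inactive and l ≤ max(δ (gm - 1), 0), or it
  -- is active and 2l ≤ max(δ (gm - 1), 0) + δ. Each case suffices because gm is at least 1 up to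
  -- O(δ).
  have key : l ≤ δ * gm j - δ / 2 + (2 * M + 3 * B + 4) * δ ^ 2 := by
    rcases le_max_iff.1 h with h | h
    · linarith
    · rcases le_total (gm j) 1 with hg1 | hg1
      · have e2 : max (T * (gm j - 1) + σ) 0 ≤ δ ^ 2 :=
          max_le (by linarith [mul_nonpos_of_nonneg_of_nonpos hT0 (sub_nonpos.2 hg1)]) hδ2
        rcases max_cases (2 * τ - l) 0 with ⟨h3, -⟩ | ⟨h3, -⟩ <;> rw [h3] at h <;> linarith
      · have m4 := mul_nonneg p1.le (sub_nonneg.2 hg1)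
        have e2 : max (T * (gm j - 1) + σ) 0 ≤ δ * (gm j - 1) + δ ^ 2 * M + δ ^ 2 := by
          refine max_le ?_ (by linarith)
          linarith [mul_le_mul_of_nonneg_right p10 (sub_nonneg.2 hg1)]
        rcases max_cases (2 * τ - l) 0 with ⟨h3, -⟩ | ⟨h3, -⟩ <;> rw [h3] at h <;> linarith
  have k3 : c * l ≤ l := mul_le_of_le_one_left (sub_nonneg.2 (H.fp_le j h1 hj)) p3
  linarith

/-- Sum of the gains of `step_ge`; since nδ ≤ 2, errors of order δ² at each step add up to O(δ). -/
theorem ge_of_forall_ge (H : IsChain n δ c s τ T σ M fm fp gm gp) (hst : IsStep δ c s τ T σ)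
    (hn : n * δ ≤ 2) {B : ℝ} (hB : 0 ≤ B) {J : ℕ} (hJ1 : 1 ≤ J) (hJ : J ≤ n)
    (hg : ∀ j, 1 ≤ j → j < J → 1 - B * δ ≤ gm j) :
    1 + J * δ / 2 - (8 * M + 6 * B + 13) * δ ≤ fm J := by
  have hM : 0 ≤ M := (H.fm_mem J hJ1 hJ).1.trans (H.fm_mem J hJ1 hJ).2
  have hp := hst.pos
  have main : ∀ j, 1 ≤ j → j ≤ J →
      1 - δ ^ 2 + (j - 1) * (δ / 2 - (4 * M + 3 * B + 6) * δ ^ 2) ≤ fm j := by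
    intro j hj1
    induction j, hj1 using Nat.le_induction with
    | base =>
      intro h
      rw [H.fm_succ 0 (by omega), H.fp_zero]
      have := mul_nonneg (by nlinarith [hst.le_s, hst.le] : 0 ≤ s) (H.gp_mem 0 (by omega)).1
      have := hst.le_c
      push_cast
      linarith
    | succ j hj1 ih =>
      intro h
      have h2 := H.step_ge hst hB hj1 (by omega) (hg j hj1 (by omega))
      have h3 := ih (by omega)
      push_cast
      linarith
  have h1 := main J hJ1 le_rfl
  have h2 : (J : ℝ) * δ ≤ 2 := (by gcongr : (J : ℝ) * δ ≤ n * δ).trans hn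
  have h3 : (J : ℝ) * δ * ((4 * M + 3 * B + 6) * δ) ≤ 2 * ((4 * M + 3 * B + 6) * δ) := by gcongr
  have h4 : 0 ≤ (4 * M + 3 * B + 6) * δ ^ 2 := by positivity
  have h5 : δ ^ 2 ≤ δ / 4 := by nlinarith [hst.le]
  linarith

theorem fp_ge (H : IsChain n δ c s τ T σ M fm fp gm gp) (hst : IsStep δ c s τ T σ)
    {j : ℕ} (hj : j < n) : fm (j + 1) - M * δ ≤ fp j := by
  rw [H.fm_succ j hj]
  have h1 := H.fp_mem j hj
  have h2 := H.gp_mem j hj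
  have hM := h1.1.trans h1.2
  nlinarith [mul_le_mul_of_nonneg_right hst.c_le h1.1,
    mul_le_mul_of_nonneg_right hst.s_le h2.1, mul_le_mul_of_nonneg_left h2.2 hst.pos.le]

/-- If `fm` is above `1` and `gm` below `1` at some step, then the energy `fm² + gm² - gm` almost
does not decrease at that step, and `gm` does not increase. -/
theorem trap_step (H : IsChain n δ c s τ T σ M fm fp gm gp) (hst : IsStep δ c s τ T σ)
    {κ : ℝ} {j : ℕ} (h1 : 1 ≤ j) (hj : j < n) (hg : gm j < 1 - τ)
    (hf : 1 + κ ≤ fm j) (hκ : 4 * δ ≤ κ) :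
    gm (j + 1) < 1 - τ ∧ fm j ^ 2 + gm j ^ 2 - gm j - (5 * M + 3) * δ ^ 2 ≤
      fm (j + 1) ^ 2 + gm (j + 1) ^ 2 - gm (j + 1) := by
  have hb := H.bal_g j h1 hj
  have hb' := H.bal_f' j h1 hj
  rw [H.fm_succ j hj, H.gm_succ j hj]
  obtain ⟨p1, p2, p3, p4, p5, p6, p7, p8, p9, p10, p11, p12, p13⟩ := hst
  obtain ⟨a1, a2⟩ := H.gp_mem j hj
  obtain ⟨b1, b2⟩ := H.gm_mem j h1 hj.le
  obtain ⟨c1, c2⟩ := H.fm_mem j h1 hj.le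
  obtain ⟨d1, d2⟩ := H.fp_mem j hj
  have hgg := H.gm_le j h1 hj
  have hff := H.fp_le j h1 hj
  have hs0 : 0 ≤ s := by nlinarith
  have hc0 : 0 ≤ c := by nlinarith
  have hT0 : 0 ≤ T := by nlinarith
  have hTδ : 3 * δ / 4 ≤ T := by nlinarith
  have hT2 : T ≤ 5 * δ / 4 := by nlinarith
  -- Both terms of `bal_g` are nonpositive, the second because T (fm - 1) ≥ 3δ² ≥ σ; so the edge of
  -- angle t + π/2 has length zero.
  have hgp : gp j = gm j := by
    refine le_antisymm ?_ hgg
    have hδ4 : δ ^ 2 ≤ δ * (1 / 4) := by rw [sq]; gcongr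
    have e0 : 3 * δ / 4 * κ ≤ T * (fm j - 1) := mul_le_mul hTδ (by linarith) (by linarith) hT0
    have e1' : δ * (4 * δ) ≤ δ * κ := mul_le_mul_of_nonneg_left hκ p1.le
    have e1 : T * (1 - fm j) + σ ≤ 0 := by linarith
    rw [max_eq_right (max_le (by linarith) e1)] at hb
    linarith
  rw [hgp] at hb' ⊢
  -- As gm < 1, the visible wall near the corner has length O(δ²), and what remains gives l ≤ 2τ - l
  -- in the essential case.
  have hl : fm j - fp j ≤ τ + δ ^ 2 := by
    have hδ4 : δ ^ 2 ≤ δ * (1 / 4) := by rw [sq]; gcongr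
    have e1 : T * (gm j - 1) + σ ≤ δ ^ 2 := by
      linarith [mul_nonpos_of_nonneg_of_nonpos hT0 (by linarith : gm j - 1 ≤ 0)]
    have e2 : T * (1 - gm j) + σ ≤ fm j - 1 - τ := by linarith [mul_nonneg hT0 b1]
    have e3 : max (T * (gm j - 1) + σ) 0 ≤ δ ^ 2 := max_le e1 (sq_nonneg _)
    rcases le_total (fp j - 1 + τ) (T * (1 - gm j) + σ) with h | h
    · rw [max_eq_right h, max_eq_right (sub_nonpos.2 e2)] at hb'
      linarith
    · rw [max_eq_left h] at hb'
      rcases max_cases (fp j - 1 + τ - (fm j - 1 - τ)) 0 with ⟨h3, -⟩ | ⟨h3, -⟩ <;>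
        rw [h3] at hb' <;> linarith
  refine ⟨by linarith [mul_nonneg hs0 d1, mul_le_of_le_one_left b1 p3], ?_⟩
  set l := fm j - fp j with hldef
  have hfp : fp j = fm j - l := by rw [hldef]; ring
  rw [hfp]
  have hl0 : 0 ≤ l := sub_nonneg.2 hff
  -- The rotation preserves the sum of squares, so the quadratic part only loses about 2 l f ≤ δ f,
  -- and the term -g gains about δ f. In the continuous model f' = g - 1/2, g' = -f, the quantity f²
  -- + g² - g is a first integral.
  have id1 : (c * (fm j - l) + s * gm j) ^ 2 + (c * gm j - s * (fm j - l)) ^ 2 =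
      (fm j - l) ^ 2 + gm j ^ 2 := by
    linear_combination ((fm j - l) ^ 2 + gm j ^ 2) * p7
  rw [id1]
  have hM : 0 ≤ M := a1.trans a2
  have i1 : fm j * (-5 * δ ^ 2) ≤ fm j * (s - 2 * l) := by
    gcongr
    linarith
  have i2 : fm j * δ ^ 2 ≤ M * δ ^ 2 := by gcongr
  have i3 : s * l ≤ δ * (τ + δ ^ 2) := by gcongr
  have i4 : δ * (τ + δ ^ 2) ≤ δ * (3 * δ) := by
    gcongr
    nlinarith
  linarith [mul_nonneg (sub_nonneg.2 p3) b1, sq_nonneg l]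

/-- Since gm starts above 1 + κ and decreases at a bounded rate, a first index J with gm < 1 - τ
comes late, when fm is already above 1 by a fixed amount. From there `trap_step` keeps gm below 1 -
τ up to the last index, against `gm_last`. -/
theorem ge_of_initial (H : IsChain n δ c s τ T σ M fm fp gm gp) (hst : IsStep δ c s τ T σ)
    (hn : n * δ ≤ 2) (hM : 1 ≤ M) {κ : ℝ} (hκ : 0 < κ) (hκ1 : κ ≤ 1) (hg0 : 1 + κ ≤ gp 0)
    (hδ : (400 * M + 400) * M * δ ≤ κ) {j : ℕ} (hj1 : 1 ≤ j) (hj : j ≤ n) : 1 - τ ≤ gm j := by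
  by_contra hcon
  have hex : ∃ j, 1 ≤ j ∧ j ≤ n ∧ gm j < 1 - τ := ⟨j, hj1, hj, not_le.1 hcon⟩
  clear hcon hj1 hj j
  classical
  obtain ⟨hJ1, hJn, hJ⟩ := Nat.find_spec hex
  set J := Nat.find hex
  have hmin : ∀ j, 1 ≤ j → j < J → 1 - τ ≤ gm j := by
    intro j h1 h2
    by_contra h3
    exact Nat.find_min hex h2 ⟨h1, by omega, not_le.1 h3⟩
  have hp := hst.pos
  have hδ1 := hst.le
  have hτδ : τ ≤ 1 * δ := by nlinarith [hst.τ_le]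
  -- the decrease of `gm` is slow
  have hslow : ∀ j, 1 ≤ j → j ≤ n → 1 + κ - j * (2 * M * δ) ≤ gm j := by
    have hstep : ∀ j < n, gp j - 2 * M * δ ≤ gm (j + 1) := by
      intro j hj
      rw [H.gm_succ j hj]
      have a := H.gp_mem j hj
      have b := H.fp_mem j hj
      have hs := mul_le_mul_of_nonneg_right hst.s_le b.1
      have hs' := mul_le_mul_of_nonneg_left b.2 hp.le
      have hc := mul_le_mul_of_nonneg_right hst.le_c a.1
      have : δ ^ 2 * gp j ≤ δ * M := by
        rw [sq, mul_assoc]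
        refine mul_le_mul_of_nonneg_left ?_ hp.le
        nlinarith [a.1, a.2]
      linarith
    intro j hj1
    induction j, hj1 using Nat.le_induction with
    | base =>
      intro h
      have := hstep 0 (by omega)
      push_cast
      linarith
    | succ j hj1 ih =>
      intro h
      have h2 := hstep j (by omega)
      have h3 := ih (by omega)
      have h4 := H.gm_le j hj1 (by omega)
      push_cast
      linarith
  have hJδ : κ ≤ J * (2 * M * δ) := by
    have := hslow J hJ1 hJn
    linarith [hst.τ_nonneg]
  have hf := H.ge_of_forall_ge hst hn zero_le_one hJ1 hJn
    (fun j h1 h2 => by linarith [hmin j h1 h2])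
  -- Slow decrease gives Jδ ≥ κ/(2M), so the gain Jδ/2 of fm is at least 2e; the hypothesis on δ
  -- says that (50M + 50)δ ≤ e, so one e absorbs the errors.
  set e := κ / (8 * M) with he
  have he0 : 0 < e := by positivity
  have heM : e * (8 * M) = κ := by rw [he]; field_simp
  have he1 : e ≤ 1 / 8 := by
    linarith [mul_le_mul_of_nonneg_left hM he0.le]
  have heδ : (50 * M + 50) * δ ≤ e := by
    refine le_of_mul_le_mul_right ?_ (by positivity : 0 < 8 * M)
    rw [heM]
    linarith
  have hMδ : 0 ≤ M * δ := by positivity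
  have hMδ1 : δ ≤ M * δ := le_mul_of_one_le_left hp.le hM
  have hfJ : 1 + e ≤ fm J := by
    have : 2 * e ≤ J * δ / 2 := by
      refine le_of_mul_le_mul_right ?_ (by positivity : 0 < 4 * M)
      linarith
    linarith
  have hgJ : -(3 * M * δ) ≤ gm J ^ 2 - gm J := by
    have h0 := (H.gm_mem J hJ1 hJn).1
    have : 1 - 3 * M * δ ≤ gm J := by
      rcases Nat.lt_or_ge 1 J with h | h
      · have h1 := hmin (J - 1) (by omega) (by omega)
        have h2 := H.gm_le (J - 1) (by omega) (by omega)
        have h3 := H.gm_succ (J - 1) (by omega)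
        rw [Nat.sub_add_cancel hJ1] at h3
        have a := H.gp_mem (J - 1) (by omega)
        have b := H.fp_mem (J - 1) (by omega)
        have hs := mul_le_mul_of_nonneg_right hst.s_le b.1
        have hs' := mul_le_mul_of_nonneg_left b.2 hp.le
        have hc := mul_le_mul_of_nonneg_right hst.le_c a.1
        have : δ ^ 2 * gp (J - 1) ≤ δ * M := by
          rw [sq, mul_assoc]
          refine mul_le_mul_of_nonneg_left ?_ hp.le
          nlinarith [a.1, a.2]
        linarith
      · have : J = 1 := by omega
        have h1 := hslow J hJ1 hJn
        rw [this] at h1 ⊢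
        push_cast at h1
        linarith
    linarith [sq_nonneg (1 - gm J)]
  -- the trap
  have htrap : ∀ j, J ≤ j → j ≤ n → gm j < 1 - τ ∧
      1 + e - (j - J) * ((5 * M + 3) * δ ^ 2) ≤ fm j ^ 2 + gm j ^ 2 - gm j := by
    intro j hj
    induction j, hj using Nat.le_induction with
    | base =>
      intro _
      refine ⟨hJ, ?_⟩
      linarith [pow_le_pow_left₀ (by positivity) hfJ 2, sq_nonneg e]
    | succ j hj ih =>
      intro h
      obtain ⟨h1, h2⟩ := ih (by omega)
      have hg := H.gm_mem j (by omega) (by omega)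
      have hf0 := (H.fm_mem j (by omega) (by omega)).1
      have hsum : (j - J : ℝ) * ((5 * M + 3) * δ ^ 2) ≤ 2 * ((5 * M + 3) * δ) := by
        have : (j - J : ℝ) * δ ≤ 2 := by
          refine le_trans ?_ hn
          gcongr
          have : (j : ℝ) ≤ n := by exact_mod_cast (by omega : j ≤ n)
          have : (0 : ℝ) ≤ J := Nat.cast_nonneg _
          linarith
        calc (j - J : ℝ) * ((5 * M + 3) * δ ^ 2) = (j - J : ℝ) * δ * ((5 * M + 3) * δ) := by ring
          _ ≤ _ := by gcongr
      -- Since gm lies in [0, 1], gm² - gm ≤ 0 and the energy bound passes to fm².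
      have hf2 : 1 + e / 2 ≤ fm j ^ 2 := by
        have h6 : 0 ≤ gm j * (1 - gm j) :=
          mul_nonneg hg.1 (by linarith [hst.τ_nonneg])
        linarith
      have hf3 : 1 + e / 5 ≤ fm j := by
        by_contra hlt
        have h8 := pow_le_pow_left₀ hf0 (not_le.1 hlt).le 2
        have h9 : e ^ 2 ≤ e := pow_le_of_le_one he0.le (by linarith) two_ne_zero
        linarith
      obtain ⟨h3, h4⟩ := H.trap_step hst (by omega) (by omega) h1 hf3 (by linarith)
      refine ⟨h3, ?_⟩
      push_cast
      linarith
  have := (htrap n hJn le_rfl).1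
  rw [H.gm_last] at this
  linarith [hst.τ_nonneg]

/-- If the initial arm length is larger than `1`, then both arm lengths are bounded below. -/
theorem bounds (H : IsChain n δ c s τ T σ M fm fp gm gp) (hst : IsStep δ c s τ T σ)
    (hn : n * δ ≤ 2) (hM : 1 ≤ M) {κ : ℝ} (hκ : 0 < κ) (hκ1 : κ ≤ 1) (hg0 : 1 + κ ≤ gp 0)
    (hδ : (400 * M + 400) * M * δ ≤ κ) {j : ℕ} (hj1 : 1 ≤ j) (hj : j < n) :
    1 + j * δ / 2 - (100 * M + 200) * δ ≤ fp j ∧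
      1 + (n - j : ℕ) * δ / 2 - (100 * M + 200) * δ ≤ gm j := by
  have hp := hst.pos
  have hτ : τ ≤ 1 * δ := by nlinarith [hst.τ_le, hst.le]
  have hf : ∀ j, 1 ≤ j → j ≤ n → 1 + j * δ / 2 - (8 * M + 19) * δ ≤ fm j := fun j h1 h2 => by
    have := H.ge_of_forall_ge hst hn zero_le_one h1 h2 fun i h3 h4 => by
      have := H.ge_of_initial hst hn hM hκ hκ1 hg0 hδ h3 (by omega : i ≤ n)
      linarith
    linarith
  have hf' : ∀ j < n, 1 + j * δ / 2 - (9 * M + 19) * δ ≤ fp j := fun j h => by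
    have h1 := H.fp_ge hst h
    have h2 := hf (j + 1) (by omega) (by omega)
    push_cast at h2
    nlinarith
  have hMδ : 0 ≤ M * δ := by positivity
  refine ⟨by linarith [hf' j hj], ?_⟩
  -- Read backwards, the chain exchanges the roles of f and g, and the bound just proved for fp is
  -- the hypothesis that makes gm grow.
  have H' := H.mirror hst
  have h1 := H'.ge_of_forall_ge hst hn (B := 9 * M + 19) (by positivity) (J := n - j + 1)
    (by omega) (by omega) fun i h3 h4 => by
      have := hf' (n - i) (by omega)
      have : (0 : ℝ) ≤ (n - i : ℕ) * δ := by positivity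
      show _ ≤ fp (n - i)
      linarith
  have h2 := H'.fp_ge hst (j := n - j) (by omega)
  beta_reduce at h1 h2
  rw [show n - (n - j) = j by omega] at h2
  push_cast at h1
  nlinarith

end IsChain

/-! ### Polygon caps with uniform angles -/

/-- The step `π / (2 n)` of the uniform angle set. -/
def step (n : ℕ) : ℝ := π / 2 / n

theorem step_pos {n : ℕ} (hn : 0 < n) : 0 < step n := by
  unfold step
  positivity

theorem mul_step {n : ℕ} (hn : 0 < n) : n * step n = π / 2 := by
  unfold step
  field_simp

theorem two_mul_step {n : ℕ} (hn : 0 < n) : (2 * n : ℕ) * step n = π := by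
  have := mul_step hn
  push_cast
  linarith

theorem nat_mul_step_add {n : ℕ} (hn : 0 < n) (k : ℕ) :
    k * step n + π / 2 = (k + n : ℕ) * step n := by
  rw [← mul_step hn]
  push_cast
  ring

theorem mem_uniformAngleSet {n : ℕ} {t : ℝ} :
    t ∈ uniformAngleSet (π / 2) n ↔ ∃ k : ℕ, 1 ≤ k ∧ k < n ∧ t = k * step n := by
  have : ∀ k : ℕ, (k : ℝ) / n * (π / 2) = k * step n := fun k => by
    unfold step
    ring
  simp only [uniformAngleSet, mem_ofPred_eq, this]

theorem mem_angleDomain {n : ℕ} (hn : 0 < n) {t : ℝ} :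
    t ∈ angleDomain (π / 2) (uniformAngleSet (π / 2) n) ↔
      ∃ k : ℕ, 1 ≤ k ∧ k < 2 * n ∧ t = k * step n := by
  simp only [angleDomain, mem_union, mem_image, mem_uniformAngleSet, mem_insert_iff,
    mem_singleton_iff, or_self]
  constructor
  · rintro ((⟨k, h1, h2, rfl⟩ | ⟨_, ⟨k, h1, h2, rfl⟩, rfl⟩) | rfl)
    · exact ⟨k, h1, by omega, rfl⟩
    · exact ⟨k + n, by omega, by omega, nat_mul_step_add hn k⟩
    · exact ⟨n, hn, by omega, (mul_step hn).symm⟩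
  · rintro ⟨k, h1, h2, rfl⟩
    rcases lt_trichotomy k n with h | rfl | h
    · exact Or.inl (Or.inl ⟨k, h1, h, rfl⟩)
    · exact Or.inr (mul_step hn)
    · refine Or.inl (Or.inr ⟨_, ⟨k - n, by omega, by omega, rfl⟩, ?_⟩)
      rw [nat_mul_step_add hn, Nat.sub_add_cancel h.le]

theorem inner_u_bottom (p : Plane) : inner ℝ p (u (3 * π / 2)) = -p 1 := by
  have h1 : cos (3 * π / 2) = 0 := by
    rw [show 3 * π / 2 = π / 2 + π by ring, cos_add_pi, cos_pi_div_two, neg_zero]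
  have h2 : sin (3 * π / 2) = -1 := by
    rw [show 3 * π / 2 = π / 2 + π by ring, sin_add_pi, sin_pi_div_two]
  rw [inner_u, h1, h2]
  ring

theorem inner_u_pi_div_two (p : Plane) : inner ℝ p (u (π / 2)) = p 1 := by
  simp [inner_u]

theorem inner_u_zero (p : Plane) : inner ℝ p (u 0) = p 0 := by
  simp [inner_u]

/-- A convex body cut out by half-planes with the right normal angles is a polygon cap. -/
theorem isPolygonCap_of_forall_mem_iff {n : ℕ} (hn : 0 < n) {K : ConvexBody Plane} (a : ℕ → ℝ)
    (h1 : supp K (π / 2) = 1) (h0 : supp K (3 * π / 2) = 0)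
    (h : ∀ p, p ∈ (K : Set Plane) ↔
      0 ≤ p 1 ∧ ∀ k : ℕ, 1 ≤ k → k < 2 * n → inner ℝ p (u (k * step n)) ≤ a k) :
    IsPolygonCap (π / 2) (uniformAngleSet (π / 2) n) K := by
  have key : ∀ A : Set ℝ, 3 * π / 2 ∈ A → (∀ k : ℕ, 1 ≤ k → k < 2 * n → k * step n ∈ A) →
      IsInterOfHalfPlanes A (K : Set Plane) := by
    intro A hA hA'
    refine ⟨insert (3 * π / 2, 0)
      {q | ∃ k : ℕ, 1 ≤ k ∧ k < 2 * n ∧ q = (k * step n, a k)}, ?_, ?_⟩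
    · rintro q (rfl | ⟨k, hk1, hk2, rfl⟩)
      exacts [hA, hA' k hk1 hk2]
    · ext p
      rw [h]
      rw [biInter_insert, mem_inter_iff, mem_iInter₂]
      refine and_congr ?_ ⟨?_, fun H k hk1 hk2 => ?_⟩
      · rw [closedLower, mem_ofPred_eq, inner_u_bottom, neg_nonpos]
      · rintro H q ⟨k, hk1, hk2, rfl⟩
        exact H k hk1 hk2
      · exact H (k * step n, a k) (mem_ofPred_eq.symm ▸ ⟨k, hk1, hk2, rfl⟩)
  have e : π / 2 + π = 3 * π / 2 := by ring
  refine ⟨⟨⟨by positivity, le_rfl⟩, h1, h1, by rw [e, h0], h0, key _ (by simp) ?_⟩,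
    key _ (by simp) fun k hk1 hk2 => Or.inl ((mem_angleDomain hn).2 ⟨k, hk1, hk2, rfl⟩)⟩
  intro k hk1 hk2
  have hs := step_pos hn
  have hle : k * step n ≤ π := by
    rw [← two_mul_step hn]
    gcongr
  have hge : 0 ≤ k * step n := by positivity
  left
  rcases le_total (k * step n) (π / 2) with h | h
  · exact Or.inl ⟨hge, h⟩
  · exact Or.inr ⟨h, by linarith⟩

section PolygonCap

variable {n : ℕ} {K : ConvexBody Plane}

theorem IsPolygonCap.mem_iff (hn : 0 < n)
    (hK : IsPolygonCap (π / 2) (uniformAngleSet (π / 2) n) K) (p : Plane) :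
    p ∈ (K : Set Plane) ↔
      0 ≤ p 1 ∧ ∀ k : ℕ, 1 ≤ k → k < 2 * n →
        inner ℝ p (u (k * step n)) ≤ supp K (k * step n) := by
  rw [mem_iff_of_isInterOfHalfPlanes hK.isInter]
  have e : π / 2 + π = 3 * π / 2 := by ring
  have hb := hK.isCap.supp_bottom
  constructor
  · intro h
    refine ⟨?_, fun k hk1 hk2 => h _ (Or.inl ((mem_angleDomain hn).2 ⟨k, hk1, hk2, rfl⟩))⟩
    have := h (3 * π / 2) (Or.inr (by simp))
    rw [hb, inner_u_bottom] at this
    linarith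
  · rintro ⟨h0, h⟩ t (ht | ht)
    · obtain ⟨k, hk1, hk2, rfl⟩ := (mem_angleDomain hn).1 ht
      exact h k hk1 hk2
    · have : t = 3 * π / 2 := by
        rcases ht with rfl | rfl
        exacts [e, rfl]
      rw [this, hb, inner_u_bottom]
      linarith

theorem IsCap.nonneg {ω : ℝ} (hK : IsCap ω K) {p : Plane} (hp : p ∈ (K : Set Plane)) :
    0 ≤ p 1 := by
  have := inner_le_supp hp (3 * π / 2)
  rw [hK.supp_bottom, inner_u_bottom] at this
  linarith

theorem IsCap.le_one {ω : ℝ} (hK : IsCap ω K) {p : Plane} (hp : p ∈ (K : Set Plane)) :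
    p 1 ≤ 1 := by
  have := inner_le_supp hp (π / 2)
  rwa [hK.supp_top, inner_u_pi_div_two] at this

/-- The outer walls of the hallways together with the strip are exactly the half-planes defining K,
so the first term of the area functional is the area of K itself. -/
theorem IsPolygonCap.polygonCap_eq (hn : 0 < n)
    (hK : IsPolygonCap (π / 2) (uniformAngleSet (π / 2) n) K) :
    polygonCap (π / 2) (uniformAngleSet (π / 2) n) K = K := by
  ext p
  simp only [polygonCap, parallelogram, outerQuadrant, closedUpper, closedLower, mem_inter_iff,
    mem_iInter, mem_ofPred_eq, inner_u_pi_div_two, mem_uniformAngleSet]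
  constructor
  · rintro ⟨⟨⟨h1, h2⟩, -⟩, h⟩
    refine (hK.mem_iff hn p).2 ⟨h1, fun k hk1 hk2 => ?_⟩
    rcases lt_trichotomy k n with hk | rfl | hk
    · exact (h _ ⟨k, hk1, hk, rfl⟩).1
    · rwa [mul_step hn, hK.isCap.supp_top, inner_u_pi_div_two]
    · have := (h _ ⟨k - n, by omega, by omega, rfl⟩).2
      rwa [nat_mul_step_add hn, Nat.sub_add_cancel hk.le] at this
  · intro hp
    exact ⟨⟨⟨hK.isCap.nonneg hp, hK.isCap.le_one hp⟩, hK.isCap.nonneg hp, hK.isCap.le_one hp⟩,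
      fun t _ => ⟨inner_le_supp hp _, inner_le_supp hp _⟩⟩

theorem mem_innerQuadrant {p : Plane} {t : ℝ} : p ∈ innerQuadrant K t ↔
    inner ℝ p (u t) < supp K t - 1 ∧ inner ℝ p (v t) < supp K (t + π / 2) - 1 := by
  simp [innerQuadrant, openLower, u_add_pi_div_two]

theorem mem_polygonNiche {p : Plane} :
    p ∈ polygonNiche (π / 2) (uniformAngleSet (π / 2) n) K ↔
      0 ≤ p 1 ∧ ∃ k : ℕ, 1 ≤ k ∧ k < n ∧ p ∈ innerQuadrant K (k * step n) := by
  simp only [polygonNiche, fan, closedUpper, mem_inter_iff, mem_ofPred_eq, inner_u_pi_div_two,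
    and_self, mem_iUnion, mem_uniformAngleSet]
  refine and_congr_right fun _ => ⟨?_, ?_⟩
  · rintro ⟨_, ⟨k, h1, h2, rfl⟩, h⟩
    exact ⟨k, h1, h2, h⟩
  · rintro ⟨k, h1, h2, h⟩
    exact ⟨_, ⟨k, h1, h2, rfl⟩, h⟩

/-- No half-plane of angle in [0, δ) cuts K, so the supporting line of angle δ meets the bottom line
at a point of K, which is a rightmost one. This fixes the initial arm length `fp` to 1. -/
theorem IsPolygonCap.supp_one (hn : 2 ≤ n)
    (hK : IsPolygonCap (π / 2) (uniformAngleSet (π / 2) n) K) :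
    supp K (step n) = supp K 0 * cos (step n) := by
  have hn0 : 0 < n := by omega
  have hs := step_pos hn0
  have h2 := two_mul_step hn0
  have hs2 : step n < π / 2 := by
    have := mul_step hn0
    have : (2 : ℝ) ≤ n := by exact_mod_cast hn
    nlinarith [pi_pos]
  have hc : 0 < cos (step n) := cos_pos_of_mem_Ioo ⟨by linarith, hs2⟩
  refine le_antisymm ?_ ?_
  · obtain ⟨p, hp, h⟩ := exists_mem_edge K (step n)
    have hy := hK.isCap.nonneg hp
    have hmem : (!₂[supp K (step n) / cos (step n), 0] : Plane) ∈ (K : Set Plane) := by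
      refine (hK.mem_iff hn0 _).2 ⟨by simp, fun k hk1 hk2 => ?_⟩
      refine le_trans ?_ (inner_le_supp hp _)
      rw [← h]
      have hk : (k : ℝ) * step n ≤ π := by
        rw [← h2]
        gcongr
      have hk' : step n ≤ k * step n := le_mul_of_one_le_left hs.le (by exact_mod_cast hk1)
      have : 0 ≤ sin (k * step n - step n) :=
        sin_nonneg_of_nonneg_of_le_pi (by linarith) (by linarith)
      rw [sin_sub] at this
      simp only [inner_u, Matrix.cons_val_zero, Matrix.cons_val_one, zero_mul,
        add_zero]
      rw [div_mul_eq_mul_div, div_le_iff₀ hc]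
      nlinarith [mul_nonneg hy this]
    have := inner_le_supp hmem 0
    rw [inner_u_zero] at this
    simp only [Matrix.cons_val_zero] at this
    rwa [div_le_iff₀ hc] at this
  · obtain ⟨p, hp, h⟩ := exists_mem_edge K 0
    have hy := hK.isCap.nonneg hp
    rw [inner_u_zero] at h
    rw [← h]
    refine le_trans ?_ (inner_le_supp hp _)
    rw [inner_u]
    have : 0 ≤ sin (step n) := sin_nonneg_of_nonneg_of_le_pi hs.le (by linarith [pi_pos])
    nlinarith [mul_nonneg hy this]

end PolygonCap

/-! ### Mirror symmetry -/

section Reflection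

/-- The reflection in the vertical axis. -/
def reflection : Plane ≃ₗᵢ[ℝ] Plane where
  toFun p := !₂[-p 0, p 1]
  invFun p := !₂[-p 0, p 1]
  map_add' p q := by
    ext i
    fin_cases i <;> simp [add_comm]
  map_smul' c p := by
    ext i
    fin_cases i <;> simp
  left_inv p := by
    ext i
    fin_cases i <;> simp
  right_inv p := by
    ext i
    fin_cases i <;> simp
  norm_map' p := by
    simp [EuclideanSpace.norm_eq, Fin.sum_univ_two]

@[simp] theorem reflection_apply_zero (p : Plane) : reflection p 0 = -p 0 := rfl

@[simp] theorem reflection_apply_one (p : Plane) : reflection p 1 = p 1 := rfl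

@[simp] theorem reflection_reflection (p : Plane) : reflection (reflection p) = p :=
  reflection.left_inv p

theorem inner_reflection_u (p : Plane) (t : ℝ) :
    inner ℝ (reflection p) (u t) = inner ℝ p (u (π - t)) := by
  simp [inner_u]

theorem inner_reflection_v (p : Plane) (t : ℝ) :
    inner ℝ (reflection p) (v t) = inner ℝ p (u (π / 2 - t)) := by
  simp [inner_u, inner_v, cos_pi_div_two_sub, sin_pi_div_two_sub]

/-- The mirror image of a convex body in the vertical axis. -/
def mirrorBody (K : ConvexBody Plane) : ConvexBody Plane where
  carrier := reflection ⁻¹' K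
  convex' := K.convex.linear_preimage reflection.toLinearEquiv.toLinearMap
  isCompact' := by
    have := K.isCompact.image reflection.continuous
    rwa [show reflection '' (K : Set Plane) = reflection ⁻¹' K from
      reflection.toEquiv.image_eq_preimage_symm _] at this
  nonempty' := by
    obtain ⟨p, hp⟩ := K.nonempty
    exact ⟨reflection p, by simpa using hp⟩

variable {K : ConvexBody Plane}

theorem mem_mirrorBody {p : Plane} :
    p ∈ (mirrorBody K : Set Plane) ↔ reflection p ∈ (K : Set Plane) := Iff.rfl

@[simp] theorem mirrorBody_mirrorBody (K : ConvexBody Plane) : mirrorBody (mirrorBody K) = K := by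
  refine ConvexBody.ext (Set.ext fun p => ?_)
  rw [mem_mirrorBody, mem_mirrorBody, reflection_reflection]

theorem supp_mirrorBody (K : ConvexBody Plane) (t : ℝ) :
    supp (mirrorBody K) t = supp K (π - t) := by
  refine le_antisymm (supp_le fun p hp => ?_) (supp_le fun p hp => ?_)
  · have := inner_le_supp (mem_mirrorBody.1 hp) (π - t)
    rwa [inner_reflection_u, sub_sub_cancel] at this
  · rw [← inner_reflection_u]
    exact inner_le_supp (mem_mirrorBody.2 (by simpa using hp)) t

theorem IsPolygonCap.mirrorBody {n : ℕ} (hn : 0 < n)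
    (hK : IsPolygonCap (π / 2) (uniformAngleSet (π / 2) n) K) :
    IsPolygonCap (π / 2) (uniformAngleSet (π / 2) n) (mirrorBody K) := by
  refine isPolygonCap_of_forall_mem_iff hn (fun k => supp K (π - k * step n)) ?_ ?_ fun p => ?_
  · rw [supp_mirrorBody, sub_half, hK.isCap.supp_top]
  · rw [supp_mirrorBody, ← supp_add_two_pi, show π - 3 * π / 2 + 2 * π = 3 * π / 2 by ring,
      hK.isCap.supp_bottom]
  · rw [mem_mirrorBody, hK.mem_iff hn, reflection_apply_one]
    have e : ∀ k ≤ 2 * n, π - (2 * n - k : ℕ) * step n = k * step n := fun k hk => by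
      rw [← two_mul_step hn, Nat.cast_sub hk]
      ring
    refine and_congr_right fun _ => ⟨fun h k h1 h2 => ?_, fun h k h1 h2 => ?_⟩
    · have := h (2 * n - k) (by omega) (by omega)
      rw [inner_reflection_u, e k (by omega)] at this
      rw [← e k (by omega), sub_sub_cancel, e k (by omega)]
      exact this
    · have := h (2 * n - k) (by omega) (by omega)
      rw [e k (by omega)] at this
      rwa [inner_reflection_u, ← e k (by omega), sub_sub_cancel, e k (by omega)]

/-- The reflection exchanges the two walls of a hallway and sends the angle kδ to (n - k)δ, which
preserves the uniform angle set. -/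
theorem polygonArea_mirrorBody {n : ℕ} (hn : 0 < n)
    (hK : IsPolygonCap (π / 2) (uniformAngleSet (π / 2) n) K) :
    polygonArea (π / 2) (uniformAngleSet (π / 2) n) (mirrorBody K) =
      polygonArea (π / 2) (uniformAngleSet (π / 2) n) K := by
  have hv : ∀ s : Set Plane, volume.real (reflection ⁻¹' s) = volume.real s := fun s => by
    rw [measureReal_def, measureReal_def]
    congr 1
    exact (show MeasurePreserving reflection.toHomeomorph.toMeasurableEquiv volume volume from
      reflection.measurePreserving).measure_preimage_equiv s
  rw [polygonArea, polygonArea, hK.polygonCap_eq hn, (hK.mirrorBody hn).polygonCap_eq hn]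
  congr 1
  · exact hv K
  · rw [← hv (polygonNiche _ _ K)]
    congr 1
    ext p
    have key : ∀ k ≤ n, (reflection p ∈ innerQuadrant K ((n - k : ℕ) * step n) ↔
        p ∈ innerQuadrant (Sofa.mirrorBody K) (k * step n)) := fun k hk => by
      have e : ((n - k : ℕ) : ℝ) * step n = π / 2 - k * step n := by
        rw [← mul_step hn, Nat.cast_sub hk]
        ring
      rw [mem_innerQuadrant, mem_innerQuadrant, e, inner_reflection_u, inner_reflection_v,
        supp_mirrorBody, supp_mirrorBody, and_comm, sub_sub_cancel, ← u_add_pi_div_two]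
      ring_nf
    rw [mem_preimage, mem_polygonNiche, mem_polygonNiche, reflection_apply_one]
    refine and_congr_right fun _ => ⟨?_, ?_⟩
    · rintro ⟨k, h1, h2, h⟩
      exact ⟨n - k, by omega, by omega, (key k h2.le).2 h⟩
    · rintro ⟨k, h1, h2, h⟩
      refine ⟨n - k, by omega, by omega, (key _ (by omega)).1 ?_⟩
      rwa [Nat.sub_sub_self h2.le]

end Reflection

/-! ### First variation of the area -/

/-- The tangential coordinate of the intersection of the supporting lines of angles `t`
and `t + δ`. -/
def qp (K : ConvexBody Plane) (δ t : ℝ) : ℝ := (supp K (t + δ) - supp K t * cos δ) / sin δ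

/-- The tangential coordinate of the intersection of the supporting lines of angles `t - δ`
and `t`. -/
def qm (K : ConvexBody Plane) (δ t : ℝ) : ℝ := (supp K t * cos δ - supp K (t - δ)) / sin δ

section Polygon

variable {n : ℕ}

/-- For boundedness three half-planes suffice above the axis: those of index 1 and 2n - 1 bound the
abscissa, that of index n the ordinate. -/
theorem isCompact_polygon (hn : 2 ≤ n) (a : ℕ → ℝ) :
    IsCompact {p : Plane | 0 ≤ p 1 ∧
      ∀ k : ℕ, 1 ≤ k → k < 2 * n → inner ℝ p (u (k * step n)) ≤ a k} := by
  have hn0 : 0 < n := by omega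
  have hs := step_pos hn0
  have hs2 : step n < π / 2 := by
    have := mul_step hn0
    have : (2 : ℝ) ≤ n := by exact_mod_cast hn
    nlinarith [pi_pos]
  have hc : 0 < cos (step n) := cos_pos_of_mem_Ioo ⟨by linarith, hs2⟩
  have hsin : 0 < sin (step n) := sin_pos_of_pos_of_lt_pi hs (by linarith)
  refine Metric.isCompact_of_isClosed_isBounded ?_ ?_
  · have : {p : Plane | ∀ k : ℕ, 1 ≤ k → k < 2 * n → inner ℝ p (u (k * step n)) ≤ a k} =
        ⋂ (k : ℕ) (_ : 1 ≤ k) (_ : k < 2 * n), {p | inner ℝ p (u (k * step n)) ≤ a k} := by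
      ext p
      simp
    refine IsClosed.inter (isClosed_le continuous_const
      (by fun_prop : Continuous fun p : Plane => p 1))
      (show IsClosed {p : Plane | ∀ k : ℕ, 1 ≤ k → k < 2 * n →
        inner ℝ p (u (k * step n)) ≤ a k} from ?_)
    rw [this]
    exact isClosed_iInter fun k => isClosed_iInter fun _ => isClosed_iInter fun _ =>
      isClosed_le (continuous_inner_u _) continuous_const
  · refine Bornology.IsBounded.subset (Metric.isBounded_closedBall (x := (0 : Plane))
      (r := |a n| + (|a 1| + |a (2 * n - 1)|) / cos (step n))) ?_
    rintro p ⟨h0, h⟩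
    rw [mem_closedBall_zero_iff]
    have h1 := h n (by omega) (by omega)
    have h2 := h 1 le_rfl (by omega)
    have h3 := h (2 * n - 1) (by omega) (by omega)
    have e : ((2 * n - 1 : ℕ) : ℝ) * step n = π - step n := by
      rw [← two_mul_step hn0, Nat.cast_sub (by omega)]
      push_cast
      ring
    rw [mul_step hn0, inner_u_pi_div_two] at h1
    rw [Nat.cast_one, one_mul, inner_u] at h2
    rw [e, inner_u, cos_pi_sub, sin_pi_sub] at h3
    have h4 := norm_le_abs_add_abs p (π / 2)
    rw [inner_u_pi_div_two, inner_v, sin_pi_div_two, cos_pi_div_two, mul_one, mul_zero,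
      add_zero, abs_neg, abs_of_nonneg h0] at h4
    have h5 : |p 0| ≤ (|a 1| + |a (2 * n - 1)|) / cos (step n) := by
      rw [le_div_iff₀ hc, ← abs_of_pos hc, ← abs_mul, abs_le]
      have := mul_nonneg h0 hsin.le
      constructor <;> linarith [le_abs_self (a 1), le_abs_self (a (2 * n - 1)),
        abs_nonneg (a 1), abs_nonneg (a (2 * n - 1))]
    linarith [le_abs_self (a n)]

theorem convex_polygon (n : ℕ) (a : ℕ → ℝ) :
    Convex ℝ {p : Plane | 0 ≤ p 1 ∧
      ∀ k : ℕ, 1 ≤ k → k < 2 * n → inner ℝ p (u (k * step n)) ≤ a k} := by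
  rintro p ⟨hp0, hp⟩ q ⟨hq0, hq⟩ x y hx hy hxy
  refine ⟨?_, fun k h1 h2 => ?_⟩
  · simp only [PiLp.add_apply, PiLp.smul_apply, smul_eq_mul]
    positivity
  · rw [inner_add_left, inner_smul_left, inner_smul_left]
    simp only [conj_trivial]
    calc _ ≤ x * a k + y * a k := by
          gcongr
          exacts [hp k h1 h2, hq k h1 h2]
      _ = a k := by rw [← add_mul, hxy, one_mul]

/-- The convex body cut out of the upper half-plane by half-planes with uniform normal angles. -/
def polygonBody (hn : 2 ≤ n) (a : ℕ → ℝ) (hne : {p : Plane | 0 ≤ p 1 ∧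
      ∀ k : ℕ, 1 ≤ k → k < 2 * n → inner ℝ p (u (k * step n)) ≤ a k}.Nonempty) :
    ConvexBody Plane :=
  ⟨_, convex_polygon n a, isCompact_polygon hn a, hne⟩

end Polygon

section Perturbation

variable {n : ℕ} {K : ConvexBody Plane}

/-- If `p` lies beyond the supporting line of angle `a` but not beyond that of angle `b > a`, then
it is not beyond those of larger angle. -/
theorem inner_le_supp_of_lt {p : Plane} {a b c : ℝ} (hab : a < b) (hbc : b ≤ c)
    (hac : c - a ≤ π) (hb : b - a < π) (ha' : supp K a ≤ inner ℝ p (u a))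
    (hb' : inner ℝ p (u b) ≤ supp K b) : inner ℝ p (u c) ≤ supp K c := by
  have h1 := sin_mul_supp_le K hab.le hbc hac
  have h2 := sin_mul_inner_u p a b c
  have h3 : 0 < sin (b - a) := sin_pos_of_pos_of_lt_pi (by linarith) hb
  have h4 : 0 ≤ sin (c - b) := sin_nonneg_of_nonneg_of_le_pi (by linarith) (by linarith)
  have h5 : 0 ≤ sin (c - a) := sin_nonneg_of_nonneg_of_le_pi (by linarith) (by linarith)
  have h6 := mul_le_mul_of_nonneg_left ha' h4
  have h7 := mul_le_mul_of_nonneg_left hb' h5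
  exact le_of_mul_le_mul_left (by linarith) h3

theorem inner_le_supp_of_gt {p : Plane} {a b c : ℝ} (hab : a ≤ b) (hbc : b < c)
    (hac : c - a ≤ π) (hb : c - b < π) (hc' : supp K c ≤ inner ℝ p (u c))
    (hb' : inner ℝ p (u b) ≤ supp K b) : inner ℝ p (u a) ≤ supp K a := by
  have h1 := sin_mul_supp_le K hab hbc.le hac
  have h2 := sin_mul_inner_u p a b c
  have h3 : 0 < sin (c - b) := sin_pos_of_pos_of_lt_pi (by linarith) hb
  have h4 : 0 ≤ sin (b - a) := sin_nonneg_of_nonneg_of_le_pi (by linarith) (by linarith)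
  have h5 : 0 ≤ sin (c - a) := sin_nonneg_of_nonneg_of_le_pi (by linarith) (by linarith)
  have h6 := mul_le_mul_of_nonneg_left hc' h4
  have h7 := mul_le_mul_of_nonneg_left hb' h5
  exact le_of_mul_le_mul_left (by linarith) h3

/-- `volume.real` vanishes on sets of infinite measure, so finiteness is needed to compare niches. A
quadrant of angle in (0, π/2) cuts a bounded triangle, or nothing, from the upper half-plane. -/
theorem volume_polygonNiche_ne_top (hn : 0 < n) (K : ConvexBody Plane) :
    volume (polygonNiche (π / 2) (uniformAngleSet (π / 2) n) K) ≠ ⊤ := by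
  have hs := step_pos hn
  refine ne_top_of_le_ne_top ?_ (measure_mono (t := ⋃ k ∈ Finset.Ioo 0 n,
    box (k * step n)
      (Icc (-((supp K (k * step n + π / 2) - 1) * cos (k * step n)) / sin (k * step n))
        (supp K (k * step n) - 1))
      (Icc (-((supp K (k * step n) - 1) * sin (k * step n)) / cos (k * step n))
        (supp K (k * step n + π / 2) - 1))) ?_)
  · refine (measure_biUnion_lt_top (Finset.finite_toSet _) fun k _ => ?_).ne
    rw [volume_box _ measurableSet_Icc measurableSet_Icc, Real.volume_Icc, Real.volume_Icc]
    exact ENNReal.mul_lt_top ENNReal.ofReal_lt_top ENNReal.ofReal_lt_top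
  · intro p hp
    obtain ⟨h0, k, h1, h2, h⟩ := mem_polygonNiche.1 hp
    obtain ⟨ha, hb⟩ := mem_innerQuadrant.1 h
    have hk : (k : ℝ) * step n < π / 2 := by
      rw [← mul_step hn]
      gcongr
    have hk0 : 0 < (k : ℝ) * step n := by positivity
    have hcos : 0 < cos (k * step n) := cos_pos_of_mem_Ioo ⟨by linarith, hk⟩
    have hsin : 0 < sin (k * step n) := sin_pos_of_pos_of_lt_pi hk0 (by linarith)
    have hy := inner_u_eq_frame p (k * step n) (π / 2)
    rw [inner_u_pi_div_two, cos_pi_div_two_sub, sin_pi_div_two_sub] at hy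
    rw [hy] at h0
    refine mem_iUnion₂.2 ⟨k, Finset.mem_Ioo.2 ⟨h1, h2⟩, ⟨?_, ha.le⟩, ?_, hb.le⟩
    · rw [div_le_iff₀ hsin]
      nlinarith
    · rw [div_le_iff₀ hcos]
      nlinarith

/-- The part of the strip between the inner walls of angle `t` of `K` and of its perturbation which
is not in the inner quadrants of `K` of the two neighbouring angles. -/
def wallStrip (K : ConvexBody Plane) (δ t ε : ℝ) : Set Plane :=
  {p | supp K t - 1 ≤ inner ℝ p (u t) ∧ inner ℝ p (u t) < supp K t - 1 + ε ∧
    inner ℝ p (v t) < supp K (t + π / 2) - 1 ∧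
    p ∉ innerQuadrant K (t + δ) ∧ p ∉ innerQuadrant K (t - δ)}

/-- The extreme values k = 0 and k = n are not in the angle set, but as h(π/2) = 1 their quadrants
lie below the axis. The walls of index 1 and n - 1 therefore need no separate treatment. -/
theorem not_mem_innerQuadrant (hn : 0 < n) (h1 : supp K (π / 2) = 1) {p : Plane}
    (hp0 : 0 ≤ p 1) (hp : p ∉ polygonNiche (π / 2) (uniformAngleSet (π / 2) n) K) {k : ℕ}
    (hk : k ≤ n) : p ∉ innerQuadrant K (k * step n) := by
  intro h
  rcases Nat.eq_zero_or_pos k with rfl | hk0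
  · have := (mem_innerQuadrant.1 h).2
    rw [Nat.cast_zero, zero_mul, zero_add, h1, inner_v, sin_zero, cos_zero] at this
    linarith
  · rcases hk.lt_or_eq with hkn | rfl
    · exact hp (mem_polygonNiche.2 ⟨hp0, k, hk0, hkn, h⟩)
    · have := (mem_innerQuadrant.1 h).1
      rw [mul_step hn, h1, inner_u_pi_div_two] at this
      linarith

/-- First variation of the area: an edge of a maximum polygon cap is not longer than the visible
part of the corresponding wall of the niche. -/
theorem IsMaximumPolygonCap.edge_le (hn : 2 ≤ n)
    (hK : IsMaximumPolygonCap (π / 2) (uniformAngleSet (π / 2) n) K) {j : ℕ} (hj1 : 1 ≤ j)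
    (hjn : j < n) {V C : ℝ} (hV : 0 ≤ V) (hC : 0 ≤ C)
    (hJ : ∀ ε, 0 < ε → ∃ J : Set ℝ, MeasurableSet J ∧ volume J ≤ ENNReal.ofReal (V + C * ε) ∧
      ∀ p ∈ wallStrip K (step n) (j * step n) ε, inner ℝ p (v (j * step n)) ∈ J) :
    qp K (step n) (j * step n) - qm K (step n) (j * step n) ≤ V := by
  have hn0 : 0 < n := by omega
  set δ := step n with hδ
  have hs : 0 < δ := step_pos hn0
  have hs2 : δ < π / 2 := by
    have := mul_step hn0
    have : (2 : ℝ) ≤ n := by exact_mod_cast hn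
    nlinarith [pi_pos]
  have hc : 0 < cos δ := cos_pos_of_mem_Ioo ⟨by linarith, hs2⟩
  have hsin : 0 < sin δ := sin_pos_of_pos_of_lt_pi hs (by linarith)
  set t := (j : ℝ) * δ with ht
  set a := qm K δ t with ha
  set b := qp K δ t with hb
  -- When the line of angle t is pushed by ε, its intersections with the two neighbouring lines move
  -- inwards by ε cot δ.
  set κ := cos δ / sin δ with hκ
  have hκ0 : 0 < κ := by positivity
  have hcap := hK.isPolygonCap
  have htop := hcap.isCap.supp_top
  have hbot := hcap.isCap.supp_bottom
  have ht0 : 0 < t := by positivity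
  have hδt : δ ≤ t := le_mul_of_one_le_left hs.le (by exact_mod_cast hj1)
  have ht2 : t < π / 2 := by
    rw [← mul_step hn0, ht]
    gcongr
  -- it suffices to bound the length up to a small error
  suffices hmain : ∀ ε, 0 < ε → 2 * ε * κ ≤ b - a → b - a - 2 * ε * κ ≤ V + C * ε by
    by_contra hlt
    push Not at hlt
    have hpos : 0 < b - a - V := by linarith
    have hden : 0 < C + 2 * κ := by positivity
    have h1 := hmain ((b - a - V) / (2 * (C + 2 * κ))) (by positivity) ?_
    · have h2 : (b - a - V) / (2 * (C + 2 * κ)) * (C + 2 * κ) = (b - a - V) / 2 := by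
        field_simp
      linarith
    · have h2 : (b - a - V) / (2 * (C + 2 * κ)) * (C + 2 * κ) = (b - a - V) / 2 := by
        field_simp
      have h3 : 0 ≤ (b - a - V) / (2 * (C + 2 * κ)) * C := by positivity
      linarith
  intro ε hε hεl
  -- the perturbed cap
  set A : ℕ → ℝ := fun k => if k = j then supp K t + ε else supp K (k * δ) with hA
  have hAj : A j = supp K t + ε := by simp [hA]
  have hAk : ∀ k, k ≠ j → A k = supp K (k * δ) := fun k hk => by simp [hA, hk]
  have hAge : ∀ k : ℕ, supp K (k * δ) ≤ A k := fun k => by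
    by_cases hk : k = j
    · rw [hk, hAj]
      linarith
    · rw [hAk k hk]
  have hsub : (K : Set Plane) ⊆ {p : Plane | 0 ≤ p 1 ∧
      ∀ k : ℕ, 1 ≤ k → k < 2 * n → inner ℝ p (u (k * step n)) ≤ A k} := fun p hp =>
    ⟨hcap.isCap.nonneg hp, fun k _ _ => (inner_le_supp hp _).trans (hAge k)⟩
  set K' := polygonBody hn A (K.nonempty.mono hsub) with hK'
  have hmemK' : ∀ p, p ∈ (K' : Set Plane) ↔ 0 ≤ p 1 ∧
      ∀ k : ℕ, 1 ≤ k → k < 2 * n → inner ℝ p (u (k * δ)) ≤ A k := fun p => Iff.rfl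
  have hsub' : (K : Set Plane) ⊆ K' := hsub
  -- Beyond the old wall only the two neighbouring half-planes matter, and trigonometric convexity
  -- implies all the others. The bottom one enters as the angle -π/2.
  have hregion : ∀ p : Plane, supp K t ≤ inner ℝ p (u t) → inner ℝ p (u t) ≤ supp K t + ε →
      inner ℝ p (u (t + δ)) ≤ supp K (t + δ) → inner ℝ p (u (t - δ)) ≤ supp K (t - δ) →
      p ∈ (K' : Set Plane) := by
    intro p h1 h2 h3 h4
    refine (hmemK' p).2 ⟨?_, fun k hk1 hk2 => ?_⟩
    · have h5 := inner_le_supp_of_gt (a := -(π / 2)) (by linarith) (by linarith) (by linarith)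
        (by linarith) h1 h4
      rw [← supp_add_two_pi, ← u_add_two_pi, show -(π / 2) + 2 * π = 3 * π / 2 by ring, hbot,
        inner_u_bottom] at h5
      linarith
    · have hk3 : (k : ℝ) * δ ≤ π := by
        rw [← two_mul_step hn0]
        gcongr
      have hk0 : 0 ≤ (k : ℝ) * δ := by positivity
      rcases lt_trichotomy k j with hk | rfl | hk
      · rw [hAk k hk.ne]
        have : (k + 1 : ℝ) * δ ≤ j * δ := by
          gcongr
          exact_mod_cast hk
        exact inner_le_supp_of_gt (by linarith) (by linarith) (by linarith) (by linarith) h1 h4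
      · rwa [hAj]
      · rw [hAk k hk.ne']
        have : (j + 1 : ℝ) * δ ≤ k * δ := by
          gcongr
          exact_mod_cast hk
        exact inner_le_supp_of_lt (by linarith) (by linarith) (by linarith) (by linarith) h1 h3
  have hbs : b * sin δ = supp K (t + δ) - supp K t * cos δ := by
    rw [hb, qp, div_mul_cancel₀ _ hsin.ne']
  have has : a * sin δ = supp K t * cos δ - supp K (t - δ) := by
    rw [ha, qm, div_mul_cancel₀ _ hsin.ne']
  have hκs : κ * sin δ = cos δ := by rw [hκ, div_mul_cancel₀ _ hsin.ne']
  have hbox : ∀ p : Plane, supp K t ≤ inner ℝ p (u t) → inner ℝ p (u t) ≤ supp K t + ε →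
      a + ε * κ ≤ inner ℝ p (v t) → inner ℝ p (v t) ≤ b - ε * κ → p ∈ (K' : Set Plane) := by
    intro p h1 h2 h3 h4
    have h5 := mul_le_mul_of_nonneg_right h2 hc.le
    have h6 := mul_le_mul_of_nonneg_right h3 hsin.le
    have h7 := mul_le_mul_of_nonneg_right h4 hsin.le
    refine hregion p h1 h2 ?_ ?_
    · rw [inner_u_eq_frame p t, add_sub_cancel_left]
      linear_combination h5 + h7 + hbs - ε * hκs
    · rw [inner_u_eq_frame p t, sub_sub_cancel_left, cos_neg, sin_neg]
      linear_combination h5 + h6 - has - ε * hκs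
  -- The new offsets are attained, so the quadrant of index j is the only one that changes, and only
  -- by its wall of angle t.
  have hsupp : ∀ k : ℕ, 1 ≤ k → k < 2 * n → supp K' (k * δ) = A k := by
    intro k hk1 hk2
    refine le_antisymm (supp_le fun p hp => ((hmemK' p).1 hp).2 k hk1 hk2) ?_
    by_cases hk : k = j
    · subst hk
      rw [hAj]
      have := inner_le_supp (hbox ((supp K t + ε) • u t + ((a + b) / 2) • v t)
        (by rw [inner_frame_u]; linarith) (by rw [inner_frame_u])
        (by rw [inner_frame_v]; linarith) (by rw [inner_frame_v]; linarith)) t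
      rwa [inner_frame_u] at this
    · rw [hAk k hk]
      exact supp_mono hsub' _
  have hcap' : IsPolygonCap (π / 2) (uniformAngleSet (π / 2) n) K' := by
    refine isPolygonCap_of_forall_mem_iff hn0 A ?_ ?_ hmemK'
    · have := hsupp n (by omega) (by omega)
      rwa [hAk n (by omega), hδ, mul_step hn0, htop] at this
    · refine le_antisymm (supp_le fun p hp => ?_) (hbot ▸ supp_mono hsub' _)
      rw [inner_u_bottom]
      linarith [((hmemK' p).1 hp).1]
  have hmax := hK.maximal K' hcap'
  rw [polygonArea, polygonArea, hcap'.polygonCap_eq hn0, hcap.polygonCap_eq hn0] at hmax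
  -- the gain of the cap
  have hgain : volume.real (K : Set Plane) + ε * (b - a - 2 * ε * κ) ≤
      volume.real (K' : Set Plane) := by
    set B := box t (Ioc (supp K t) (supp K t + ε)) (Icc (a + ε * κ) (b - ε * κ)) with hBdef
    have hBvol : volume B = ENNReal.ofReal (ε * (b - a - 2 * ε * κ)) := by
      rw [hBdef, volume_box _ measurableSet_Ioc measurableSet_Icc, Real.volume_Ioc,
        Real.volume_Icc, ← ENNReal.ofReal_mul (by linarith)]
      congr 1
      ring
    have hdisj : Disjoint (K : Set Plane) B := by
      rw [Set.disjoint_left]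
      intro p hp hpB
      exact absurd (inner_le_supp hp t) (not_le.2 hpB.1.1)
    have hunion : (K : Set Plane) ∪ B ⊆ K' := by
      refine union_subset hsub' ?_
      rintro p ⟨⟨h1, h2⟩, h3, h4⟩
      exact hbox p h1.le h2 h3 h4
    have h1 := measureReal_mono (μ := volume) hunion K'.isCompact.measure_lt_top.ne
    rw [measureReal_union hdisj (measurableSet_box _ measurableSet_Ioc measurableSet_Icc)
      K.isCompact.measure_lt_top.ne (by rw [hBvol]; exact ENNReal.ofReal_ne_top),
      measureReal_def (s := B), hBvol,
      ENNReal.toReal_ofReal (mul_nonneg hε.le (by linarith))] at h1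
    exact h1
  -- the growth of the niche
  have hloss : volume.real (polygonNiche (π / 2) (uniformAngleSet (π / 2) n) K') ≤
      volume.real (polygonNiche (π / 2) (uniformAngleSet (π / 2) n) K) +
        ε * (V + C * ε) := by
    obtain ⟨J, hJm, hJv, hJmem⟩ := hJ ε hε
    set D := box t (Ico (supp K t - 1) (supp K t - 1 + ε)) J with hD
    have hDvol : volume D ≤ ENNReal.ofReal (ε * (V + C * ε)) := by
      rw [hD, volume_box _ measurableSet_Ico hJm, Real.volume_Ico, add_sub_cancel_left,
        ENNReal.ofReal_mul hε.le]
      gcongr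
    have hsubset : polygonNiche (π / 2) (uniformAngleSet (π / 2) n) K' ⊆
        polygonNiche (π / 2) (uniformAngleSet (π / 2) n) K ∪ D := by
      intro p hp
      by_cases hpN : p ∈ polygonNiche (π / 2) (uniformAngleSet (π / 2) n) K
      · exact Or.inl hpN
      right
      obtain ⟨h0, k, hk1, hk2, h⟩ := mem_polygonNiche.1 hp
      rw [mem_innerQuadrant, nat_mul_step_add hn0, hsupp k hk1 (by omega),
        hsupp (k + n) (by omega) (by omega), hAk (k + n) (by omega), ← nat_mul_step_add hn0] at h
      by_cases hk : k = j
      · subst hk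
        rw [hAj] at h
        have h3 : supp K t - 1 ≤ inner ℝ p (u t) := by
          by_contra hlt
          exact hpN (mem_polygonNiche.2 ⟨h0, k, hk1, hk2,
            mem_innerQuadrant.2 ⟨not_le.1 hlt, h.2⟩⟩)
        have h4 : inner ℝ p (u t) < supp K t - 1 + ε := by linarith [h.1]
        refine ⟨⟨h3, h4⟩, hJmem p ⟨h3, h4, h.2, ?_, ?_⟩⟩
        · have := not_mem_innerQuadrant hn0 htop h0 hpN (k := k + 1) (by omega)
          rwa [show ((k + 1 : ℕ) : ℝ) * step n = t + δ by push_cast; ring] at this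
        · have := not_mem_innerQuadrant hn0 htop h0 hpN (k := k - 1) (by omega)
          rwa [show ((k - 1 : ℕ) : ℝ) * step n = t - δ by
            rw [Nat.cast_sub hk1]; push_cast; ring] at this
      · rw [hAk k hk] at h
        exact absurd (mem_polygonNiche.2 ⟨h0, k, hk1, hk2, mem_innerQuadrant.2 h⟩) hpN
    have hDfin : volume D ≠ ⊤ := ne_top_of_le_ne_top ENNReal.ofReal_ne_top hDvol
    have h1 := measureReal_mono (μ := volume) hsubset
      (measure_union_ne_top (volume_polygonNiche_ne_top hn0 K) hDfin)
    refine h1.trans ((measureReal_union_le _ _).trans ?_)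
    gcongr
    exact ENNReal.toReal_le_of_le_ofReal (by positivity) hDvol
  have : ε * (b - a - 2 * ε * κ) ≤ ε * (V + C * ε) := by linarith
  exact le_of_mul_le_mul_left this hε

/-- The distance from the outer corner of angle `t` to the far end of the edge of angle `t`. -/
def fm (K : ConvexBody Plane) (δ t : ℝ) : ℝ := supp K (t + π / 2) - qm K δ t

/-- The distance from the outer corner of angle `t` to the near end of the edge of angle `t`. -/
def fp (K : ConvexBody Plane) (δ t : ℝ) : ℝ := supp K (t + π / 2) - qp K δ t

/-- The distance from the outer corner of angle `t` to the near end of the edge of angle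
`t + π / 2`. -/
def gm (K : ConvexBody Plane) (δ t : ℝ) : ℝ := supp K t + qm K δ (t + π / 2)

/-- The distance from the outer corner of angle `t` to the far end of the edge of angle
`t + π / 2`. -/
def gp (K : ConvexBody Plane) (δ t : ℝ) : ℝ := supp K t + qp K δ (t + π / 2)

/-- The left side is the distance along the wall from the inner corner. A point outside the quadrant
of angle t + δ violates one of its two inequalities, and each of them, written in the frame of t,
gives one term of the maximum. The last term accounts for the thickness of the strip. -/
theorem wallStrip_le {δ t ε : ℝ} (hs : 0 < sin δ) (hc : 0 < cos δ) {p : Plane}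
    (hp : p ∈ wallStrip K δ t ε) :
    supp K (t + π / 2) - 1 - inner ℝ p (v t) ≤
      max (fp K δ t - 1 + (1 - cos δ) / sin δ) (sin δ / cos δ * (1 - gp K δ t) + (1 / cos δ - 1)) +
        ε * (cos δ / sin δ) := by
  obtain ⟨h1, h2, h3, h4, -⟩ := hp
  rw [mem_innerQuadrant, not_and_or, not_lt, not_lt, inner_u_eq_frame p t, inner_v_eq_frame p t (t + δ),
    add_sub_cancel_left, add_right_comm] at h4
  have hε : 0 ≤ ε * (cos δ / sin δ) := by
    have : 0 < ε := by linarith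
    positivity
  rcases h4 with h4 | h4
  · refine le_trans ?_ (add_le_add_left (le_max_left _ _) _)
    refine le_of_mul_le_mul_right ?_ hs
    have e : (fp K δ t - 1 + (1 - cos δ) / sin δ + ε * (cos δ / sin δ)) * sin δ =
        supp K (t + π / 2) * sin δ - (supp K (t + δ) - supp K t * cos δ) - sin δ +
          (1 - cos δ) + ε * cos δ := by
      rw [fp, qp]
      field_simp
    rw [e]
    linarith [mul_le_mul_of_nonneg_right h2.le hc.le, mul_le_mul_of_nonneg_right h2.le hs.le,
      mul_le_mul_of_nonneg_right h1 hs.le]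
  · refine le_trans ?_ (le_add_of_le_of_nonneg (le_max_right _ _) hε)
    refine le_of_mul_le_mul_right ?_ hc
    have e : (sin δ / cos δ * (1 - gp K δ t) + (1 / cos δ - 1)) * cos δ =
        sin δ * (1 - supp K t) - (supp K (t + π / 2 + δ) - supp K (t + π / 2) * cos δ) +
          (1 - cos δ) := by
      rw [gp, qp]
      field_simp
      ring
    rw [e]
    linarith [mul_le_mul_of_nonneg_right h2.le hc.le, mul_le_mul_of_nonneg_right h2.le hs.le,
      mul_le_mul_of_nonneg_right h1 hs.le]

/-- What the quadrant of angle t - δ leaves visible is a piece next to the corner, behind one of its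
walls, and a piece far from it, behind the other. -/
theorem wallStrip_le_or_ge {δ t ε : ℝ} (hs : 0 < sin δ) (hc : 0 < cos δ) {p : Plane}
    (hp : p ∈ wallStrip K δ t ε) :
    supp K (t + π / 2) - 1 - inner ℝ p (v t) ≤
        sin δ / cos δ * (gm K δ t - 1) + (1 / cos δ - 1) + ε * (sin δ / cos δ) ∨
      fm K δ t - 1 - (1 - cos δ) / sin δ - ε * (cos δ / sin δ) ≤
        supp K (t + π / 2) - 1 - inner ℝ p (v t) := by
  obtain ⟨h1, h2, h3, -, h4⟩ := hp
  rw [mem_innerQuadrant, not_and_or, not_lt, not_lt, inner_u_eq_frame p t, inner_v_eq_frame p t (t - δ),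
    sub_sub_cancel_left, cos_neg, sin_neg, sub_add_eq_add_sub] at h4
  rcases h4 with h4 | h4
  · right
    refine le_of_mul_le_mul_right ?_ hs
    have e : (fm K δ t - 1 - (1 - cos δ) / sin δ - ε * (cos δ / sin δ)) * sin δ =
        supp K (t + π / 2) * sin δ - (supp K t * cos δ - supp K (t - δ)) - sin δ -
          (1 - cos δ) - ε * cos δ := by
      rw [fm, qm]
      field_simp
    rw [e]
    linarith [mul_le_mul_of_nonneg_right h2.le hc.le, mul_le_mul_of_nonneg_right h2.le hs.le,
      mul_le_mul_of_nonneg_right h1 hs.le]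
  · left
    refine le_of_mul_le_mul_right ?_ hc
    have e : (sin δ / cos δ * (gm K δ t - 1) + (1 / cos δ - 1) + ε * (sin δ / cos δ)) * cos δ =
        sin δ * (supp K t - 1) + (supp K (t + π / 2) * cos δ - supp K (t + π / 2 - δ)) +
          (1 - cos δ) + ε * sin δ := by
      rw [gm, qm]
      field_simp
      ring
    rw [e]
    linarith [mul_le_mul_of_nonneg_right h2.le hc.le, mul_le_mul_of_nonneg_right h2.le hs.le,
      mul_le_mul_of_nonneg_right h1 hs.le]

theorem cos_sin_step_pos (hn : 2 ≤ n) : 0 < cos (step n) ∧ 0 < sin (step n) := by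
  have hs := step_pos (n := n) (by omega)
  have hs2 : step n < π / 2 := by
    have := mul_step (n := n) (by omega)
    have : (2 : ℝ) ≤ n := by exact_mod_cast hn
    nlinarith [pi_pos]
  exact ⟨cos_pos_of_mem_Ioo ⟨by linarith, hs2⟩, sin_pos_of_pos_of_lt_pi hs (by linarith)⟩

theorem IsMaximumPolygonCap.edge_le_near (hn : 2 ≤ n)
    (hK : IsMaximumPolygonCap (π / 2) (uniformAngleSet (π / 2) n) K) {j : ℕ} (hj1 : 1 ≤ j)
    (hjn : j < n) {δ t : ℝ} (hδ : δ = step n) (ht : t = j * step n) :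
    fm K δ t - fp K δ t ≤
      max (max (fp K δ t - 1 + (1 - cos δ) / sin δ)
        (sin δ / cos δ * (1 - gp K δ t) + (1 / cos δ - 1))) 0 := by
  obtain ⟨hc, hs⟩ := cos_sin_step_pos hn
  subst hδ ht
  rw [show ∀ δ t, fm K δ t - fp K δ t = qp K δ t - qm K δ t from fun δ t => by rw [fm, fp]; ring]
  refine hK.edge_le hn hj1 hjn (C := cos (step n) / sin (step n)) (le_max_right _ _)
    (by positivity) fun ε hε => ?_
  set t := (j : ℝ) * step n
  set δ := step n
  set m := max (fp K δ t - 1 + (1 - cos δ) / sin δ)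
    (sin δ / cos δ * (1 - gp K δ t) + (1 / cos δ - 1)) with hm
  refine ⟨Icc (supp K (t + π / 2) - 1 - (m + ε * (cos δ / sin δ))) (supp K (t + π / 2) - 1),
    measurableSet_Icc, ?_, fun p hp => ⟨?_, hp.2.2.1.le⟩⟩
  · rw [Real.volume_Icc]
    refine ENNReal.ofReal_le_ofReal ?_
    linarith [le_max_left m 0]
  · linarith [wallStrip_le hs hc hp]

theorem IsMaximumPolygonCap.edge_le_far (hn : 2 ≤ n)
    (hK : IsMaximumPolygonCap (π / 2) (uniformAngleSet (π / 2) n) K) {j : ℕ} (hj1 : 1 ≤ j)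
    (hjn : j < n) {δ t : ℝ} (hδ : δ = step n) (ht : t = j * step n) :
    fm K δ t - fp K δ t ≤
      max (sin δ / cos δ * (gm K δ t - 1) + (1 / cos δ - 1)) 0 +
        max (max (fp K δ t - 1 + (1 - cos δ) / sin δ)
          (sin δ / cos δ * (1 - gp K δ t) + (1 / cos δ - 1)) -
            (fm K δ t - 1 - (1 - cos δ) / sin δ)) 0 := by
  obtain ⟨hc, hs⟩ := cos_sin_step_pos hn
  subst hδ ht
  rw [show ∀ δ t, fm K δ t - fp K δ t = qp K δ t - qm K δ t from fun δ t => by rw [fm, fp]; ring]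
  refine hK.edge_le hn hj1 hjn
    (C := sin (step n) / cos (step n) + 2 * (cos (step n) / sin (step n)))
    (add_nonneg (le_max_right _ _) (le_max_right _ _)) (by positivity) fun ε hε => ?_
  set t := (j : ℝ) * step n
  set δ := step n
  set m := max (fp K δ t - 1 + (1 - cos δ) / sin δ)
    (sin δ / cos δ * (1 - gp K δ t) + (1 / cos δ - 1)) with hm
  set γ := fm K δ t - 1 - (1 - cos δ) / sin δ with hγ
  set e := sin δ / cos δ * (gm K δ t - 1) + (1 / cos δ - 1) with he
  set B := supp K (t + π / 2) - 1 with hB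
  refine ⟨Icc (B - (e + ε * (sin δ / cos δ))) B ∪
    Icc (B - (m + ε * (cos δ / sin δ))) (B - (γ - ε * (cos δ / sin δ))),
    measurableSet_Icc.union measurableSet_Icc, ?_, fun p hp => ?_⟩
  · refine (measure_union_le _ _).trans ?_
    have h1 : 0 ≤ ε * (sin δ / cos δ) := by positivity
    have h2 : 0 ≤ ε * (cos δ / sin δ) := by positivity
    rw [Real.volume_Icc, Real.volume_Icc]
    refine (add_le_add (ENNReal.ofReal_le_ofReal (q := max e 0 + ε * (sin δ / cos δ)) ?_)
      (ENNReal.ofReal_le_ofReal (q := max (m - γ) 0 + 2 * (ε * (cos δ / sin δ))) ?_)).trans ?_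
    · linarith [le_max_left e 0]
    · linarith [le_max_left (m - γ) 0]
    · rw [← ENNReal.ofReal_add (add_nonneg (le_max_right _ _) h1)
        (add_nonneg (le_max_right _ _) (by positivity))]
      refine ENNReal.ofReal_le_ofReal (le_of_eq ?_)
      ring
  · have h1 := wallStrip_le hs hc hp
    have h2 := hp.2.2.1
    rcases wallStrip_le_or_ge hs hc hp with h | h
    · exact Or.inl ⟨by linarith, h2.le⟩
    · exact Or.inr ⟨by linarith, by linarith⟩

end Perturbation

/-! ### Maximum polygon caps as chains -/

section Chain

variable {n : ℕ} {K : ConvexBody Plane}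

theorem IsMaximumPolygonCap.mirrorBody (hn : 0 < n)
    (hK : IsMaximumPolygonCap (π / 2) (uniformAngleSet (π / 2) n) K) :
    IsMaximumPolygonCap (π / 2) (uniformAngleSet (π / 2) n) (mirrorBody K) where
  isPolygonCap := hK.isPolygonCap.mirrorBody hn
  topCorner_mem := by
    rw [mem_mirrorBody]
    convert hK.topCorner_mem using 1
    ext i
    have : π / 4 - π / 2 / 2 = 0 := by ring
    fin_cases i <;> simp [topCorner, this]
  maximal K' hK' := by
    rw [polygonArea_mirrorBody hn hK.isPolygonCap, ← polygonArea_mirrorBody hn hK']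
    exact hK.maximal _ (hK'.mirrorBody hn)

theorem fm_mirrorBody (K : ConvexBody Plane) (δ t : ℝ) :
    fm (mirrorBody K) δ t = gp K δ (π / 2 - t) := by
  simp only [fm, gp, qm, qp, supp_mirrorBody]
  ring_nf

theorem fp_mirrorBody (K : ConvexBody Plane) (δ t : ℝ) :
    fp (mirrorBody K) δ t = gm K δ (π / 2 - t) := by
  simp only [fp, gm, qm, qp, supp_mirrorBody]
  ring_nf

theorem gm_mirrorBody (K : ConvexBody Plane) (δ t : ℝ) :
    gm (mirrorBody K) δ t = fp K δ (π / 2 - t) := by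
  simp only [fp, gm, qm, qp, supp_mirrorBody]
  ring_nf

theorem gp_mirrorBody (K : ConvexBody Plane) (δ t : ℝ) :
    gp (mirrorBody K) δ t = fm K δ (π / 2 - t) := by
  simp only [fm, gp, qm, qp, supp_mirrorBody]
  ring_nf

/-- The supporting lines of angles t and t + δ meet at a point, and so do those of angles t + π/2
and t + π/2 + δ. The vector between these two points has coordinates given by `fp`, `gp` in the
frame of t and by `fm`, `gm` in the frame of t + δ. -/
theorem fm_add (K : ConvexBody Plane) {δ : ℝ} (hs : sin δ ≠ 0) (t : ℝ) :
    fm K δ (t + δ) = cos δ * fp K δ t + sin δ * gp K δ t := by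
  simp only [fm, fp, gp, qm, qp, add_sub_cancel_right, add_right_comm t δ (π / 2)]
  field_simp
  linear_combination -supp K t * sin_sq_add_cos_sq δ

theorem gm_add (K : ConvexBody Plane) {δ : ℝ} (hs : sin δ ≠ 0) (t : ℝ) :
    gm K δ (t + δ) = cos δ * gp K δ t - sin δ * fp K δ t := by
  simp only [gm, fp, gp, qm, qp, add_sub_cancel_right, add_right_comm t δ (π / 2)]
  generalize t + π / 2 = r
  field_simp
  linear_combination supp K r * sin_sq_add_cos_sq δ

theorem qm_le_qp (K : ConvexBody Plane) {δ : ℝ} (hδ : 0 < δ) (hδ2 : δ < π / 2) (t : ℝ) :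
    qm K δ t ≤ qp K δ t := by
  have hs : 0 < sin δ := sin_pos_of_pos_of_lt_pi hδ (by linarith)
  have h := sin_mul_supp_le K (a := t - δ) (b := t) (c := t + δ) (by linarith) (by linarith)
    (by linarith)
  rw [show t + δ - (t - δ) = 2 * δ by ring, add_sub_cancel_left, sub_sub_cancel, sin_two_mul] at h
  rw [qm, qp]
  refine div_le_div_of_nonneg_right ?_ hs.le
  have : sin δ * (supp K t * cos δ - supp K (t - δ)) ≤
      sin δ * (supp K (t + δ) - supp K t * cos δ) := by linarith
  exact le_of_mul_le_mul_left this hs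

theorem fp_le_fm (K : ConvexBody Plane) {δ : ℝ} (hδ : 0 < δ) (hδ2 : δ < π / 2) (t : ℝ) :
    fp K δ t ≤ fm K δ t := by
  rw [fp, fm]
  linarith [qm_le_qp K hδ hδ2 t]

theorem gm_le_gp (K : ConvexBody Plane) {δ : ℝ} (hδ : 0 < δ) (hδ2 : δ < π / 2) (t : ℝ) :
    gm K δ t ≤ gp K δ t := by
  rw [gm, gp]
  linarith [qm_le_qp K hδ hδ2 (t + π / 2)]

theorem fp_nonneg (K : ConvexBody Plane) {δ : ℝ} (hδ : 0 < δ) (hδ2 : δ < π / 2) (t : ℝ) :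
    0 ≤ fp K δ t := by
  have hs : 0 < sin δ := sin_pos_of_pos_of_lt_pi hδ (by linarith)
  have h := sin_mul_supp_le K (a := t) (b := t + δ) (c := t + π / 2) (by linarith) (by linarith)
    (by linarith [pi_pos])
  rw [add_sub_cancel_left, add_sub_cancel_left, add_sub_add_left_eq_sub, sin_pi_div_two_sub,
    sin_pi_div_two, one_mul] at h
  rw [fp, qp, sub_nonneg, div_le_iff₀ hs]
  linarith

theorem gm_nonneg (K : ConvexBody Plane) {δ : ℝ} (hδ : 0 < δ) (hδ2 : δ < π / 2) (t : ℝ) :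
    0 ≤ gm K δ t := by
  have := fp_nonneg (mirrorBody K) hδ hδ2 (π / 2 - t)
  rwa [fp_mirrorBody, sub_sub_cancel] at this

theorem fp_le {δ M : ℝ} (hδ : 0 < δ) (hδ2 : δ < π / 2) (hM : ∀ t, |supp K t| ≤ M) (t : ℝ) :
    fp K δ t ≤ 2 * M := by
  have hs : 0 < sin δ := sin_pos_of_pos_of_lt_pi hδ (by linarith)
  obtain ⟨p, hp, h⟩ := exists_mem_edge K t
  have h1 := inner_le_supp hp (t + δ)
  have h2 := inner_le_supp hp (t - π / 2)
  rw [inner_u_eq_frame p t, add_sub_cancel_left, h] at h1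
  rw [inner_u_eq_frame p t, sub_sub_cancel_left, cos_neg, sin_neg, cos_pi_div_two,
    sin_pi_div_two] at h2
  have h3 := (abs_le.1 (hM (t - π / 2))).2
  have h4 := (abs_le.1 (hM (t + π / 2))).2
  have h5 : -M ≤ qp K δ t := by
    rw [qp, le_div_iff₀ hs]
    nlinarith
  rw [fp]
  linarith

theorem gm_le {δ M : ℝ} (hδ : 0 < δ) (hδ2 : δ < π / 2) (hM : ∀ t, |supp K t| ≤ M) (t : ℝ) :
    gm K δ t ≤ 2 * M := by
  have := fp_le (K := mirrorBody K) hδ hδ2 (fun t => by rw [supp_mirrorBody]; exact hM _)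
    (π / 2 - t)
  rwa [fp_mirrorBody, sub_sub_cancel] at this

/-- By `gm_add`, cos δ times `gp` is a combination of arm lengths already bounded by 2M, and cos δ ≥
1/2. -/
theorem gp_le {δ M : ℝ} (hδ : 0 < δ) (hδ2 : δ ≤ 1 / 4) (hM : ∀ t, |supp K t| ≤ M) (t : ℝ) :
    gp K δ t ≤ 8 * M := by
  have hM0 : 0 ≤ M := (abs_nonneg _).trans (hM 0)
  have hδ3 : δ < π / 2 := by linarith [pi_gt_three]
  have hs : 0 < sin δ := sin_pos_of_pos_of_lt_pi hδ (by linarith)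
  have hc := one_sub_sq_div_two_le_cos (x := δ)
  have h1 := gm_add K hs.ne' t
  have h2 := gm_le hδ hδ3 hM (t + δ)
  have h3 := fp_le hδ hδ3 hM t
  have h4 := mul_le_mul (sin_le_one δ) h3 (fp_nonneg K hδ hδ3 t) zero_le_one
  have h5 : (1 / 2 : ℝ) ≤ cos δ := by nlinarith
  have h6 : 0 ≤ gp K δ t := (gm_nonneg K hδ hδ3 t).trans (gm_le_gp K hδ hδ3 t)
  nlinarith

theorem fm_le {δ M : ℝ} (hδ : 0 < δ) (hδ2 : δ ≤ 1 / 4) (hM : ∀ t, |supp K t| ≤ M) (t : ℝ) :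
    fm K δ t ≤ 8 * M := by
  have := gp_le (K := mirrorBody K) hδ hδ2 (fun t => by rw [supp_mirrorBody]; exact hM _)
    (π / 2 - t)
  rwa [gp_mirrorBody, sub_sub_cancel] at this

theorem IsPolygonCap.fp_zero (hn : 2 ≤ n)
    (hK : IsPolygonCap (π / 2) (uniformAngleSet (π / 2) n) K) : fp K (step n) 0 = 1 := by
  rw [fp, qp, zero_add, zero_add, hK.supp_one hn, sub_self, zero_div, hK.isCap.supp_top, sub_zero]

theorem IsMaximumPolygonCap.isChain (hn : 2 ≤ n)
    (hK : IsMaximumPolygonCap (π / 2) (uniformAngleSet (π / 2) n) K) (hδ : step n ≤ 1 / 4)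
    {M : ℝ} (hM : ∀ t, |supp K t| ≤ M) :
    IsChain n (step n) (cos (step n)) (sin (step n)) ((1 - cos (step n)) / sin (step n))
      (sin (step n) / cos (step n)) (1 / cos (step n) - 1) (8 * M)
      (fun j => fm K (step n) (j * step n)) (fun j => fp K (step n) (j * step n))
      (fun j => gm K (step n) (j * step n)) (fun j => gp K (step n) (j * step n)) := by
  have hn0 : 0 < n := by omega
  have hs0 := step_pos hn0
  have hδ2 : step n < π / 2 := by linarith [pi_gt_three]
  obtain ⟨hc, hs⟩ := cos_sin_step_pos hn
  have hM0 : 0 ≤ M := (abs_nonneg _).trans (hM 0)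
  have hK' := hK.mirrorBody hn0
  have e : ∀ j : ℕ, ((j + 1 : ℕ) : ℝ) * step n = j * step n + step n := fun j => by
    push_cast
    ring
  have e' : ∀ j ≤ n, π / 2 - ((n - j : ℕ) : ℝ) * step n = j * step n := fun j hj => by
    rw [← mul_step hn0, Nat.cast_sub hj]
    ring
  refine ⟨fun j _ => ?_, fun j _ => ?_, ?_, ?_, fun j _ => ⟨fp_nonneg K hs0 hδ2 _, ?_⟩,
    fun j _ => ⟨?_, gp_le hs0 hδ hM _⟩, fun j _ _ => ⟨?_, fm_le hs0 hδ hM _⟩,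
    fun j _ _ => ⟨gm_nonneg K hs0 hδ2 _, ?_⟩, fun j _ _ => fp_le_fm K hs0 hδ2 _,
    fun j _ _ => gm_le_gp K hs0 hδ2 _, fun j h1 h2 => hK.edge_le_near hn h1 h2 rfl rfl,
    fun j h1 h2 => hK.edge_le_far hn h1 h2 rfl rfl, fun j h1 h2 => ?_, fun j h1 h2 => ?_⟩
  · rw [e, fm_add K hs.ne']
  · rw [e, gm_add K hs.ne']
  · rw [Nat.cast_zero, zero_mul, hK.isPolygonCap.fp_zero hn]
  · have := hK'.isPolygonCap.fp_zero hn
    rwa [fp_mirrorBody, sub_zero, ← mul_step hn0] at this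
  · exact (fp_le hs0 hδ2 hM _).trans (by linarith)
  · exact (gm_nonneg K hs0 hδ2 _).trans (gm_le_gp K hs0 hδ2 _)
  · exact (fp_nonneg K hs0 hδ2 _).trans (fp_le_fm K hs0 hδ2 _)
  · exact (gm_le hs0 hδ2 hM _).trans (by linarith)
  · have := hK'.edge_le_near hn (j := n - j) (by omega) (by omega) rfl rfl
    rwa [fm_mirrorBody, fp_mirrorBody, gp_mirrorBody, e' j h2.le] at this
  · have := hK'.edge_le_far hn (j := n - j) (by omega) (by omega) rfl rfl
    rwa [fm_mirrorBody, fp_mirrorBody, gp_mirrorBody, gm_mirrorBody, e' j h2.le] at this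

/-- The two extreme arms add up to the width plus the length of the top edge; if the width exceeds
2, one of them exceeds 1. -/
theorem supp_zero_add_supp_pi_le (hn : 2 ≤ n) (K : ConvexBody Plane) :
    supp K 0 + supp K π ≤ gp K (step n) 0 + fm K (step n) (π / 2) := by
  have hδ2 : step n < π / 2 := by
    have := mul_step (n := n) (by omega)
    have : (2 : ℝ) ≤ n := by exact_mod_cast hn
    nlinarith [pi_pos]
  have := qm_le_qp K (step_pos (n := n) (by omega)) hδ2 (π / 2)
  rw [gp, fm, zero_add, add_halves]
  linarith

end Chain

/-! ### A stadium as competitor -/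

section Competitor

variable {n : ℕ} {K : ConvexBody Plane}

/-- The cap has height 1, so it fits in a rectangle whose area is its width. -/
theorem IsPolygonCap.polygonArea_le (hn : 0 < n)
    (hK : IsPolygonCap (π / 2) (uniformAngleSet (π / 2) n) K) :
    polygonArea (π / 2) (uniformAngleSet (π / 2) n) K ≤ supp K 0 + supp K π := by
  have hsub : (K : Set Plane) ⊆ box 0 (Icc (-supp K π) (supp K 0)) (Icc 0 1) := by
    intro p hp
    have h1 := inner_le_supp hp 0
    have h2 := inner_le_supp hp π
    have e : inner ℝ p (v 0) = p 1 := by simp [inner_v]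
    rw [inner_u, cos_pi, sin_pi] at h2
    rw [inner_u_zero] at h1
    refine ⟨⟨?_, ?_⟩, ?_, ?_⟩
    · rw [inner_u_zero]
      linarith
    · rwa [inner_u_zero]
    · rw [e]
      exact hK.isCap.nonneg hp
    · rw [e]
      exact hK.isCap.le_one hp
  have hW : 0 ≤ supp K 0 + supp K π := by
    obtain ⟨p, hp⟩ := K.nonempty
    have := (hsub hp).1
    linarith [this.1, this.2]
  rw [polygonArea, hK.polygonCap_eq hn]
  have h1 : volume.real (K : Set Plane) ≤ supp K 0 + supp K π := by
    refine ENNReal.toReal_le_of_le_ofReal hW ((measure_mono hsub).trans_eq ?_)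
    rw [volume_box _ measurableSet_Icc measurableSet_Icc, Real.volume_Icc, Real.volume_Icc]
    simp [add_comm]
  linarith [measureReal_nonneg (μ := (volume : Measure Plane))
    (s := polygonNiche (π / 2) (uniformAngleSet (π / 2) n) K)]

/-- The closed upper half of the unit disc. -/
def halfDisc : Set Plane := Metric.closedBall 0 1 ∩ {p | 0 ≤ p 1}

theorem le_volume_halfDisc : ENNReal.ofReal (π / 2) ≤ volume halfDisc := by
  have h1 : volume (Metric.closedBall (0 : Plane) 1) = ENNReal.ofReal π := by
    rw [EuclideanSpace.volume_closedBall_fin_two]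
    simp
  have h2 : Metric.closedBall (0 : Plane) 1 ⊆ halfDisc ∪ -halfDisc := by
    intro p hp
    rcases le_total 0 (p 1) with h | h
    · exact Or.inl ⟨hp, h⟩
    · refine Or.inr ⟨?_, ?_⟩
      · simpa using hp
      · simpa using h
  have h3 := (measure_mono (μ := volume) h2).trans (measure_union_le _ _)
  rw [Measure.measure_neg, h1, ← two_mul] at h3
  rw [ENNReal.ofReal_div_of_pos two_pos]
  refine ENNReal.div_le_of_le_mul ?_
  rw [mul_comm]
  simpa using h3

/-- A rectangle with two half-discs attached has a large area. -/
theorem le_volume_of_stadium_subset {S : Set Plane}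
    (h0 : box 0 (Ico (-(1 / 2)) (1 / 2)) (Icc 0 1) ⊆ S)
    (h1 : ∀ p ∈ halfDisc, p + (1 / 2 : ℝ) • u 0 ∈ S)
    (h2 : ∀ p ∈ halfDisc, p - (1 / 2 : ℝ) • u 0 ∈ S) :
    ENNReal.ofReal (1 + π / 2) ≤ volume S := by
  set D1 : Set Plane := (fun p => p + (-((1 / 2 : ℝ) • u 0))) ⁻¹' (halfDisc ∩ {p | 0 ≤ p 0})
  set D2 : Set Plane := (fun p => p + (1 / 2 : ℝ) • u 0) ⁻¹' (halfDisc \ {p | 0 ≤ p 0})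
  set R := box 0 (Ico (-(1 / 2)) (1 / 2)) (Icc 0 1) with hR
  have hm0 : MeasurableSet {p : Plane | 0 ≤ p 0} :=
    measurableSet_le measurable_const (by fun_prop : Continuous fun p : Plane => p 0).measurable
  have hm1 : MeasurableSet {p : Plane | 0 ≤ p 1} :=
    measurableSet_le measurable_const (by fun_prop : Continuous fun p : Plane => p 1).measurable
  have hmH : MeasurableSet halfDisc := Metric.isClosed_closedBall.measurableSet.inter hm1
  have hRm : MeasurableSet R := measurableSet_box _ measurableSet_Ico measurableSet_Icc
  have hRv : volume R = ENNReal.ofReal 1 := by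
    rw [hR, volume_box _ measurableSet_Ico measurableSet_Icc, Real.volume_Ico, Real.volume_Icc]
    norm_num
  have hD : volume D1 + volume D2 = volume halfDisc := by
    rw [measure_preimage_add_right, measure_preimage_add_right, measure_inter_add_sdiff _ hm0]
  have hD2m : MeasurableSet D2 := (measurable_add_const _) (hmH.diff hm0)
  have hx1 : ∀ p ∈ D1, 1 / 2 ≤ p 0 := fun p hp => by
    have := hp.2
    simp at this
    linarith
  have hx2 : ∀ p ∈ D2, p 0 < -(1 / 2) := fun p hp => by
    have := hp.2
    simp at this
    linarith
  have hxR : ∀ p ∈ R, -(1 / 2) ≤ p 0 ∧ p 0 < 1 / 2 := fun p hp => by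
    have := hp.1
    rw [inner_u_zero] at this
    exact this
  have hdisj1 : Disjoint D1 D2 := Set.disjoint_left.2 fun p hp hp' => by
    linarith [hx1 p hp, hx2 p hp']
  have hdisj2 : Disjoint (D1 ∪ D2) R := Set.disjoint_left.2 fun p hp hp' => by
    rcases hp with hp | hp
    · linarith [hx1 p hp, hxR p hp']
    · linarith [hx2 p hp, hxR p hp']
  have hsub : D1 ∪ D2 ∪ R ⊆ S := by
    rintro p ((hp | hp) | hp)
    · have := h1 _ hp.1
      simpa using this
    · have := h2 _ hp.1
      simpa using this
    · exact h0 hp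
  calc ENNReal.ofReal (1 + π / 2) = ENNReal.ofReal (π / 2) + ENNReal.ofReal 1 := by
        rw [← ENNReal.ofReal_add (by positivity) zero_le_one, add_comm]
    _ ≤ volume D1 + volume D2 + volume R := by
        rw [hD, hRv]
        gcongr
        exact le_volume_halfDisc
    _ = volume (D1 ∪ D2 ∪ R) := by
        rw [measure_union hdisj2 hRm, measure_union hdisj1 hD2m]
    _ ≤ volume S := measure_mono hsub

/-- A maximum polygon cap is wide. -/
theorem IsMaximumPolygonCap.le_width (hn : 2 ≤ n)
    (hK : IsMaximumPolygonCap (π / 2) (uniformAngleSet (π / 2) n) K) :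
    (1 + π) / 2 ≤ supp K 0 + supp K π := by
  have hn0 : 0 < n := by omega
  refine le_trans ?_ (hK.isPolygonCap.polygonArea_le hn0)
  -- Support numbers of the unit disc plus a horizontal segment of length 1, a stadium whose upper
  -- half has area 1 + π/2.
  set a : ℕ → ℝ := fun k => 1 + |cos (k * step n)| / 2 with ha
  have hangle : ∀ k : ℕ, k ≤ 2 * n → 0 ≤ (k : ℝ) * step n ∧ (k : ℝ) * step n ≤ π :=
    fun k hk => by
      have := step_pos hn0
      refine ⟨by positivity, ?_⟩
      rw [← two_mul_step hn0]
      gcongr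
  have hmem : ∀ x : ℝ, |x| ≤ 1 / 2 → ∀ q : Plane, ‖q‖ ≤ 1 → 0 ≤ q 1 →
      0 ≤ (q + x • u 0) 1 ∧
        ∀ k : ℕ, 1 ≤ k → k < 2 * n → inner ℝ (q + x • u 0) (u (k * step n)) ≤ a k := by
    intro x hx q hq hq0
    refine ⟨by simpa using hq0, fun k h1 h2 => ?_⟩
    have h3 := (abs_le.1 (abs_inner_u_le q (k * step n))).2
    have h4 : x * cos (k * step n) ≤ |cos (k * step n)| / 2 := by
      refine (le_abs_self _).trans ?_
      rw [abs_mul]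
      nlinarith [abs_nonneg (cos (k * step n))]
    have h5 : inner ℝ (x • u 0) (u (k * step n)) = x * cos (k * step n) := by
      simp [inner_u]
    rw [inner_add_left, h5]
    simp only [ha]
    linarith
  have hne : {p : Plane | 0 ≤ p 1 ∧
      ∀ k : ℕ, 1 ≤ k → k < 2 * n → inner ℝ p (u (k * step n)) ≤ a k}.Nonempty :=
    ⟨_, hmem 0 (by norm_num) 0 (by simp) (by simp)⟩
  set H := polygonBody hn a hne with hH
  have hmemH : ∀ p, p ∈ (H : Set Plane) ↔ 0 ≤ p 1 ∧
      ∀ k : ℕ, 1 ≤ k → k < 2 * n → inner ℝ p (u (k * step n)) ≤ a k := fun p => Iff.rfl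
  have hsupp : ∀ k : ℕ, 1 ≤ k → k < 2 * n → supp H (k * step n) = a k := by
    intro k h1 h2
    refine le_antisymm (supp_le fun p hp => ((hmemH p).1 hp).2 k h1 h2) ?_
    have hy : 0 ≤ u (k * step n) 1 :=
      sin_nonneg_of_nonneg_of_le_pi (hangle k h2.le).1 (hangle k h2.le).2
    have key : ∀ x : ℝ, |x| ≤ 1 / 2 → 1 + x * cos (k * step n) ≤ supp H (k * step n) := by
      intro x hx
      have := inner_le_supp ((hmemH _).2 (hmem x hx _ (norm_u (k * step n)).le hy)) (k * step n)
      rw [inner_add_left, real_inner_self_eq_norm_sq, norm_u] at this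
      simpa [inner_u] using this
    have k1 := key (1 / 2) (by norm_num [abs_of_pos])
    have k2 := key (-(1 / 2)) (by norm_num [abs_of_pos])
    rcases abs_cases (cos (k * step n)) with ⟨h, -⟩ | ⟨h, -⟩ <;> simp only [ha, h] <;> linarith
  have hcap : IsPolygonCap (π / 2) (uniformAngleSet (π / 2) n) H := by
    refine isPolygonCap_of_forall_mem_iff hn0 a ?_ ?_ hmemH
    · have := hsupp n (by omega) (by omega)
      simpa [ha, mul_step hn0] using this
    · refine le_antisymm (supp_le fun p hp => ?_) ?_
      · rw [inner_u_bottom]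
        linarith [((hmemH p).1 hp).1]
      · have := inner_le_supp ((hmemH _).2 (hmem 0 (by norm_num) 0 (by simp) (by simp)))
          (3 * π / 2)
        simpa using this
  refine le_trans ?_ (hK.maximal H hcap)
  rw [polygonArea, hcap.polygonCap_eq hn0]
  have hvol : 1 + π / 2 ≤ volume.real (H : Set Plane) := by
    rw [measureReal_def, ← ENNReal.ofReal_le_iff_le_toReal H.isCompact.measure_lt_top.ne]
    refine le_volume_of_stadium_subset (fun p hp => ?_) (fun p hp => ?_) fun p hp => ?_
    · have h1 := hp.1
      have h2 := hp.2
      have e : inner ℝ p (v 0) = p 1 := by simp [inner_v]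
      rw [inner_u_zero] at h1
      rw [e] at h2
      have := hmem (p 0) (abs_le.2 ⟨h1.1, h1.2.le⟩) (p 1 • u (π / 2)) ?_ ?_
      · convert (hmemH _).2 this using 1
        ext i
        fin_cases i <;> simp
      · rw [norm_smul, norm_u, mul_one, norm_eq_abs, abs_of_nonneg h2.1]
        exact h2.2
      · simpa using h2.1
    · exact (hmemH _).2 (hmem (1 / 2) (by norm_num [abs_of_pos]) p (by simpa using hp.1) hp.2)
    · have := (hmemH _).2 (hmem (-(1 / 2)) (by norm_num [abs_of_pos]) p
        (by simpa using hp.1) hp.2)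
      rwa [neg_smul, ← sub_eq_add_neg] at this
  -- The walls of each of these quadrants cross the axis at -1/2 and 1/2 and meet at a right angle.
  -- By Thales the triangle they cut off lies in the disc of radius 1/2, hence in a rectangle of
  -- area 1/2.
  have hniche : volume.real (polygonNiche (π / 2) (uniformAngleSet (π / 2) n) H) ≤ 1 / 2 := by
    refine ENNReal.toReal_le_of_le_ofReal (by norm_num) ((measure_mono
      (t := box 0 (Icc (-(1 / 2)) (1 / 2)) (Icc 0 (1 / 2))) fun p hp => ?_).trans_eq ?_)
    · obtain ⟨h0, k, hk1, hk2, h⟩ := mem_polygonNiche.1 hp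
      obtain ⟨h1, h2⟩ := mem_innerQuadrant.1 h
      rw [hsupp k hk1 (by omega)] at h1
      rw [nat_mul_step_add hn0, hsupp _ (by omega) (by omega)] at h2
      simp only [ha, ← nat_mul_step_add hn0, cos_add_pi_div_two, abs_neg] at h1 h2
      have hs := step_pos hn0
      have ht : (k : ℝ) * step n < π / 2 := by
        rw [← mul_step hn0]
        gcongr
      have ht0 : 0 < (k : ℝ) * step n := by positivity
      have hc' : 0 < cos (k * step n) := cos_pos_of_mem_Ioo ⟨by linarith, ht⟩
      have hs' : 0 < sin (k * step n) := sin_pos_of_pos_of_lt_pi ht0 (by linarith)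
      rw [abs_of_pos hc'] at h1
      rw [abs_of_pos hs'] at h2
      have hy := inner_u_eq_frame p (k * step n) (π / 2)
      rw [inner_u_pi_div_two, cos_pi_div_two_sub, sin_pi_div_two_sub] at hy
      have hsq : inner ℝ p (u (k * step n)) ^ 2 + inner ℝ p (v (k * step n)) ^ 2 =
          p 0 ^ 2 + p 1 ^ 2 := by
        rw [inner_u, inner_v]
        linear_combination (p 0 ^ 2 + p 1 ^ 2) * sin_sq_add_cos_sq (k * step n)
      have h1' : inner ℝ p (u (k * step n)) < cos (k * step n) / 2 := by linarith
      have h2' : inner ℝ p (v (k * step n)) < sin (k * step n) / 2 := by linarith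
      have hcs := sin_sq_add_cos_sq (k * step n)
      generalize inner ℝ p (u (k * step n)) = A at *
      generalize inner ℝ p (v (k * step n)) = B at *
      generalize cos (k * step n) = c at *
      generalize sin (k * step n) = s at *
      have h3 : 0 < B + s / 2 := by
        have : 0 < (B + s / 2) * c := by nlinarith
        exact pos_of_mul_pos_left this hc'.le
      have h4 : 0 < A + c / 2 := by
        have : 0 < (A + c / 2) * s := by nlinarith
        exact pos_of_mul_pos_left this hs'.le
      have h5 : p 0 ^ 2 + p 1 ^ 2 ≤ 1 / 4 := by
        rw [← hsq]
        nlinarith [mul_pos (sub_pos.2 h1') h4, mul_pos (sub_pos.2 h2') h3]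
      have e : inner ℝ p (v 0) = p 1 := by simp [inner_v]
      refine ⟨?_, ?_⟩
      · rw [inner_u_zero]
        constructor <;> nlinarith
      · rw [e]
        exact ⟨h0, by nlinarith⟩
    · rw [volume_box _ measurableSet_Icc measurableSet_Icc, Real.volume_Icc, Real.volume_Icc,
        ← ENNReal.ofReal_mul (by norm_num)]
      norm_num
  linarith

end Competitor

/-! ### Uniform bounds on arms and second differences -/

section Discrete

variable {n : ℕ} {K : ConvexBody Plane}

/-- The arm lengths of a maximum polygon cap are larger than `1` up to a small error, and its edges
are short. -/
structure HasArmBounds (n : ℕ) (C : ℝ) (K : ConvexBody Plane) : Prop where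
  fp_ge : ∀ j : ℕ, 1 ≤ j → j < n →
    1 + j * step n / 2 - C * step n ≤ fp K (step n) (j * step n)
  gm_ge : ∀ j : ℕ, 1 ≤ j → j < n →
    1 + (π / 2 - j * step n) / 2 - C * step n ≤ gm K (step n) (j * step n)
  edge_le : ∀ j : ℕ, 1 ≤ j → j < n →
    fm K (step n) (j * step n) - fp K (step n) (j * step n) ≤ C * step n
  edge_le' : ∀ j : ℕ, 1 ≤ j → j < n →
    gp K (step n) (j * step n) - gm K (step n) (j * step n) ≤ C * step n

theorem HasArmBounds.mirrorBody (hn : 0 < n) {C : ℝ} (h : HasArmBounds n C K) :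
    HasArmBounds n C (mirrorBody K) := by
  have e : ∀ j ≤ n, π / 2 - (j : ℝ) * step n = ((n - j : ℕ) : ℝ) * step n := fun j hj => by
    rw [← mul_step hn, Nat.cast_sub hj]
    ring
  have e' : ∀ j ≤ n, π / 2 - ((n - j : ℕ) : ℝ) * step n = j * step n := fun j hj => by
    rw [← e j hj, sub_sub_cancel]
  refine ⟨fun j h1 h2 => ?_, fun j h1 h2 => ?_, fun j h1 h2 => ?_, fun j h1 h2 => ?_⟩
  · have := h.gm_ge (n - j) (by omega) (by omega)
    rwa [fp_mirrorBody, e j h2.le, ← e' j h2.le]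
  · have := h.fp_ge (n - j) (by omega) (by omega)
    rwa [gm_mirrorBody, e j h2.le]
  · have := h.edge_le' (n - j) (by omega) (by omega)
    rwa [fm_mirrorBody, fp_mirrorBody, e j h2.le]
  · have := h.edge_le (n - j) (by omega) (by omega)
    rwa [gm_mirrorBody, gp_mirrorBody, e j h2.le]

theorem IsMaximumPolygonCap.hasArmBounds_of_initial (hn : 2 ≤ n)
    (hK : IsMaximumPolygonCap (π / 2) (uniformAngleSet (π / 2) n) K) (hδ : step n ≤ 1 / 4)
    {M : ℝ} (hM1 : 1 ≤ M) (hM : ∀ t, |supp K t| ≤ M)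
    (hδM : (400 * (8 * M) + 400) * (8 * M) * step n ≤ 1 / 50)
    (h0 : 1 + 1 / 50 ≤ gp K (step n) 0) :
    HasArmBounds n (800 * M + 200) K := by
  have hn0 : 0 < n := by omega
  have H := hK.isChain hn hδ hM
  have hst := isStep (step_pos hn0) hδ
  have hnδ : n * step n ≤ 2 := by
    rw [mul_step hn0]
    linarith [pi_le_four]
  have hp := step_pos hn0
  have hb := fun j (h1 : 1 ≤ j) (h2 : j < n) => H.bounds hst hnδ (by linarith)
    (by norm_num : (0 : ℝ) < 1 / 50) (by norm_num) (by simpa using h0) hδM h1 h2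
  refine ⟨fun j h1 h2 => ?_, fun j h1 h2 => ?_, fun j h1 h2 => ?_, fun j h1 h2 => ?_⟩
  · have := (hb j h1 h2).1
    linarith
  · have := (hb j h1 h2).2
    rw [Nat.cast_sub h2.le, sub_mul, mul_step hn0] at this
    linarith
  · have := H.edge_le_const hst h1 h2
    nlinarith
  · have := (H.mirror hst).edge_le_const hst (j := n - j) (by omega) (by omega)
    simp only [Nat.sub_sub_self h2.le] at this
    nlinarith

/-- As (1 + π)/2 > 2 + 2/50, one of the two extreme arms exceeds 1 + 1/50; if it is the final one,
the mirror image is used. -/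
theorem IsMaximumPolygonCap.hasArmBounds (hn : 2 ≤ n)
    (hK : IsMaximumPolygonCap (π / 2) (uniformAngleSet (π / 2) n) K) (hδ : step n ≤ 1 / 4)
    {M : ℝ} (hM1 : 1 ≤ M) (hM : ∀ t, |supp K t| ≤ M)
    (hδM : (400 * (8 * M) + 400) * (8 * M) * step n ≤ 1 / 50) :
    HasArmBounds n (800 * M + 200) K := by
  have hn0 : 0 < n := by omega
  have hw := hK.le_width hn
  have hw' := supp_zero_add_supp_pi_le hn K
  have hπ := pi_gt_d2
  rcases le_total (fm K (step n) (π / 2)) (gp K (step n) 0) with h | h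
  · exact hK.hasArmBounds_of_initial hn hδ hM1 hM hδM (by linarith)
  · have := (hK.mirrorBody hn0).hasArmBounds_of_initial hn hδ hM1
      (fun t => by rw [supp_mirrorBody]; exact hM _) hδM
      (by rw [gp_mirrorBody, sub_zero]; linarith)
    simpa using this.mirrorBody hn0

/-- Comparison with the solution of the recurrence for the support numbers of a disc. -/
theorem le_of_second_difference_le {δ C : ℝ} {N : ℕ} (hδ : 0 < δ) (hN : N * δ < π) (hC : 0 ≤ C)
    (H : ℕ → ℝ) (hs : 0 < sin δ)
    (h : ∀ m, m + 2 ≤ N → H (m + 2) - 2 * cos δ * H (m + 1) + H m ≤ 2 * C * (1 - cos δ)) {m : ℕ}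
    (hm : m ≤ N) :
    H m ≤ H 0 * cos (m * δ) + (H 1 - H 0 * cos δ) / sin δ * sin (m * δ) +
      C * (1 - cos (m * δ)) := by
  set q := (H 1 - H 0 * cos δ) / sin δ with hq
  set e : ℕ → ℝ := fun m => H m - (H 0 * cos (m * δ) + q * sin (m * δ) + C * (1 - cos (m * δ)))
    with he
  have hcos : ∀ m : ℕ, cos ((m + 2 : ℕ) * δ) = 2 * cos δ * cos ((m + 1 : ℕ) * δ) - cos (m * δ) := by
    intro m
    have e1 : ((m + 2 : ℕ) : ℝ) * δ = (m + 1 : ℕ) * δ + δ := by push_cast; ring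
    have e2 : (m : ℝ) * δ = (m + 1 : ℕ) * δ - δ := by push_cast; ring
    rw [e1, e2, cos_add, cos_sub]
    ring
  have hsin : ∀ m : ℕ, sin ((m + 2 : ℕ) * δ) = 2 * cos δ * sin ((m + 1 : ℕ) * δ) - sin (m * δ) := by
    intro m
    have e1 : ((m + 2 : ℕ) : ℝ) * δ = (m + 1 : ℕ) * δ + δ := by push_cast; ring
    have e2 : (m : ℝ) * δ = (m + 1 : ℕ) * δ - δ := by push_cast; ring
    rw [e1, e2, sin_add, sin_sub]
    ring
  have he0 : e 0 = 0 := by simp [he]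
  have he1 : e 1 ≤ 0 := by
    have : q * sin δ = H 1 - H 0 * cos δ := by rw [hq, div_mul_cancel₀ _ hs.ne']
    simp only [he, Nat.cast_one, one_mul]
    linarith [mul_nonneg hC (sub_nonneg.2 (cos_le_one δ))]
  have hrec : ∀ m, m + 2 ≤ N → e (m + 2) ≤ 2 * cos δ * e (m + 1) - e m := by
    intro m hm
    have := h m hm
    simp only [he, hcos, hsin]
    linarith
  have hpos : ∀ m : ℕ, m ≤ N → 0 ≤ sin (m * δ) := fun m hm =>
    sin_nonneg_of_nonneg_of_le_pi (by positivity) (le_trans (by gcongr) hN.le)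
  have hpos' : ∀ m : ℕ, 1 ≤ m → m ≤ N → 0 < sin (m * δ) := fun m h1 hm =>
    sin_pos_of_pos_of_lt_pi (by positivity) (lt_of_le_of_lt (by gcongr) hN)
  -- A discrete Wronskian with sin(mδ): the quotient of `e m` by sin(mδ) does not increase for m ≥
  -- 1.
  have hW : ∀ m, m + 1 ≤ N → e (m + 1) * sin (m * δ) ≤ e m * sin ((m + 1 : ℕ) * δ) := by
    intro m
    induction m with
    | zero => simp [he0]
    | succ m ih =>
      intro hm
      have h1 := ih (by omega)
      have h2 := mul_le_mul_of_nonneg_right (hrec m (by omega)) (hpos (m + 1) (by omega))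
      rw [hsin]
      linarith
  have hle : ∀ m, m ≤ N → e m ≤ 0 := by
    intro m
    induction m with
    | zero => intro; exact he0.le
    | succ m ih =>
      intro hm
      rcases Nat.eq_zero_or_pos m with rfl | hm0
      · exact he1
      · have h1 := hW m hm
        have h2 := mul_nonneg_of_nonpos_of_nonpos (ih (by omega)) (neg_nonpos.2 (hpos (m + 1) hm))
        have h3 := hpos' m hm0 (by omega)
        by_contra hcon
        linarith [mul_pos (not_le.1 hcon) h3]
  have := hle m hm
  simp only [he] at this
  linarith

/-- A disc of radius R has second differences 2R(1 - cos δ); so edges of length at most Cδ are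
dominated by those of the radius R = 3C. -/
theorem le_two_mul_one_sub_cos {δ : ℝ} (h0 : 0 < δ) (h1 : δ ≤ 1 / 4) :
    δ * sin δ ≤ 6 * (1 - cos δ) := by
  have h2 := sin_gt_sub_cube h0
  have h3 : δ ^ 3 ≤ δ := pow_le_of_le_one h0.le (by linarith) three_ne_zero
  have h4 : δ ≤ 3 * sin δ := by linarith
  have h5 := mul_le_mul_of_nonneg_right h4 (by linarith : 0 ≤ sin δ)
  nlinarith [sin_sq_add_cos_sq δ, cos_le_one δ, neg_one_le_cos δ]

theorem qp_sub_qm_mul_sin (K : ConvexBody Plane) {δ : ℝ} (hs : 0 < sin δ) (t : ℝ) :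
    (qp K δ t - qm K δ t) * sin δ =
      supp K (t + δ) - 2 * cos δ * supp K t + supp K (t - δ) := by
  rw [qp, qm, ← sub_div, div_mul_cancel₀ _ hs.ne']
  ring

theorem HasArmBounds.second_difference_le (hn : 2 ≤ n) {C : ℝ} (h : HasArmBounds n C K)
    (hC : 0 ≤ C) (hδ : step n ≤ 1 / 4) {j : ℕ} (h1 : 1 ≤ j) (h2 : j < n) :
    supp K (j * step n + step n) - 2 * cos (step n) * supp K (j * step n) +
      supp K (j * step n - step n) ≤ 2 * (3 * C) * (1 - cos (step n)) := by
  obtain ⟨hc, hs⟩ := cos_sin_step_pos hn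
  have h3 := h.edge_le j h1 h2
  rw [← qp_sub_qm_mul_sin K hs]
  rw [fm, fp, sub_sub_sub_cancel_left] at h3
  have h4 := mul_le_mul_of_nonneg_right h3 hs.le
  have h5 := mul_le_mul_of_nonneg_left
    (le_two_mul_one_sub_cos (step_pos (n := n) (by omega)) hδ) hC
  linarith

theorem HasArmBounds.supp_le_right (hn : 2 ≤ n) {C : ℝ} (h : HasArmBounds n C K)
    (hC : 0 ≤ C) (hδ : step n ≤ 1 / 4) {j k : ℕ} (hjk : j ≤ k) (hk : k ≤ n) :
    supp K (k * step n) ≤ supp K (j * step n) * cos ((k - j : ℝ) * step n) +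
      qp K (step n) (j * step n) * sin ((k - j : ℝ) * step n) +
      3 * C * (1 - cos ((k - j : ℝ) * step n)) := by
  obtain ⟨hc, hs⟩ := cos_sin_step_pos hn
  have hp := step_pos (n := n) (by omega)
  have hN : ((n - j : ℕ) : ℝ) * step n < π := by
    have h1 := mul_step (n := n) (by omega)
    have : ((n - j : ℕ) : ℝ) * step n ≤ n * step n := by
      gcongr
      omega
    linarith [pi_pos]
  have h1 := le_of_second_difference_le hp hN (by positivity : 0 ≤ 3 * C)
    (fun m => supp K ((j + m : ℕ) * step n)) hs (fun m hm => ?_) (m := k - j) (by omega)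
  · simp only [Nat.add_sub_cancel' hjk, add_zero, Nat.cast_sub hjk] at h1
    rw [qp]
    convert h1 using 7
    push_cast
    ring
  · have := h.second_difference_le hn hC hδ (j := j + m + 1) (by omega) (by omega)
    rw [show ((j + m + 1 : ℕ) : ℝ) * step n + step n = (j + (m + 2) : ℕ) * step n by push_cast; ring,
      show ((j + m + 1 : ℕ) : ℝ) * step n - step n = (j + m : ℕ) * step n by push_cast; ring] at this
    exact this

theorem HasArmBounds.supp_le_left (hn : 2 ≤ n) {C : ℝ} (h : HasArmBounds n C K)
    (hC : 0 ≤ C) (hδ : step n ≤ 1 / 4) {j k : ℕ} (hjk : k ≤ j) (hj : j ≤ n) :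
    supp K (k * step n) ≤ supp K (j * step n) * cos ((j - k : ℝ) * step n) -
      qm K (step n) (j * step n) * sin ((j - k : ℝ) * step n) +
      3 * C * (1 - cos ((j - k : ℝ) * step n)) := by
  obtain ⟨hc, hs⟩ := cos_sin_step_pos hn
  have hp := step_pos (n := n) (by omega)
  have hN : (j : ℝ) * step n < π := by
    have h1 := mul_step (n := n) (by omega)
    have : (j : ℝ) * step n ≤ n * step n := by gcongr
    linarith [pi_pos]
  have h1 := le_of_second_difference_le hp hN (by positivity : 0 ≤ 3 * C)
    (fun m => supp K ((j - m : ℝ) * step n)) hs (fun m hm => ?_) (m := j - k) (by omega)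
  · simp only [Nat.cast_sub hjk, sub_sub_cancel, Nat.cast_zero, sub_zero, Nat.cast_one] at h1
    rw [qm, sub_eq_add_neg (supp K (j * step n) * _), ← neg_mul, ← neg_div, neg_sub]
    convert h1 using 7
    ring
  · have := h.second_difference_le hn hC hδ (j := j - m - 1) (by omega) (by omega)
    have e : ((j - m - 1 : ℕ) : ℝ) = j - m - 1 := by
      rw [Nat.cast_sub (by omega), Nat.cast_sub (by omega)]
      simp
    rw [e] at this
    push_cast
    convert this using 1
    rw [show ((j : ℝ) - (m + 2)) * step n = (j - m - 1) * step n - step n by ring,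
      show ((j : ℝ) - (m + 1)) * step n = (j - m - 1) * step n by ring,
      show ((j : ℝ) - m) * step n = (j - m - 1) * step n + step n by ring]
    ring

end Discrete

/-! ### Passage to the limit -/

theorem norm_u_sub_u_le (s t : ℝ) : ‖u s - u t‖ ≤ |s - t| := by
  refine abs_le_of_sq_le_sq' ?_ (abs_nonneg _) |>.2
  rw [sq_abs, norm_sub_sq_real, norm_u, norm_u]
  have h1 : inner ℝ (u s) (u t) = cos (s - t) := by
    rw [inner_u, u_apply_zero, u_apply_one, cos_sub]
  have h2 := one_sub_sq_div_two_le_cos (x := s - t)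
  rw [h1]
  linarith

theorem continuous_supp (K : ConvexBody Plane) : Continuous (supp K) := by
  obtain ⟨M, hM⟩ := K.isBounded.exists_norm_le
  have hM0 : 0 ≤ M := by
    obtain ⟨p, hp⟩ := K.nonempty
    exact (norm_nonneg p).trans (hM p hp)
  have key : ∀ s t, supp K s ≤ supp K t + M * |s - t| := fun s t => by
    obtain ⟨p, hp, h⟩ := exists_mem_edge K s
    have h1 := inner_le_supp hp t
    have h2 := (real_inner_le_norm p (u s - u t)).trans
      (mul_le_mul (hM p hp) (norm_u_sub_u_le s t) (norm_nonneg _) hM0)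
    rw [inner_sub_right] at h2
    linarith
  refine (LipschitzWith.of_dist_le_mul (K := M.toNNReal) fun s t => ?_).continuous
  rw [Real.dist_eq, Real.dist_eq, abs_le, Real.coe_toNNReal M hM0]
  have h1 := key s t
  have h2 := key t s
  rw [abs_sub_comm] at h2
  constructor <;> linarith

theorem tendsto_step {ι : Type*} {l : Filter ι} {n : ι → ℕ} (hn : Tendsto n l atTop) :
    Tendsto (fun i => step (n i)) l (𝓝 0) :=
  (tendsto_const_div_atTop_nhds_zero_nat (π / 2)).comp hn

theorem tendsto_floor_mul {ι : Type*} {l : Filter ι} {δ : ι → ℝ} (hδ0 : ∀ᶠ i in l, 0 < δ i)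
    (hδ : Tendsto δ l (𝓝 0)) {x : ℝ} (hx : 0 ≤ x) :
    Tendsto (fun i => (⌊x / δ i⌋₊ : ℝ) * δ i) l (𝓝 x) := by
  refine tendsto_of_tendsto_of_tendsto_of_le_of_le' (g := fun i => x - δ i) (h := fun _ => x)
    (by simpa using tendsto_const_nhds.sub hδ) tendsto_const_nhds ?_ ?_
  · filter_upwards [hδ0] with i hi
    have := Nat.lt_floor_add_one (x / δ i)
    rw [div_lt_iff₀ hi] at this
    linarith
  · filter_upwards [hδ0] with i hi
    have := Nat.floor_le (div_nonneg hx hi.le)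
    rwa [le_div_iff₀ hi] at this

theorem tendsto_supp {ι : Type*} {l : Filter ι} {L : ι → ConvexBody Plane} {K : ConvexBody Plane}
    {d : ι → ℝ} (hd : ∀ i t, |supp (L i) t - supp K t| ≤ d i) (hd0 : Tendsto d l (𝓝 0))
    {x : ι → ℝ} {y : ℝ} (hx : Tendsto x l (𝓝 y)) :
    Tendsto (fun i => supp (L i) (x i)) l (𝓝 (supp K y)) := by
  have h1 : Tendsto (fun i => supp (L i) (x i) - supp K (x i)) l (𝓝 0) :=
    squeeze_zero_norm (fun i => hd i (x i)) hd0
  have h2 := h1.add (((continuous_supp K).tendsto y).comp hx)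
  simpa using h2

/-- The right side is of second order at 0. This compares the slopes of two support functions at a
contact angle, using one side only. -/
theorem nonpos_of_mul_sin_le {y C ε : ℝ} (hε : 0 < ε)
    (h : ∀ x, 0 < x → x < ε → y * sin x ≤ C * (1 - cos x)) : y ≤ 0 := by
  by_contra hy
  push Not at hy
  have hC : 0 ≤ |C| := abs_nonneg C
  set x := min (min (ε / 2) 1) (y / (2 * (|C| + 1))) with hx
  have hx0 : 0 < x := by positivity
  have hx1 : x ≤ 1 := (min_le_left _ _).trans (min_le_right _ _)
  have hxε : x < ε := lt_of_le_of_lt ((min_le_left _ _).trans (min_le_left _ _)) (by linarith)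
  have hxy : x * (2 * (|C| + 1)) ≤ y := by
    rw [← le_div_iff₀ (by positivity)]
    exact min_le_right _ _
  have h1 := h x hx0 hxε
  have h2 := sin_gt_sub_cube hx0
  have h3 := one_sub_sq_div_two_le_cos (x := x)
  have h4 : x ^ 3 ≤ x := pow_le_of_le_one hx0.le hx1 three_ne_zero
  have h5 : y * (x / 2) ≤ y * sin x := by gcongr; linarith
  have h6 : C * (1 - cos x) ≤ |C| * (x ^ 2 / 2) := by
    have := sub_nonneg.2 (cos_le_one x)
    refine mul_le_mul (le_abs_self C) (by linarith) this hC
  have h7 : x * (x * (2 * (|C| + 1))) ≤ x * y := by gcongr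
  nlinarith [mul_pos hx0 hy, mul_pos hx0 hx0, mul_nonneg hC (sq_nonneg x)]

theorem inner_u_le_supp_of_mem_edge {K : ConvexBody Plane} {t : ℝ} {p : Plane}
    (hp : p ∈ edge K t) (s : ℝ) :
    supp K t * cos (s - t) + inner ℝ p (v t) * sin (s - t) ≤ supp K s := by
  have := inner_le_supp hp.1 s
  rwa [inner_u_eq_frame p t, hp.2] at this

/-- At the angles of `[0, π / 2)`, a limit of maximum polygon caps admits a disc of fixed radius as
an outer approximation, and its first arm length is larger than `1`. -/
theorem exists_supp_le_of_limit {K : ConvexBody Plane} (hK : ∀ p ∈ (K : Set Plane), 0 ≤ p 1)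
    {n : ℕ → ℕ} (hn : Tendsto n atTop atTop) {L : ℕ → ConvexBody Plane}
    (hL : ∀ i, IsMaximumPolygonCap (π / 2) (uniformAngleSet (π / 2) (n i)) (L i))
    {d : ℕ → ℝ} (hd : ∀ i t, |supp (L i) t - supp K t| ≤ d i) (hd0 : Tendsto d atTop (𝓝 0)) :
    ∃ C : ℝ, 0 ≤ C ∧ ∀ t ∈ Ico 0 (π / 2), ∀ p ∈ edge K t,
      (∀ s ∈ Icc 0 (π / 2), supp K s ≤ supp K t * cos (s - t) + inner ℝ p (v t) * sin (s - t) +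
        C * (1 - cos (s - t))) ∧
      (0 < t → inner ℝ p (v t) ≤ supp K (t + π / 2) - 1 - t / 2) := by
  obtain ⟨M₀, hM₀⟩ := exists_abs_supp_le K
  have hM₀0 : 0 ≤ M₀ := (abs_nonneg _).trans (hM₀ 0)
  set M := M₀ + 1 with hM
  set C := 800 * M + 200 with hC
  have hC0 : 0 ≤ C := by positivity
  have hδ := tendsto_step hn
  have hn2 : ∀ᶠ i in atTop, 2 ≤ n i := hn.eventually_ge_atTop 2
  have hδ0 : ∀ᶠ i in atTop, 0 < step (n i) := hn2.mono fun i hi => step_pos (by omega)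
  have hδ1 : ∀ᶠ i in atTop, step (n i) ≤ 1 / 4 := hδ.eventually_le_const (by norm_num)
  have hsupp : ∀ᶠ i in atTop, ∀ t, |supp (L i) t| ≤ M := by
    filter_upwards [hd0.eventually_le_const zero_lt_one] with i hi t
    have h1 := abs_le.1 (hd i t)
    have h2 := abs_le.1 (hM₀ t)
    rw [abs_le]
    constructor <;> linarith [h1.1, h1.2, h2.1, h2.2]
  have harm : ∀ᶠ i in atTop, HasArmBounds (n i) C (L i) := by
    have h1 : Tendsto (fun i => (400 * (8 * M) + 400) * (8 * M) * step (n i)) atTop (𝓝 0) := by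
      simpa using hδ.const_mul ((400 * (8 * M) + 400) * (8 * M))
    filter_upwards [hn2, hδ1, hsupp, h1.eventually_le_const (by norm_num : (0 : ℝ) < 1 / 50)]
      with i h2 h3 h4 h5
    exact (hL i).hasArmBounds h2 h3 (by linarith) h4 h5
  refine ⟨3 * C, by positivity, fun t ht p hp => ?_⟩
  set j : ℕ → ℕ := fun i => ⌊t / step (n i)⌋₊ with hj
  have hjt := tendsto_floor_mul hδ0 hδ ht.1
  set q : ℕ → ℝ := fun i => qp (L i) (step (n i)) (j i * step (n i)) with hq
  have hq0 : ∀ i, q i = supp (L i) (j i * step (n i) + π / 2) -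
      fp (L i) (step (n i)) (j i * step (n i)) := fun i => by
    rw [fp, sub_sub_cancel]
  have hqb : ∀ᶠ i in atTop, q i ∈ Icc (-(3 * M)) (3 * M) := by
    filter_upwards [hδ0, hδ1, hsupp] with i h1 h2 h3
    have h4 := fp_nonneg (L i) h1 (by linarith [pi_gt_three]) (j i * step (n i))
    have h5 := fp_le h1 (by linarith [pi_gt_three]) h3 (j i * step (n i))
    have h6 := abs_le.1 (h3 (j i * step (n i) + π / 2))
    rw [hq0]
    constructor <;> linarith [h6.1, h6.2]
  -- The tangential coordinates q are only known to be bounded; an ultrafilter finer than `atTop`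
  -- makes them converge without extracting subsequences.
  let U : Ultrafilter ℕ := Ultrafilter.of atTop
  have hU : (U : Filter ℕ) ≤ atTop := Ultrafilter.of_le _
  obtain ⟨D, -, hD⟩ := isCompact_Icc.ultrafilter_le_nhds' (U.map q) (hU hqb)
  replace hD : Tendsto q U (𝓝 D) := hD
  have hδU := hδ.mono_left hU
  have hjtU := hjt.mono_left hU
  have hd0U := hd0.mono_left hU
  have hj1 : 0 < t → ∀ᶠ i in atTop, 1 ≤ j i := fun ht0 => by
    filter_upwards [hδ0, hδ.eventually_le_const ht0] with i h1 h2
    exact Nat.le_floor (by rw [Nat.cast_one, le_div_iff₀ h1]; linarith)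
  have hjn : ∀ᶠ i in atTop, j i < n i := by
    filter_upwards [hn2] with i hi
    have h1 := mul_step (n := n i) (by omega)
    have h2 := step_pos (n := n i) (by omega)
    rw [hj, Nat.floor_lt (div_nonneg ht.1 h2.le), div_lt_iff₀ h2, h1]
    exact ht.2
  have hright : ∀ s ∈ Icc t (π / 2), supp K s ≤ supp K t * cos (s - t) + D * sin (s - t) +
      3 * C * (1 - cos (s - t)) := by
    intro s hs
    have hkt := (tendsto_floor_mul hδ0 hδ (ht.1.trans hs.1)).mono_left hU
    have hdiff : Tendsto (fun i => ((⌊s / step (n i)⌋₊ : ℝ) - j i) * step (n i)) U (𝓝 (s - t)) := by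
      simpa [sub_mul] using hkt.sub hjtU
    refine le_of_tendsto_of_tendsto (tendsto_supp hd hd0U hkt)
      ((((tendsto_supp hd hd0U hjtU).mul ((continuous_cos.tendsto _).comp hdiff)).add
        (hD.mul ((continuous_sin.tendsto _).comp hdiff))).add
        (((continuous_cos.tendsto _).comp hdiff).const_sub 1 |>.const_mul (3 * C))) ?_
    refine hU ?_
    filter_upwards [harm, hn2, hδ1, hδ0] with i h1 h2 h3 h4
    refine h1.supp_le_right h2 hC0 h3 (Nat.floor_mono (by gcongr; exact hs.1)) ?_
    refine Nat.floor_le_of_le ?_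
    rw [div_le_iff₀ h4, mul_step (by omega)]
    exact hs.2
  have hleft : ∀ s ∈ Ico 0 t, supp K s ≤ supp K t * cos (s - t) + D * sin (s - t) +
      3 * C * (1 - cos (s - t)) := by
    intro s hs
    have ht0 : 0 < t := hs.1.trans_lt hs.2
    have hkt := (tendsto_floor_mul hδ0 hδ hs.1).mono_left hU
    have hdiff : Tendsto (fun i => ((j i : ℝ) - ⌊s / step (n i)⌋₊) * step (n i)) U (𝓝 (t - s)) := by
      simpa [sub_mul] using hjtU.sub hkt
    -- The edge length qp - qm is at most C δ, so both ends have the same limit D.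
    have hqm : Tendsto (fun i => qm (L i) (step (n i)) (j i * step (n i))) U (𝓝 D) := by
      have h1 : Tendsto (fun i => q i - qm (L i) (step (n i)) (j i * step (n i))) U (𝓝 0) := by
        refine (squeeze_zero' ?_ ?_ (by simpa using hδ.const_mul C)).mono_left hU
        · filter_upwards [hδ0, hδ1] with i h1 h2
          exact sub_nonneg.2 (qm_le_qp _ h1 (by linarith [pi_gt_three]) _)
        · filter_upwards [harm, hj1 ht0, hjn] with i h1 h2 h3
          have := h1.edge_le (j i) h2 h3
          rwa [fm, fp, sub_sub_sub_cancel_left] at this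
      simpa using hD.sub h1
    rw [show cos (s - t) = cos (t - s) by rw [← cos_neg, neg_sub],
      show D * sin (s - t) = -(D * sin (t - s)) by rw [← neg_sub t s, sin_neg, mul_neg],
      ← sub_eq_add_neg]
    refine le_of_tendsto_of_tendsto (tendsto_supp hd hd0U hkt)
      ((((tendsto_supp hd hd0U hjtU).mul ((continuous_cos.tendsto _).comp hdiff)).sub
        (hqm.mul ((continuous_sin.tendsto _).comp hdiff))).add
        (((continuous_cos.tendsto _).comp hdiff).const_sub 1 |>.const_mul (3 * C))) ?_
    refine hU ?_
    filter_upwards [harm, hn2, hδ1, hδ0, hjn] with i h1 h2 h3 h4 h5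
    exact h1.supp_le_left h2 hC0 h3 (Nat.floor_mono (by gcongr; exact hs.2.le)) h5.le
  have hall : ∀ s ∈ Icc 0 (π / 2), supp K s ≤ supp K t * cos (s - t) + D * sin (s - t) +
      3 * C * (1 - cos (s - t)) := fun s hs => by
    rcases lt_or_ge s t with h | h
    exacts [hleft s ⟨hs.1, h⟩, hright s ⟨h, hs.2⟩]
  have hle : inner ℝ p (v t) ≤ D := by
    refine sub_nonpos.1 (nonpos_of_mul_sin_le (C := 3 * C) (sub_pos.2 ht.2) fun x hx0 hx => ?_)
    have h1 := inner_u_le_supp_of_mem_edge hp (t + x)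
    have h2 := hall (t + x) ⟨by linarith [ht.1], by linarith⟩
    rw [add_sub_cancel_left] at h1 h2
    linarith
  -- Angles on the right of t gave the previous inequality and those on the left give this one. At t
  -- = 0 there is no left side, but there q is exactly 0 by `supp_one`, and K lies above the axis.
  have hge : D ≤ inner ℝ p (v t) := by
    rcases ht.1.eq_or_lt with h0 | h0
    · subst h0
      have h1 : D ≤ 0 := by
        refine (tendsto_nhds_unique (hD.congr' (f₂ := fun _ => 0) ?_) tendsto_const_nhds).le
        refine hU ?_
        filter_upwards [hn2] with i hi
        have h1 := (hL i).isPolygonCap.supp_one hi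
        simp only [hq, hj, zero_div, Nat.floor_zero, Nat.cast_zero, zero_mul, qp, zero_add, h1,
          sub_self]
      have h2 := hK p hp.1
      refine h1.trans ?_
      simpa [inner_v] using h2
    · refine sub_nonpos.1 (nonpos_of_mul_sin_le (C := 3 * C) h0 fun x hx0 hx => ?_)
      have h1 := inner_u_le_supp_of_mem_edge hp (t - x)
      have h2 := hall (t - x) ⟨by linarith, by linarith [ht.2]⟩
      rw [sub_sub_cancel_left, sin_neg, cos_neg] at h1 h2
      linarith
  have hpD := le_antisymm hle hge
  rw [hpD]
  refine ⟨hall, fun ht0 => ?_⟩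
  have hlim := tendsto_supp hd hd0U (hjtU.add_const (π / 2))
  have hrhs : Tendsto (fun i => supp (L i) (j i * step (n i) + π / 2) - 1 -
      j i * step (n i) / 2 + C * step (n i)) U (𝓝 (supp K (t + π / 2) - 1 - t / 2)) := by
    simpa using ((hlim.sub_const 1).sub (hjtU.div_const 2)).add (hδU.const_mul C)
  refine le_of_tendsto_of_tendsto hD hrhs (hU ?_)
  filter_upwards [harm, hj1 ht0, hjn] with i h1 h2 h3
  have := h1.fp_ge (j i) h2 h3
  have := hq0 i
  linarith

/-! ### Density of the length measure of a Lipschitz curve -/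

/-- The one-dimensional Hausdorff measure of the images of the Borel sets under a Lipschitz curve
whose fibers are intervals has a density. -/
theorem exists_density_hausdorffMeasure_image {J : Set ℝ} {l r : ℕ → ℝ}
    (hJ : J = ⋃ n, Icc (l n) (r n)) (hJfin : volume J ≠ ⊤) {A : ℝ → Plane} {C : ℝ≥0}
    (hA : LipschitzOnWith C A J)
    (hfib : ∀ a ∈ J, ∀ b ∈ J, A a = A b → ∀ c, a ≤ c → c ≤ b → A c = A a) :
    ∃ ρ : ℝ → ℝ≥0, Measurable ρ ∧ ∀ X, MeasurableSet X → X ⊆ J →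
      Measure.hausdorffMeasure 1 (A '' X) = ∫⁻ t in X, (ρ t : ℝ≥0∞) := by
  classical
  set H : Measure Plane := Measure.hausdorffMeasure 1 with hH
  have hlip : ∀ X ⊆ J, H (A '' X) ≤ C * volume X := fun X hX => by
    have := (hA.mono hX).hausdorffMeasure_image_le zero_le_one
    rwa [hausdorffMeasure_real, ENNReal.rpow_one] at this
  have hmeas : ∀ a, MeasurableSet (A '' (J ∩ Iic a)) := fun a => by
    have hsub : ∀ n, Icc (l n) (r n) ∩ Iic a ⊆ J := fun n t ht =>
      hJ ▸ mem_iUnion.2 ⟨n, ht.1⟩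
    have : J ∩ Iic a = ⋃ n, Icc (l n) (r n) ∩ Iic a := by rw [hJ, iUnion_inter]
    rw [this, image_iUnion]
    refine MeasurableSet.iUnion fun n => ?_
    exact ((isCompact_Icc.inter_right isClosed_Iic).image_of_continuousOn
      (hA.continuousOn.mono (hsub n))).isClosed.measurableSet
  have hΓ : MeasurableSet (A '' J) := by
    have : J = ⋃ n : ℕ, J ∩ Iic (n : ℝ) := by
      rw [← inter_iUnion, eq_comm, inter_eq_left]
      intro t _
      obtain ⟨n, hn⟩ := exists_nat_ge t
      exact mem_iUnion.2 ⟨n, hn⟩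
    rw [this, image_iUnion]
    exact MeasurableSet.iUnion fun n => hmeas n
  have hJm : MeasurableSet J := hJ ▸ MeasurableSet.iUnion fun n => measurableSet_Icc
  -- a measurable section of the curve
  set τ : Plane → ℝ := (A '' J).piecewise (Function.invFunOn A J) (fun _ => 0) with hτ
  have hτJ : ∀ x ∈ A '' J, τ x ∈ J ∧ A (τ x) = x := fun x hx => by
    rw [hτ, piecewise_eq_of_mem _ _ _ hx]
    exact ⟨Function.invFunOn_mem hx, Function.invFunOn_eq hx⟩
  have hτm : Measurable τ := by
    refine measurable_of_Iic fun a => ?_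
    have h1 : MeasurableSet (A '' J ∩ τ ⁻¹' Iic a) := by
      have hsub : A '' J ∩ τ ⁻¹' Iic a ⊆ A '' (J ∩ Iic a) := fun x hx =>
        ⟨τ x, ⟨(hτJ x hx.1).1, hx.2⟩, (hτJ x hx.1).2⟩
      -- Such a point has a preimage at most a, while the one chosen by τ is larger than a. Its
      -- fiber is an interval, so it contains a: the only candidate is A a.
      have hss : (A '' (J ∩ Iic a) \ (A '' J ∩ τ ⁻¹' Iic a)).Subsingleton := by
        have key : ∀ x ∈ A '' (J ∩ Iic a) \ (A '' J ∩ τ ⁻¹' Iic a), ∃ t ∈ J, t ≤ a ∧ A t = x ∧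
            ∀ c, t ≤ c → c ≤ a → A c = x := by
          rintro x ⟨⟨t, ht, rfl⟩, hx⟩
          have h2 := hτJ (A t) (mem_image_of_mem A ht.1)
          refine ⟨t, ht.1, ht.2, rfl, fun c h3 h4 => hfib t ht.1 _ h2.1 h2.2.symm c h3 ?_⟩
          by_contra h5
          exact hx ⟨mem_image_of_mem A ht.1, le_of_lt (lt_of_lt_of_le (not_le.1 h5) h4)⟩
        intro x hx y hy
        obtain ⟨t, -, h1, h2, h3⟩ := key x hx
        obtain ⟨s, -, h4, h5, h6⟩ := key y hy
        rcases le_total t s with h | h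
        · rw [← h3 s h h4, h5]
        · rw [← h6 t h h1, h2]
      rw [← sdiff_sdiff_cancel_left hsub]
      exact (hmeas a).diff hss.measurableSet
    have h2 : MeasurableSet ((A '' J)ᶜ ∩ τ ⁻¹' Iic a) := by
      have : (A '' J)ᶜ ∩ τ ⁻¹' Iic a = (A '' J)ᶜ ∩ {_x | (0 : ℝ) ≤ a} := by
        ext x
        refine and_congr_right fun hx => ?_
        rw [mem_preimage, hτ, piecewise_eq_of_notMem _ _ _ hx]
        rfl
      rw [this]
      exact hΓ.compl.inter (MeasurableSet.const _)
    have : τ ⁻¹' Iic a = (A '' J ∩ τ ⁻¹' Iic a) ∪ ((A '' J)ᶜ ∩ τ ⁻¹' Iic a) := by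
      rw [← union_inter_distrib_right, union_compl_self, univ_inter]
    rw [this]
    exact h1.union h2
  -- the multiple points are negligible
  set E : Set Plane := {x | ∃ a ∈ J, ∃ b ∈ J, a < b ∧ A a = x ∧ A b = x} with hE
  have hEc : E.Countable := by
    choose! a ha b hb hab hAa hAb using fun x (hx : x ∈ E) => hx
    -- Distinct multiple points have disjoint fibers, each containing a nonempty open interval, so
    -- they are countably many.
    have hdisj : E.PairwiseDisjoint fun x => Ioo (a x) (b x) := by
      intro x hx y hy hxy
      refine Set.disjoint_left.2 fun t ht ht' => hxy ?_
      have h1 := hfib _ (ha x hx) _ (hb x hx) ((hAa x hx).trans (hAb x hx).symm) t ht.1.le ht.2.le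
      have h2 := hfib _ (ha y hy) _ (hb y hy) ((hAa y hy).trans (hAb y hy).symm) t ht'.1.le ht'.2.le
      rw [← hAa x hx, ← hAa y hy, ← h1, ← h2]
    exact hdisj.countable_of_isOpen (fun _ _ => isOpen_Ioo) fun x hx => nonempty_Ioo.2 (hab x hx)
  have : NullSingletonClass H := Measure.nullSingletonClass_hausdorff Plane one_pos
  set μ : Measure ℝ := (H.restrict (A '' J)).map τ with hμ
  have hμX : ∀ X, MeasurableSet X → X ⊆ J → μ X = H (A '' X) := by
    intro X hX hXJ
    rw [hμ, Measure.map_apply hτm hX, Measure.restrict_apply (hτm hX)]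
    refine le_antisymm (measure_mono fun x hx => ⟨τ x, hx.1, (hτJ x hx.2).2⟩) ?_
    -- The section can miss X only at multiple points, which are negligible for the Hausdorff
    -- measure.
    have hsub : A '' X ⊆ (τ ⁻¹' X ∩ A '' J) ∪ E := by
      rintro x ⟨t, ht, rfl⟩
      have h1 := mem_image_of_mem A (hXJ ht)
      have h2 := hτJ _ h1
      by_cases h : τ (A t) ∈ X
      · exact Or.inl ⟨h, h1⟩
      · right
        have hne : τ (A t) ≠ t := fun h' => h (by rw [h']; exact ht)
        rcases hne.lt_or_gt with h3 | h3
        · exact ⟨_, h2.1, t, hXJ ht, h3, h2.2, rfl⟩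
        · exact ⟨t, hXJ ht, _, h2.1, h3, rfl, h2.2⟩
    refine (measure_mono hsub).trans ((measure_union_le _ _).trans ?_)
    rw [hEc.measure_zero, add_zero]
  have hμJc : μ Jᶜ = 0 := by
    rw [hμ, Measure.map_apply hτm hJm.compl, Measure.restrict_apply (hτm hJm.compl)]
    have : τ ⁻¹' Jᶜ ∩ A '' J = ∅ := by
      ext x
      simp only [mem_inter_iff, mem_preimage, mem_compl_iff, mem_empty_iff_false, iff_false,
        not_and]
      exact fun h hx => h (hτJ x hx).1
    rw [this, measure_empty]
  have hac : μ ≪ volume := by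
    refine Measure.AbsolutelyContinuous.mk fun X hX h0 => ?_
    rw [← measure_inter_add_sdiff X hJm, hμX _ (hX.inter hJm) inter_subset_right,
      measure_mono_null (fun x hx => hx.2) hμJc, add_zero]
    refine le_antisymm ((hlip _ inter_subset_right).trans ?_) zero_le
    rw [measure_mono_null inter_subset_left h0, mul_zero]
  have : IsFiniteMeasure μ := by
    refine ⟨?_⟩
    rw [← measure_add_measure_compl hJm, hμJc, add_zero, hμX J hJm subset_rfl]
    exact (hlip J subset_rfl).trans_lt (ENNReal.mul_lt_top ENNReal.coe_lt_top hJfin.lt_top)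
  refine ⟨fun t => (μ.rnDeriv volume t).toNNReal, (μ.measurable_rnDeriv volume).ennreal_toNNReal,
    fun X hX hXJ => ?_⟩
  rw [← hμX X hX hXJ, ← Measure.setLIntegral_rnDeriv hac X]
  refine lintegral_congr_ae (ae_restrict_of_ae ?_)
  filter_upwards [μ.rnDeriv_lt_top volume] with t ht
  rw [ENNReal.coe_toNNReal ht.ne]

/-! ### Bodies dominated by discs -/

/-- On the angles in `J`, each edge of `K` is contained in the boundary of a disc of radius `C`
whose support function dominates that of `K`. -/
def IsRound (K : ConvexBody Plane) (J : Set ℝ) (C : ℝ) : Prop :=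
  ∀ t ∈ J, ∀ p ∈ edge K t, ∀ s ∈ J,
    supp K s ≤ supp K t * cos (s - t) + inner ℝ p (v t) * sin (s - t) + C * (1 - cos (s - t))

/-- A point of the edge of angle `t`. -/
def edgePoint (K : ConvexBody Plane) (t : ℝ) : Plane := (exists_mem_edge K t).choose

theorem edgePoint_mem (K : ConvexBody Plane) (t : ℝ) : edgePoint K t ∈ edge K t :=
  (exists_mem_edge K t).choose_spec

section Round

variable {K : ConvexBody Plane} {J : Set ℝ} {C : ℝ}

/-- The disc attached to one point of the edge dominates the support function of the other point,
and both agree at t; comparing slopes on one side of t suffices, so t may be an endpoint of J. -/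
theorem IsRound.inner_v_eq (h : IsRound K J C) [hJ : J.OrdConnected] (hJn : J.Nontrivial)
    {t : ℝ} (ht : t ∈ J) {p q : Plane} (hp : p ∈ edge K t) (hq : q ∈ edge K t) :
    inner ℝ p (v t) = inner ℝ q (v t) := by
  obtain ⟨s, hs, hst⟩ := hJn.exists_ne t
  have key : ∀ p ∈ edge K t, ∀ q ∈ edge K t, ∀ x, t + x ∈ J →
      (inner ℝ p (v t) - inner ℝ q (v t)) * sin x ≤ C * (1 - cos x) := by
    intro p hp q hq x hx
    have h1 := inner_u_le_supp_of_mem_edge hp (t + x)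
    have h2 := h t ht q hq (t + x) hx
    rw [add_sub_cancel_left] at h1 h2
    linarith
  rcases hst.lt_or_gt with h1 | h1
  · have key' : ∀ p ∈ edge K t, ∀ q ∈ edge K t, inner ℝ q (v t) ≤ inner ℝ p (v t) := by
      intro p hp q hq
      refine sub_nonpos.1 (nonpos_of_mul_sin_le (C := C) (sub_pos.2 h1) fun x h2 h3 => ?_)
      have := key p hp q hq (-x) (hJ.out hs ht ⟨by linarith, by linarith⟩)
      rw [sin_neg, cos_neg] at this
      linarith
    exact le_antisymm (key' q hq p hp) (key' p hp q hq)
  · have key' : ∀ p ∈ edge K t, ∀ q ∈ edge K t, inner ℝ p (v t) ≤ inner ℝ q (v t) := by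
      intro p hp q hq
      refine sub_nonpos.1 (nonpos_of_mul_sin_le (C := C) (sub_pos.2 h1) fun x h2 h3 => ?_)
      exact key p hp q hq x (hJ.out ht hs ⟨by linarith, by linarith⟩)
    exact le_antisymm (key' p hp q hq) (key' q hq p hp)

theorem IsRound.edge_eq (h : IsRound K J C) [J.OrdConnected] (hJn : J.Nontrivial)
    {t : ℝ} (ht : t ∈ J) : edge K t = {edgePoint K t} := by
  refine eq_singleton_iff_unique_mem.2 ⟨edgePoint_mem K t, fun p hp => ?_⟩
  rw [eq_frame p t, eq_frame (edgePoint K t) t, hp.2, (edgePoint_mem K t).2,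
    h.inner_v_eq hJn ht hp (edgePoint_mem K t)]

/-- With θ = s - t, the disc bounds from t to s and from s to t confine the difference of the two
points to normal coordinates in [-C(1 - cos θ), 0] and tangential ones in [0, C sin θ]. -/
theorem IsRound.norm_sub_le (h : IsRound K J C) (hC : 0 ≤ C)
    (hJ : ∀ s ∈ J, ∀ t ∈ J, s - t ≤ π / 2) {s t : ℝ} (hs : s ∈ J) (ht : t ∈ J) (hts : t ≤ s) :
    ‖edgePoint K s - edgePoint K t‖ ≤ 3 * C * (s - t) := by
  rcases hts.eq_or_lt with rfl | hlt
  · simp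
  set P := edgePoint K s
  set Q := edgePoint K t
  have hP : P ∈ edge K s := edgePoint_mem K s
  have hQ : Q ∈ edge K t := edgePoint_mem K t
  have hθ := hJ s hs t ht
  have hsin : 0 < sin (s - t) := sin_pos_of_pos_of_lt_pi (by linarith) (by linarith [pi_pos])
  have hcos : 0 ≤ cos (s - t) := cos_nonneg_of_neg_pi_div_two_le_of_le (by linarith) hθ
  have h1 : inner ℝ P (u t) ≤ supp K t := inner_le_supp hP.1 t
  have h2 : supp K t ≤ inner ℝ P (u t) + C * (1 - cos (s - t)) := by
    have := h s hs P hP t ht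
    rw [← hP.2, ← inner_u_eq_frame] at this
    rwa [← cos_neg (s - t), neg_sub]
  have h3 : inner ℝ Q (u s) ≤ supp K s := inner_le_supp hQ.1 s
  have h4 : supp K s ≤ inner ℝ Q (u s) + C * (1 - cos (s - t)) := by
    have := h t ht Q hQ s hs
    rwa [← hQ.2, ← inner_u_eq_frame] at this
  have e1 : inner ℝ (P - Q) (u t) = inner ℝ P (u t) - supp K t := by
    rw [inner_sub_left, hQ.2]
  have e2 : inner ℝ (P - Q) (u s) = supp K s - inner ℝ Q (u s) := by
    rw [inner_sub_left, hP.2]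
  have e3 := inner_u_eq_frame (P - Q) t s
  set a := inner ℝ (P - Q) (u t)
  set b := inner ℝ (P - Q) (v t)
  set θ := s - t with hθdef
  have hθ0 : 0 < θ := by linarith
  have ha0 : a ≤ 0 := by linarith
  have ha1 : -(C * (1 - cos θ)) ≤ a := by linarith
  have hb0 : 0 ≤ b := by
    have : 0 ≤ b * sin θ := by linarith [mul_nonneg (neg_nonneg.2 ha0) hcos]
    exact nonneg_of_mul_nonneg_left this hsin
  have hb1 : b ≤ C * sin θ := by
    refine le_of_mul_le_mul_right ?_ hsin
    have h5 := mul_le_mul_of_nonneg_right ha1 hcos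
    have h6 := sin_sq_add_cos_sq θ
    nlinarith
  have h7 := sin_le hθ0.le
  have h8 := one_sub_sq_div_two_le_cos (x := θ)
  have h9 : θ ≤ 2 := by linarith [pi_le_four]
  have h10 : 1 - cos θ ≤ θ := by nlinarith
  refine (norm_le_abs_add_abs (P - Q) t).trans ?_
  change |a| + |b| ≤ _
  rw [abs_of_nonpos ha0, abs_of_nonneg hb0]
  nlinarith [mul_le_mul_of_nonneg_left h7 hC, mul_le_mul_of_nonneg_left h10 hC,
    mul_nonneg hC hθ0.le]

theorem IsRound.lipschitzOnWith (h : IsRound K J C) (hC : 0 ≤ C)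
    (hJ : ∀ s ∈ J, ∀ t ∈ J, s - t ≤ π / 2) :
    LipschitzOnWith (3 * C).toNNReal (edgePoint K) J := by
  refine LipschitzOnWith.of_dist_le_mul fun s hs t ht => ?_
  rw [Real.coe_toNNReal _ (by positivity)]
  rcases le_total t s with hts | hts
  · rw [dist_eq_norm, Real.dist_eq, abs_of_nonneg (sub_nonneg.2 hts)]
    exact h.norm_sub_le hC hJ hs ht hts
  · rw [dist_comm, dist_comm s t, dist_eq_norm, Real.dist_eq, abs_of_nonneg (sub_nonneg.2 hts)]
    exact h.norm_sub_le hC hJ ht hs hts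

/-- Equality case of `sin_mul_supp_le`; it makes the fibers of `edgePoint` intervals. -/
theorem edge_inter_subset {a b c : ℝ} (hab : a ≤ c) (hcb : c ≤ b) (hba : b - a < π) :
    edge K a ∩ edge K b ⊆ edge K c := by
  rintro p ⟨hp, hp'⟩
  refine ⟨hp.1, le_antisymm (inner_le_supp hp.1 c) ?_⟩
  rcases (hab.trans hcb).eq_or_lt with rfl | hlt
  · rw [le_antisymm hcb hab, hp.2]
  · have h1 := sin_mul_supp_le K hab hcb hba.le
    rw [← hp.2, ← hp'.2, ← sin_mul_inner_u] at h1
    exact le_of_mul_le_mul_left h1 (sin_pos_of_pos_of_lt_pi (by linarith) hba)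

theorem IsRound.exists_hasSurfaceDensityOn (h : IsRound K J C) (hC : 0 ≤ C) [hJo : J.OrdConnected]
    (hJn : J.Nontrivial) (hJ : ∀ s ∈ J, ∀ t ∈ J, s - t ≤ π / 2) {l r : ℕ → ℝ}
    (hJu : J = ⋃ n, Icc (l n) (r n)) (hJfin : volume J ≠ ⊤) :
    ∃ ρ : ℝ → ℝ≥0, Measurable ρ ∧ HasSurfaceDensityOn K J ρ := by
  obtain ⟨ρ, hρ, H⟩ := exists_density_hausdorffMeasure_image hJu hJfin (h.lipschitzOnWith hC hJ)
    fun a ha b hb hab c hac hcb => by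
      have hc : c ∈ J := hJo.out ha hb ⟨hac, hcb⟩
      have h1 : edgePoint K a ∈ edge K c := edge_inter_subset hac hcb
        (by linarith [hJ b hb a ha, pi_pos]) ⟨edgePoint_mem K a, hab ▸ edgePoint_mem K b⟩
      rw [h.edge_eq hJn hc] at h1
      exact h1.symm
  refine ⟨ρ, hρ, fun X hX hXJ => ?_⟩
  rw [← H X hX hXJ]
  change Measure.hausdorffMeasure 1 (⋃ t ∈ X, edge K t) = _
  congr 1
  rw [image_eq_iUnion]
  exact iUnion₂_congr fun t ht => h.edge_eq hJn (hXJ ht)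

end Round

theorem HasSurfaceDensityOn.ae_eq {K : ConvexBody Plane} {J : Set ℝ} (hJ : MeasurableSet J)
    {ρ ρ' : ℝ → ℝ≥0} (hm : Measurable ρ) (hm' : Measurable ρ') (h : HasSurfaceDensityOn K J ρ)
    (h' : HasSurfaceDensityOn K J ρ') : ρ =ᵐ[volume.restrict J] ρ' := by
  have := ae_eq_of_forall_setLIntegral_eq_of_sigmaFinite (μ := volume.restrict J)
    (f := fun t => (ρ t : ℝ≥0∞)) (g := fun t => (ρ' t : ℝ≥0∞)) (by fun_prop) (by fun_prop)
    fun s hs _ => by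
      rw [Measure.restrict_restrict hs, ← h _ (hs.inter hJ) inter_subset_right,
        ← h' _ (hs.inter hJ) inter_subset_right]
  filter_upwards [this] with t ht
  exact_mod_cast ht

/-! ### Differentiability of the support function -/

section Regularity

variable {K : ConvexBody Plane} {C : ℝ}

theorem hasDerivAt_u (t : ℝ) : HasDerivAt u (v t) t := by
  have h0 : HasDerivAt (fun t => (![cos t, sin t] : Fin 2 → ℝ)) ![-sin t, cos t] t := by
    refine hasDerivAt_pi.2 fun i => ?_
    fin_cases i
    · exact hasDerivAt_cos t
    · exact hasDerivAt_sin t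
  exact ((PiLp.continuousLinearEquiv 2 ℝ fun _ : Fin 2 => ℝ).symm.hasFDerivAt).comp_hasDerivAt t h0

theorem hasDerivAt_v (t : ℝ) : HasDerivAt v (-u t) t := by
  have h := (hasDerivAt_u (t + π / 2)).comp_add_const t (π / 2)
  have h1 : (fun x => u (x + π / 2)) = v := funext u_add_pi_div_two
  have h2 : v (t + π / 2) = -u t := by
    ext i
    fin_cases i <;> simp [u, v, sin_add, cos_add]
  rwa [h1, h2] at h

theorem contDiff_u : ContDiff ℝ 1 u := by
  refine contDiff_euclidean.2 fun i => ?_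
  fin_cases i
  · exact contDiff_cos
  · exact contDiff_sin

theorem contDiff_v : ContDiff ℝ 1 v := by
  refine contDiff_euclidean.2 fun i => ?_
  fin_cases i
  · exact contDiff_sin.neg
  · exact contDiff_cos

/-- Near t the support function lies between those of the edge point and of the disc, which agree to
first order at t. -/
theorem IsRound.hasDerivAt_supp {J : Set ℝ} (h : IsRound K J C) {t : ℝ} (hJ : J ∈ 𝓝 t) :
    HasDerivAt (supp K) (inner ℝ (edgePoint K t) (v t)) t := by
  set D := inner ℝ (edgePoint K t) (v t)
  have hmem := edgePoint_mem K t
  have hs : HasDerivAt (fun s => s - t) 1 t := (hasDerivAt_id t).sub_const t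
  have hsin : HasDerivAt (fun s => sin (s - t)) 1 t := by simpa using hs.sin
  have hcos : HasDerivAt (fun s => cos (s - t)) 0 t := by simpa using hs.cos
  have h1 : HasDerivAt (fun s => supp K t * cos (s - t) + D * sin (s - t)) D t := by
    exact ((hcos.const_mul (supp K t)).fun_add (hsin.const_mul D)).congr_deriv (by simp)
  have h2 : HasDerivAt (fun s => C * (1 - cos (s - t))) 0 t := by
    simpa using (hcos.const_sub 1).const_mul C
  have h3 : HasDerivAt (fun s => supp K s - (supp K t * cos (s - t) + D * sin (s - t))) 0 t := by
    rw [hasDerivAt_iff_isLittleO] at h2 ⊢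
    refine Asymptotics.IsBigO.trans_isLittleO ?_ h2
    refine Asymptotics.IsBigO.of_bound 1 ?_
    filter_upwards [hJ] with s hsJ
    have h4 := h t (mem_of_mem_nhds hJ) _ hmem s hsJ
    have h5 := inner_u_le_supp_of_mem_edge hmem s
    simp only [sub_self, cos_zero, sin_zero, mul_one, mul_zero, add_zero, sub_zero, smul_eq_mul,
      one_mul, norm_eq_abs]
    change _ ≤ supp K t * cos (s - t) + D * sin (s - t) + _ at h4
    change supp K t * cos (s - t) + D * sin (s - t) ≤ _ at h5
    rw [abs_of_nonneg (by linarith)]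
    exact le_trans (by linarith) (le_abs_self _)
  simpa using h3.fun_add h1

/-- The edge point is Lipschitz on [0, π/2), so it extends continuously to the line; integrating the
resulting derivative and using the continuity of `supp K` reaches the endpoint π/2. -/
theorem IsRound.exists_contDiff_eqOn (h : IsRound K (Ico 0 (π / 2)) C) (hC : 0 ≤ C) :
    ∃ H : ℝ → ℝ, ContDiff ℝ 1 H ∧ EqOn (supp K) H (Icc 0 (π / 2)) := by
  obtain ⟨g, hg, hgA⟩ := (h.lipschitzOnWith hC
    fun s hs t ht => by linarith [hs.2, ht.1]).extend_finite_dimension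
  have hD : Continuous fun t => inner ℝ (g t) (v t) := hg.continuous.inner contDiff_v.continuous
  set D := fun t => (inner ℝ (g t) (v t) : ℝ)
  have hder : ∀ t, HasDerivAt (fun t => supp K 0 + ∫ x in (0 : ℝ)..t, D x) (D t) t := fun t =>
    (intervalIntegral.integral_hasDerivAt_right (hD.intervalIntegrable _ _)
      (hD.stronglyMeasurableAtFilter _ _) hD.continuousAt).const_add _
  refine ⟨fun t => supp K 0 + ∫ x in (0 : ℝ)..t, D x, ?_, fun t ht => ?_⟩
  · refine contDiff_one_iff_deriv.2 ⟨fun t => (hder t).differentiableAt, ?_⟩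
    rwa [funext fun t => (hder t).deriv]
  · have := intervalIntegral.integral_eq_sub_of_hasDerivAt_of_le (f := supp K) (f' := D) ht.1
      (continuous_supp K).continuousOn (fun x hx => by
        have hx' : x ∈ Ioo 0 (π / 2) := ⟨hx.1, hx.2.trans_le ht.2⟩
        have h1 := h.hasDerivAt_supp (Ico_mem_nhds hx'.1 hx'.2)
        rwa [hgA (Ioo_subset_Ico_self hx')] at h1) (hD.intervalIntegrable _ _)
    simp only [this]
    ring

end Regularity

/-! ### The injectivity condition -/

theorem supp_add_pi_div_two_eq (K : ConvexBody Plane) (t : ℝ) :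
    supp K (t + π / 2) = supp (mirrorBody K) (π / 2 - t) := by
  rw [supp_mirrorBody]
  ring_nf

theorem mem_edge_mirrorBody {K : ConvexBody Plane} {t : ℝ} {p : Plane} (hp : p ∈ edge K t) :
    reflection p ∈ edge (mirrorBody K) (π - t) := by
  refine ⟨mem_mirrorBody.2 (by rw [reflection_reflection]; exact hp.1), ?_⟩
  rw [inner_reflection_u, supp_mirrorBody, sub_sub_cancel]
  exact hp.2

theorem IsRound.of_mirrorBody {K : ConvexBody Plane} {C : ℝ}
    (h : IsRound (mirrorBody K) (Ico 0 (π / 2)) C) : IsRound K (Ioc (π / 2) π) C := by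
  have hmem : ∀ t ∈ Ioc (π / 2) π, π - t ∈ Ico 0 (π / 2) := fun t ht =>
    ⟨by linarith [ht.2], by linarith [ht.1]⟩
  intro t ht p hp s hs
  have h1 := h _ (hmem t ht) _ (mem_edge_mirrorBody hp) _ (hmem s hs)
  rw [inner_reflection_v, supp_mirrorBody, supp_mirrorBody, sub_sub_cancel, sub_sub_cancel,
    show π - s - (π - t) = -(s - t) by ring, cos_neg, sin_neg] at h1
  have h2 : inner ℝ p (u (π / 2 - (π - t))) = -inner ℝ p (v t) := by
    rw [inner_u, inner_v, show π / 2 - (π - t) = t - π / 2 by ring, cos_sub_pi_div_two,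
      sin_sub_pi_div_two]
    ring
  rw [h2] at h1
  linarith

/-- The support function of `K` is dominated near each angle of `[0, π/2)` by that of a disc
through a given point of the edge, and this point lies to the right of the right wall of the
supporting hallway, with a quantitative bound. -/
def HasRoundArm (K : ConvexBody Plane) (C : ℝ) : Prop :=
  IsRound K (Ico 0 (π / 2)) C ∧ ∀ t ∈ Ioo 0 (π / 2),
    inner ℝ (edgePoint K t) (v t) ≤ supp K (t + π / 2) - 1 - t / 2

theorem IsBalancedMaximumCap.exists_hasRoundArm {K : ConvexBody Plane}
    (hK : IsBalancedMaximumCap (π / 2) K) :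
    ∃ C : ℝ, 0 ≤ C ∧ HasRoundArm K C ∧ HasRoundArm (mirrorBody K) C := by
  obtain ⟨n, L, hn, hn2, hL, hLK⟩ := hK.exists_seq
  have hd0 : Tendsto (fun i => dist (L i) K) atTop (𝓝 0) := tendsto_iff_dist_tendsto_zero.1 hLK
  have hpos : ∀ p ∈ (K : Set Plane), 0 ≤ p 1 := fun p hp => hK.isCap.nonneg hp
  obtain ⟨C₁, hC₁, h₁⟩ := exists_supp_le_of_limit hpos hn.tendsto_atTop hL
    (fun i t => abs_supp_sub_le (L i) K t) hd0
  obtain ⟨C₂, hC₂, h₂⟩ := exists_supp_le_of_limit (K := mirrorBody K)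
    (L := fun i => mirrorBody (L i)) (fun p hp => by simpa using hpos _ (mem_mirrorBody.1 hp))
    hn.tendsto_atTop (fun i => (hL i).mirrorBody (zero_lt_one.trans (hn2 i).1))
    (fun i t => by
      rw [supp_mirrorBody, supp_mirrorBody]
      exact abs_supp_sub_le (L i) K _) hd0
  have aux : ∀ (K' : ConvexBody Plane) (C : ℝ), (∀ t ∈ Ico 0 (π / 2), ∀ p ∈ edge K' t,
      (∀ s ∈ Icc 0 (π / 2), supp K' s ≤ supp K' t * cos (s - t) + inner ℝ p (v t) * sin (s - t) +
        C * (1 - cos (s - t))) ∧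
      (0 < t → inner ℝ p (v t) ≤ supp K' (t + π / 2) - 1 - t / 2)) → C ≤ max C₁ C₂ →
      HasRoundArm K' (max C₁ C₂) := by
    intro K' C h hC
    refine ⟨fun t ht p hp s hs => ?_, fun t ht => ?_⟩
    · have h3 := (h t ht p hp).1 s (Ico_subset_Icc_self hs)
      have h4 := mul_le_mul_of_nonneg_right hC (sub_nonneg.2 (cos_le_one (s - t)))
      linarith
    · exact (h t (Ioo_subset_Ico_self ht) _ (edgePoint_mem K' t)).2 ht.1
  exact ⟨max C₁ C₂, hC₁.trans (le_max_left _ _), aux _ _ h₁ (le_max_left _ _),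
    aux _ _ h₂ (le_max_right _ _)⟩

theorem Ico_eq_iUnion_Icc (a b : ℝ) : Ico a b = ⋃ n : ℕ, Icc a (b - 1 / (n + 1)) := by
  ext t
  simp only [mem_Ico, mem_iUnion, mem_Icc]
  refine ⟨fun h => ?_, fun ⟨n, h⟩ => ⟨h.1, h.2.trans_lt (sub_lt_self _ (by positivity))⟩⟩
  obtain ⟨n, hn⟩ := exists_nat_one_div_lt (sub_pos.2 h.2)
  exact ⟨n, h.1, by linarith⟩

theorem Ioc_eq_iUnion_Icc (a b : ℝ) : Ioc a b = ⋃ n : ℕ, Icc (a + 1 / (n + 1)) b := by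
  ext t
  simp only [mem_Ioc, mem_iUnion, mem_Icc]
  refine ⟨fun h => ?_, fun ⟨n, h⟩ => ⟨(lt_add_of_pos_right _ (by positivity)).trans_le h.1, h.2⟩⟩
  obtain ⟨n, hn⟩ := exists_nat_one_div_lt (sub_pos.2 h.1)
  exact ⟨n, by linarith, h.2⟩

theorem IsDensityPair.ae_eq {K : ConvexBody Plane} {r s r' s' : ℝ → ℝ≥0}
    (h : IsDensityPair K r s) (h' : IsDensityPair K r' s') :
    r' =ᵐ[volume.restrict (Icc 0 (π / 2))] r ∧ s' =ᵐ[volume.restrict (Icc 0 (π / 2))] s := by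
  constructor
  · rw [← Measure.restrict_congr_set Ico_ae_eq_Icc]
    exact h'.2.2.1.ae_eq measurableSet_Ico h'.1 h.1 h.2.2.1
  · rw [← Measure.restrict_congr_set Ioc_ae_eq_Icc]
    have h1 := h'.2.2.2.ae_eq measurableSet_Ioc (h'.2.1.comp (measurable_id.sub_const _))
      (h.2.1.comp (measurable_id.sub_const _)) h.2.2.2
    have h2 : MeasurePreserving (fun t : ℝ => t + π / 2) (volume.restrict (Ioc 0 (π / 2)))
        (volume.restrict (Ioc (π / 2) π)) := by
      have h3 := (measurePreserving_add_right (volume : Measure ℝ) (π / 2)).restrict_preimage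
        (measurableSet_Ioc (a := π / 2) (b := π))
      rwa [preimage_add_const_Ioc, sub_self, sub_half] at h3
    filter_upwards [h2.quasiMeasurePreserving.ae h1] with t ht
    simpa using ht

theorem HasRoundArm.exists_isDensityPair {K : ConvexBody Plane} {C : ℝ} (hC : 0 ≤ C)
    (h : HasRoundArm K C) (h' : HasRoundArm (mirrorBody K) C) :
    ∃ r s : ℝ → ℝ≥0, IsDensityPair K r s := by
  have hπ := pi_pos
  obtain ⟨r, hr, hr'⟩ := h.1.exists_hasSurfaceDensityOn hC
    ⟨0, ⟨le_rfl, by positivity⟩, π / 4, ⟨by positivity, by linarith⟩, by positivity⟩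
    (fun s hs t ht => by linarith [hs.2, ht.1]) (Ico_eq_iUnion_Icc _ _) (by simp)
  obtain ⟨s, hs, hs'⟩ := h'.1.of_mirrorBody.exists_hasSurfaceDensityOn hC
    ⟨π, ⟨by linarith, le_rfl⟩, 3 * π / 4, ⟨by linarith, by linarith⟩, by linarith⟩
    (fun s hs t ht => by linarith [hs.2, ht.1]) (Ioc_eq_iUnion_Icc _ _) (by simp)
  exact ⟨r, fun t => s (t + π / 2), hr, hs.comp (measurable_id.add_const _), hr', by
    simpa using hs'⟩

/-- The coefficient of v_t is read off the mirror image at π/2 - t, so both coefficients are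
restrictions of C¹ functions, endpoints included. -/
theorem HasRoundArm.contDiffOn_innerCorner {K : ConvexBody Plane} {C : ℝ} (hC : 0 ≤ C)
    (h : HasRoundArm K C) (h' : HasRoundArm (mirrorBody K) C) :
    ContDiffOn ℝ 1 (innerCorner K) (Icc 0 (π / 2)) := by
  obtain ⟨H, hH, hHK⟩ := h.1.exists_contDiff_eqOn hC
  obtain ⟨G, hG, hGK⟩ := h'.1.exists_contDiff_eqOn hC
  have key : ContDiff ℝ 1 fun t => (H t - 1) • u t + (G (π / 2 - t) - 1) • v t :=
    ((hH.sub contDiff_const).smul contDiff_u).add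
      (((hG.comp (contDiff_const.sub contDiff_id)).sub contDiff_const).smul contDiff_v)
  refine key.contDiffOn.congr fun t ht => ?_
  rw [innerCorner, supp_add_pi_div_two_eq, hHK ht, hGK ⟨by linarith [ht.2], by linarith [ht.1]⟩]

/-- The velocity of the inner corner in the frame of the supporting hallway. -/
theorem HasRoundArm.hasDerivAt_innerCorner {K : ConvexBody Plane} {C : ℝ}
    (h : HasRoundArm K C) (h' : HasRoundArm (mirrorBody K) C) {t : ℝ} (ht : t ∈ Ioo 0 (π / 2)) :
    ∃ a b : ℝ, a < 0 ∧ 0 < b ∧ HasDerivAt (innerCorner K) (a • u t + b • v t) t := by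
  have ht' : π / 2 - t ∈ Ioo 0 (π / 2) := ⟨by linarith [ht.2], by linarith [ht.1]⟩
  set D := inner ℝ (edgePoint K t) (v t)
  set E := inner ℝ (edgePoint (mirrorBody K) (π / 2 - t)) (v (π / 2 - t))
  have hD : D ≤ supp K (t + π / 2) - 1 - t / 2 := h.2 t ht
  have hE : E ≤ supp K t - 1 - (π / 2 - t) / 2 := by
    have := h'.2 _ ht'
    rwa [supp_mirrorBody, show π - (π / 2 - t + π / 2) = t by ring] at this
  have h1 : HasDerivAt (supp K) D t := h.1.hasDerivAt_supp (Ico_mem_nhds ht.1 ht.2)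
  have h2 : HasDerivAt (fun t => supp K (t + π / 2)) (-E) t := by
    have h3 := (h'.1.hasDerivAt_supp (Ico_mem_nhds ht'.1 ht'.2)).comp_const_sub (π / 2) t
    exact h3.congr_of_eventuallyEq (Eventually.of_forall fun t => supp_add_pi_div_two_eq K t)
  -- The coefficients satisfy a ≤ -t/2 and b ≥ (π/2 - t)/2: the linear terms of the arm bounds keep
  -- the inequalities strict in the limit.
  refine ⟨D - (supp K (t + π / 2) - 1), supp K t - 1 - E, by linarith [ht.1], by linarith [ht'.1],
    (((h1.sub_const 1).smul (hasDerivAt_u t)).add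
      ((h2.sub_const 1).smul (hasDerivAt_v t))).congr_deriv ?_⟩
  module

/-- The horizontal velocity a cos t - b sin t is negative. -/
theorem injOn_of_hasDerivAt_frame {f : ℝ → Plane} (hf : ContinuousOn f (Icc 0 (π / 2)))
    (hf' : ∀ t ∈ Ioo 0 (π / 2), ∃ a b : ℝ, a < 0 ∧ 0 < b ∧ HasDerivAt f (a • u t + b • v t) t) :
    InjOn f (Icc 0 (π / 2)) := by
  have hanti : StrictAntiOn (fun t => f t 0) (Icc 0 (π / 2)) := by
    refine strictAntiOn_of_deriv_neg (convex_Icc _ _)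
      ((EuclideanSpace.proj (𝕜 := ℝ) (0 : Fin 2)).continuous.comp_continuousOn hf) fun t ht => ?_
    rw [interior_Icc] at ht
    obtain ⟨a, b, ha, hb, hd⟩ := hf' t ht
    have h1 : HasDerivAt (fun t => f t 0) ((a • u t + b • v t) 0) t :=
      (EuclideanSpace.proj (𝕜 := ℝ) (0 : Fin 2)).hasFDerivAt.comp_hasDerivAt t hd
    rw [h1.deriv]
    have hs : 0 < sin t := sin_pos_of_pos_of_lt_pi ht.1 (by linarith [ht.2, pi_pos])
    have hc : 0 < cos t := cos_pos_of_mem_Ioo ⟨by linarith [ht.1, pi_pos], ht.2⟩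
    simp only [PiLp.add_apply, PiLp.smul_apply, u_apply_zero, v_apply_zero, smul_eq_mul]
    nlinarith [mul_pos (neg_pos.2 ha) hc, mul_pos hb hs]
  intro s hs t ht hst
  exact hanti.injOn hs ht (congrArg (fun p : Plane => p 0) hst)

end Sofa

end

theorem mainTheorem2 (K : ConvexBody Sofa.Plane) (hK : Sofa.IsBalancedMaximumCap (π / 2) K) :
    Sofa.InjectivityCondition K ∧ Set.InjOn (Sofa.innerCorner K) (Set.Icc 0 (π / 2)) := by
  obtain ⟨C, hC, h, h'⟩ := hK.exists_hasRoundArm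
  have hcont := h.contDiffOn_innerCorner hC h'
  obtain ⟨r, s, hrs⟩ := h.exists_isDensityPair hC h'
  refine ⟨⟨⟨r, s, hrs, fun r' s' h1 => hrs.ae_eq h1⟩, hcont, fun t ht => ?_, fun t ht => ?_⟩,
    Sofa.injOn_of_hasDerivAt_frame hcont.continuousOn fun t ht => h.hasDerivAt_innerCorner h' ht⟩
  · obtain ⟨a, b, ha, -, hd⟩ := h.hasDerivAt_innerCorner h' ht
    rwa [hd.deriv, Sofa.inner_frame_u]
  · obtain ⟨a, b, -, hb, hd⟩ := h.hasDerivAt_innerCorner h' ht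
    rwa [hd.deriv, Sofa.inner_frame_v]
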